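/- Fix $p\ge 0$. Let $(Y_i,\mathbf X_i,A_i)$, $i=1,\dots,n$, be i.i.d., where $\mathbf X_i\in\mathbb R^{p+1}$, $A_i\in\{0,1\}$ is the treatment indicator, $(\mathbf X_i,A_i)$ has a fixed law $\rho$, and given $(\mathbf X_i,A_i)$ the response $Y_i$ has density (with respect to a $\sigma$-finite measure $\nu$ on $\mathbb R$) $$f(y\mid\gamma_i)=\exp\Big\{\frac{y\gamma_i-b(\gamma_i)}{a(\phi)}+c(y,\phi)\Big\},\qquad g(\mu_i)=\eta_i=\boldsymbol\theta_0^\top\mathbf X_i+(\boldsymbol\beta^\top\mathbf X_i)A_i,\quad \mu_i=b'(\gamma_i),$$ with $a(\phi)>0$ known. Here $\gamma$ ranges over an open interval $\Gamma$ on which the densities are normalized and $b''>0$; the link $g$ is one-to-one and twice continuously differentiable with $g'\neq0$ on the mean space $b'(\Gamma)$. For parameters $\boldsymbol\theta,\boldsymbol\beta$ write $\mu_i=\mu_i(\boldsymbol\beta,\boldsymbol\theta)$ for the mean and $V_i=V_i(\boldsymbol\beta,\boldsymbol\theta)=b''(\gamma_i)$. The score of the treatment group is $$\mathbf S_n^{(1)}(\boldsymbol\theta,\boldsymbol\beta)=\sum_{i\le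 n,\,A_i=1}\frac{\partial\mu_i}{\partial\boldsymbol\beta}\,\frac{Y_i-\mu_i}{a(\phi)V_i}.$$ Let $\boldsymbol\beta_0=\mathbf 0$ and put $$\overline{\mathbf I}_n^{(1)}(\boldsymbol\beta_0;\boldsymbol\theta)=-\frac1n\frac{\partial\mathbf S_n^{(1)}}{\partial\boldsymbol\beta}(\boldsymbol\theta,\boldsymbol\beta_0),\qquad \overline{\mathbf I}_n^{(1)}(\boldsymbol\theta)=-\frac1n\frac{\partial\mathbf S_n^{(1)}}{\partial\boldsymbol\theta}(\boldsymbol\theta,\boldsymbol\beta_0).$$ Let $\mathbf I^{(1)}(\boldsymbol\beta_0)$ and $\mathbf I^{(1)}(\boldsymbol\theta_0)$ be the expectations of these two matrices at $\boldsymbol\theta=\boldsymbol\theta_0$ when $(\boldsymbol\theta_0,\boldsymbol\beta_0)$ are the true parameters. Assume the following. (i) There is $\varepsilon>0$ such that, almost surely, $\eta_i\in g(b'(\Gamma))$ for all $\boldsymbol\theta,\boldsymbol\beta$ with $|\boldsymbol\theta-\boldsymbol\theta_0|<\varepsilon$ and $|\boldsymbol\beta-\boldsymbol\beta_0|<\varepsilon$,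 and the derivative with respect to $\boldsymbol\beta$ of the score of one treated observation is bounded, uniformly over these $\boldsymbol\theta,\boldsymbol\beta$, by a function of the observation that is integrable under $(\boldsymbol\theta_0,\boldsymbol\beta_0)$; and $\mathbf I^{(1)}(\boldsymbol\beta_0)$ is invertible. (ii) $\hat{\boldsymbol\theta}=\hat{\boldsymbol\theta}_n$ is an estimator (for instance a penalized likelihood estimator) computed from the control group ($A_i=0$) that has the oracle property: with $\mathcal A=\{j:\theta_{0,j}\ne0\}$, $P(\{j:\hat\theta_j\neq0\}=\mathcal A)\to1$ and $\sqrt n(\hat{\boldsymbol\theta}_{\mathcal A}-\boldsymbol\theta_{0,\mathcal A})\xrightarrow{d}N(\mathbf 0,\boldsymbol\Sigma^*)$. Let $\boldsymbol\Sigma(\boldsymbol\theta_0)$ be the $(p+1)\times(p+1)$ matrix obtained by extending $\boldsymbol\Sigma^*$ by zeros. (iii) $\hat{\boldsymbol\Sigma}(\hat{\boldsymbol\theta})$ is computed from the control group and converges in probability to $\boldsymbol\Sigma(\boldsymbol\theta_0)$. Put $\overline{\mathbf S}_n=\frac1n\mathbf S_n^{(1)}(\hat{\boldsymbol\theta},\boldsymbol\beta_0)$,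 $\overline{\mathbf V}_n(\hat{\boldsymbol\theta})=\overline{\mathbf I}_n^{(1)}(\hat{\boldsymbol\theta})+\overline{\mathbf I}_n^{(1)}(\hat{\boldsymbol\theta})\hat{\boldsymbol\Sigma}(\hat{\boldsymbol\theta})\overline{\mathbf I}_n^{(1)}(\hat{\boldsymbol\theta})$, $\mathbf V(\boldsymbol\theta_0)=\mathbf I^{(1)}(\boldsymbol\theta_0)+\mathbf I^{(1)}(\boldsymbol\theta_0)\boldsymbol\Sigma(\boldsymbol\theta_0)\mathbf I^{(1)}(\boldsymbol\theta_0)$, and, with $\psi_{(\mathbf m,\mathbf C)}$ the density of the multivariate normal law with mean $\mathbf m$ and covariance matrix $\mathbf C$, $$\tilde\Lambda_n=2\log\frac{\sup_{\boldsymbol\beta\in H_1}\psi_{\left(\overline{\mathbf I}_n^{(1)}(\boldsymbol\beta_0;\hat{\boldsymbol\theta})(\boldsymbol\beta-\boldsymbol\beta_0),\,\overline{\mathbf V}_n(\hat{\boldsymbol\theta})/n\right)}(\overline{\mathbf S}_n)}{\psi_{\left(\mathbf 0,\,\overline{\mathbf V}_n(\hat{\boldsymbol\theta})/n\right)}(\overline{\mathbf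 S}_n)},$$ where the supremum is over all $\boldsymbol\beta=\boldsymbol\beta_0+\boldsymbol\delta'/\sqrt n$ with $\boldsymbol\delta'\neq\mathbf 0$. Then, under $H_0:\boldsymbol\beta=\boldsymbol\beta_0=\mathbf 0$, $\tilde\Lambda_n$ converges in distribution to the central chi-squared law $\chi^2_{p+1}$; and for every $\boldsymbol\delta\ne\mathbf 0$, under $H_1:\boldsymbol\beta=\boldsymbol\beta_0+\boldsymbol\delta/\sqrt n$, $\tilde\Lambda_n$ converges in distribution to the noncentral chi-squared law $\chi^2_{p+1}(u_1)$ with noncentrality $$u_1=\boldsymbol\delta^\top\mathbf I^{(1)}(\boldsymbol\beta_0)\,\mathbf V(\boldsymbol\theta_0)^{-1}\,\mathbf I^{(1)}(\boldsymbol\beta_0)\,\boldsymbol\delta.$$ -/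

import Mathlib

open MeasureTheory ProbabilityTheory Filter Topology Matrix

noncomputable section

namespace POST

/-! ### Convergence in law -/

/-- Convergence in law of `X n` (under `P n`) to `Q`: the probabilities of every continuity set of
`Q` converge. -/
def ConvergesInLaw {E : Type*} [TopologicalSpace E] [MeasurableSpace E] {Ω : ℕ → Type*}
    [∀ n, MeasurableSpace (Ω n)] (P : ∀ n, Measure (Ω n)) (X : ∀ n, Ω n → E)
    (Q : Measure E) : Prop :=
  ∀ B : Set E, MeasurableSet B → Q (frontier B) = 0 →
    Tendsto (fun n => P n {ω | X n ω ∈ B}) atTop (𝓝 (Q B))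

/-- The chi-squared law with `k` degrees of freedom and noncentrality `u ≥ 0`: the law of
`∑ Zᵢ²` for independent `Zᵢ ~ N(mᵢ, 1)`, where `m = (√u, 0, …, 0)`, so that `∑ mᵢ² = u`.
For `u = 0` it is the central law. -/
def chiSquared (k : ℕ) (u : ℝ) : Measure ℝ :=
  (Measure.pi fun i : Fin k => gaussianReal (if i.val = 0 then Real.sqrt u else 0) 1).map
    fun z => ∑ i, z i ^ 2

/-! ### Generalized linear models -/

/-- The ingredients of a generalized linear model: a dominating measure `ν`, the functions
`a`, `b`, `c` and the dispersion `φ` of the exponential family, the open set `Γ` of admissible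
canonical parameters, and the link function `g`. -/
structure GLM where
  ν : Measure ℝ
  a : ℝ → ℝ
  φ : ℝ
  b : ℝ → ℝ
  c : ℝ → ℝ → ℝ
  Γ : Set ℝ
  g : ℝ → ℝ

/-- The density `exp {(y γ - b γ) / a φ + c (y, φ)}` of the response. -/
def GLM.density (M : GLM) (γ y : ℝ) : ℝ :=
  Real.exp ((y * γ - M.b γ) / M.a M.φ + M.c y M.φ)

/-- The data define a genuine generalized linear model: the densities are normalized,
the variance `a φ * b'' γ` is positive, and the link is a twice continuously differentiable
one-to-one function of the mean with nonvanishing derivative. -/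
structure GLM.IsRegular (M : GLM) : Prop where
  sigmaFinite : SigmaFinite M.ν
  a_pos : 0 < M.a M.φ
  measurable_c : Measurable fun y => M.c y M.φ
  isOpen : IsOpen M.Γ
  ordConnected : M.Γ.OrdConnected
  normalized : ∀ γ ∈ M.Γ, ∫⁻ y, ENNReal.ofReal (M.density γ y) ∂M.ν = 1
  variance_pos : ∀ γ ∈ M.Γ, 0 < deriv (deriv M.b) γ
  link_contDiff : ContDiffOn ℝ 2 M.g (deriv M.b '' M.Γ)
  link_injOn : Set.InjOn M.g (deriv M.b '' M.Γ)
  link_deriv_ne : ∀ m ∈ deriv M.b '' M.Γ, deriv M.g m ≠ 0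

/-- The values `g (b' γ)` that the linear predictor may take. -/
def GLM.predictorRange (M : GLM) : Set ℝ := (fun γ => M.g (deriv M.b γ)) '' M.Γ

/-- The canonical parameter `γ` with `g (b' γ) = η`. -/
def GLM.canonical (M : GLM) (η : ℝ) : ℝ :=
  Function.invFunOn (fun γ => M.g (deriv M.b γ)) M.Γ η

/-! ### The data -/

/-- `(p+1)`-dimensional vectors. -/
abbrev Vec (p : ℕ) := EuclideanSpace ℝ (Fin (p + 1))

/-- `(p+1) × (p+1)` matrices. -/
abbrev Mat (p : ℕ) := Matrix (Fin (p + 1)) (Fin (p + 1)) ℝ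

/-- One observation `((X, A), Y)`; `A = true` means treatment. -/
abbrev Obs (p : ℕ) := (Vec p × Bool) × ℝ

variable {p : ℕ}

/-- `η = θᵀ x + (βᵀ x) a`. -/
def linPred (θ β x : Vec p) (a : Bool) : ℝ :=
  inner ℝ θ x + inner ℝ β x * (if a then 1 else 0)

/-- The mean `μ(β, θ) = b' (γ)` of the response given `x` and `a`. -/
def GLM.mean (M : GLM) (θ β x : Vec p) (a : Bool) : ℝ :=
  deriv M.b (M.canonical (linPred θ β x a))

/-- `V(β, θ) = b'' (γ)`, so that `a φ * V` is the variance of the response given `x` and `a`. -/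
def GLM.varFun (M : GLM) (θ β x : Vec p) (a : Bool) : ℝ :=
  deriv (deriv M.b) (M.canonical (linPred θ β x a))

/-- The law of one observation: `(X, A)` has law `ρ`, and `Y` given `(X, A)` has the density of
the generalized linear model with parameters `θ`, `β`. -/
def GLM.obsLaw (M : GLM) (ρ : Measure (Vec p × Bool)) (θ β : Vec p) : Measure (Obs p) :=
  (ρ.prod M.ν).withDensity fun o =>
    ENNReal.ofReal (M.density (M.canonical (linPred θ β o.1.1 o.1.2)) o.2)

/-- The law of an i.i.d. sample of size `n`. -/
def GLM.sampleLaw (M : GLM) (ρ : Measure (Vec p × Bool)) (θ β : Vec p) (n : ℕ) :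
    Measure (Fin n → Obs p) :=
  Measure.pi fun _ => M.obsLaw ρ θ β

/-- What an observation contributes to the control-group data: the treatment indicator,
and `(X, Y)` for control subjects only. -/
def controlPart (o : Obs p) : Obs p := if o.1.2 then ((0, true), 0) else o

/-- The control-group data of a sample. -/
def controlData {n : ℕ} (d : Fin n → Obs p) : Fin n → Obs p := fun i => controlPart (d i)

/-! ### Score and information of the treatment group -/

/-- The score contribution `∂μ/∂β * (Y - μ) / (a φ * V)` of a treated subject; control subjects
contribute nothing. -/
def GLM.obsScore (M : GLM) (θ β : Vec p) (o : Obs p) : Vec p :=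
  if o.1.2 then
    ((o.2 - M.mean θ β o.1.1 o.1.2) / (M.a M.φ * M.varFun θ β o.1.1 o.1.2)) •
      gradient (fun β' => M.mean θ β' o.1.1 o.1.2) β
  else 0

/-- The score `S_{n,β}^{(1)}(θ, β)` of the treatment group. -/
def GLM.score (M : GLM) {n : ℕ} (d : Fin n → Obs p) (θ β : Vec p) : Vec p :=
  ∑ i, M.obsScore θ β (d i)

/-- The Jacobian matrix of `F` at `v`. -/
def jacobian (F : Vec p → Vec p) (v : Vec p) : Mat p :=
  Matrix.of fun i j => (fderiv ℝ F v (EuclideanSpace.single j 1)) i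

/-- `-(1/n) ∂S_{n,β}^{(1)}(θ, β)/∂β`. -/
def GLM.infoBetaBar (M : GLM) {n : ℕ} (d : Fin n → Obs p) (θ β : Vec p) : Mat p :=
  -((n : ℝ)⁻¹ • jacobian (fun β' => M.score d θ β') β)

/-- `-(1/n) ∂S_{n,β}^{(1)}(θ, β)/∂θ`. -/
def GLM.infoThetaBar (M : GLM) {n : ℕ} (d : Fin n → Obs p) (θ β : Vec p) : Mat p :=
  -((n : ℝ)⁻¹ • jacobian (fun θ' => M.score d θ' β) θ)

/-- `I^{(1)}(β)`: the expectation, under the parameters `θ`, `β`, of `infoBetaBar`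
(by the i.i.d. assumption, of its value for one observation). -/
def GLM.infoBeta (M : GLM) (ρ : Measure (Vec p × Bool)) (θ β : Vec p) : Mat p :=
  Matrix.of fun i j => ∫ o, -(jacobian (fun β' => M.obsScore θ β' o) β i j) ∂M.obsLaw ρ θ β

/-- `I^{(1)}(θ)`: the expectation, under the parameters `θ`, `β`, of `infoThetaBar`
(by the i.i.d. assumption, of its value for one observation). -/
def GLM.infoTheta (M : GLM) (ρ : Measure (Vec p × Bool)) (θ β : Vec p) : Mat p :=
  Matrix.of fun i j => ∫ o, -(jacobian (fun θ' => M.obsScore θ' β o) θ i j) ∂M.obsLaw ρ θ β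

/-- `J + J S J`. -/
def sandwich (J S : Mat p) : Mat p := J + J * S * J

/-- Standard regularity of the model at `(θ₀, β₀)`: near these parameters the linear predictor
almost surely stays in the admissible range, and the derivative of a treated subject's score is
dominated by an integrable function. -/
def GLM.RegularAt (M : GLM) (ρ : Measure (Vec p × Bool)) (θ₀ β₀ : Vec p) : Prop :=
  ∃ ε > 0,
    (∀ᵐ z ∂ρ, ∀ θ ∈ Metric.ball θ₀ ε, ∀ β ∈ Metric.ball β₀ ε,
      linPred θ β z.1 z.2 ∈ M.predictorRange) ∧
    ∃ G : Obs p → ℝ, Integrable G (M.obsLaw ρ θ₀ β₀) ∧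
      ∀ᵐ o ∂M.obsLaw ρ θ₀ β₀, ∀ θ ∈ Metric.ball θ₀ ε, ∀ β ∈ Metric.ball β₀ ε,
        ‖fderiv ℝ (fun β' => M.obsScore θ β' o) β‖ ≤ G o

/-! ### The estimator of the nuisance parameter -/

/-- The index set of the nonzero coordinates of `θ₀`. -/
abbrev Active (θ₀ : Vec p) := {j : Fin (p + 1) // θ₀ j ≠ 0}

open Classical in
/-- A matrix indexed by the active coordinates, extended by zero. -/
def padMatrix (θ₀ : Vec p) (S : Matrix (Active θ₀) (Active θ₀) ℝ) : Mat p :=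
  Matrix.of fun i j =>
    if h : θ₀ i ≠ 0 ∧ θ₀ j ≠ 0 then S ⟨i, h.1⟩ ⟨j, h.2⟩ else 0

open Classical in
/-- The oracle property of `θhat`: selection consistency, and asymptotic normality, with
covariance matrix `Sstar`, of the active coordinates. -/
structure OracleProperty {Ω : ℕ → Type*} [∀ n, MeasurableSpace (Ω n)]
    (P : ∀ n, Measure (Ω n)) (θhat : ∀ n, Ω n → Vec p) (θ₀ : Vec p)
    (Sstar : Matrix (Active θ₀) (Active θ₀) ℝ) : Prop where
  selection : Tendsto (fun n => P n {ω | ∀ j, θhat n ω j ≠ 0 ↔ θ₀ j ≠ 0}) atTop (𝓝 1)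
  normality : ConvergesInLaw P
    (fun n ω => WithLp.toLp 2 fun j : Active θ₀ => Real.sqrt n * (θhat n ω j - θ₀ j))
    (multivariateGaussian (0 : EuclideanSpace ℝ (Active θ₀)) Sstar)

/-! ### The test statistic -/

/-- The density at `x` of the normal law with mean `m` and covariance matrix `S`. -/
def normalDensity (m : Vec p) (S : Mat p) (x : Vec p) : ℝ :=
  (Real.sqrt ((2 * Real.pi) ^ (p + 1) * S.det))⁻¹ *
    Real.exp (-((x - m).ofLp ⬝ᵥ (S⁻¹ *ᵥ (x - m).ofLp)) / 2)

/-- The values of `β` under the alternative: `β₀ + δ / √n` with `δ ≠ 0`. -/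
def alternatives (n : ℕ) (β₀ : Vec p) : Set (Vec p) :=
  {β | ∃ δ : Vec p, δ ≠ 0 ∧ β = β₀ + (Real.sqrt n)⁻¹ • δ}

/-- The statistic `Λ̃_n`, where `θhat` estimates `θ` and `Shat θ` estimates the asymptotic
covariance matrix of that estimator. -/
def GLM.llr (M : GLM) {n : ℕ} (β₀ θhat : Vec p) (Shat : Vec p → Mat p)
    (d : Fin n → Obs p) : ℝ :=
  let Sbar : Vec p := (n : ℝ)⁻¹ • M.score d θhat β₀
  let Vbar : Mat p := sandwich (M.infoThetaBar d θhat β₀) (Shat θhat)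
  let C : Mat p := (n : ℝ)⁻¹ • Vbar
  let shift : Vec p → Vec p := fun β =>
    WithLp.toLp 2 (M.infoBetaBar d θhat β₀ *ᵥ (β - β₀).ofLp)
  2 * Real.log
    (sSup ((fun β => normalDensity (shift β) C Sbar) '' alternatives n β₀) /
      normalDensity 0 C Sbar)

end POST

end

/-! A treated subject has linear predictor θ·x + β·x, so the score depends on (θ, β) only through θ
+ β (`obsScore_eq`). Hence the two information matrices are one matrix J (`infoTheta_eq`), and by
the information identity J is also the covariance matrix of the score of one observation.

The supremum in the statistic can be computed. If the estimated information is invertible, the means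
allowed by the alternative are exactly the nonzero vectors. These are dense, so the supremum is the
peak of the normal density, and twice the log ratio is zᵀ V̄⁻¹ z, where z is n^(-1/2) times the
score at the estimator (`llr_eq`).

A Taylor expansion at θ₀ gives z = U − J̄ v + ‖v‖ e, where U is the normalized score at θ₀, v = √n
(θ̂ − θ₀), J̄ is the sample information and e → 0 in probability (`exists_score_expansion`). By
selection consistency v is, with high probability, the active error W padded by zeros. Under the
null hypothesis (U, W) tends to N(0, J) ⊗ N(0, Σ*). The delicate point is the independence: U and
the control data share the random treatment indicators. In `conditional_clt` the characteristic
function of U is conditioned on the control data; it is then a product over the treated subjects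
that converges in L² to a constant. So z tends to N(0, J + JΣJ), and its Mahalanobis norm is
chi-squared.

For β = δ/√n the log-likelihood ratio is δ·U − δᵀJδ/2 + o(1) (`tendsto_logLik_expansion`). Le Cam's
third lemma (`WeaklyTendsto.tilt`) tilts the joint limit by exp(δ·u − δᵀJδ/2), which moves the mean
of U to Jδ and does not touch W. Le Cam's first lemma (`WeaklyTendsto.contiguous`) carries every
statement that holds with high probability under the null over to the alternatives. So z tends to
N(Jδ, V), whose Mahalanobis norm is noncentral chi-squared; δ = 0 gives the null law.

The analytic input is an integrable envelope for the oscillation of the score derivative near θ₀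
(`exists_envelope`). It controls the Taylor remainders and allows evaluation at the random point θ̂.
Measurability of the statistic is never established: convergence in probability is expressed by the
filter `whp` of outer probabilities, and Slutsky's lemma is proved in that setting. -/

noncomputable section

namespace POST

section

/-! ### Convergence with high probability -/

section HighProbability

variable {Ω : ℕ → Type*} [∀ n, MeasurableSpace (Ω n)]

/-- The sets of outcomes whose (outer) probability under `P n` tends to one. A random sequence
converges in probability iff it converges along this filter. -/
def whp (P : ∀ n, Measure (Ω n)) : Filter (Σ n, Ω n) where
  sets := {S | Tendsto (fun n => P n {ω | (⟨n, ω⟩ : Σ n, Ω n) ∉ S}) atTop (𝓝 0)}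
  univ_sets := by simp
  sets_of_superset := by
    intro S T hS hST
    exact tendsto_of_tendsto_of_tendsto_of_le_of_le tendsto_const_nhds hS (fun _ => zero_le)
      fun n => measure_mono fun ω hω h => hω (hST h)
  inter_sets := by
    intro S T hS hT
    have h := hS.add hT
    rw [add_zero] at h
    refine tendsto_of_tendsto_of_tendsto_of_le_of_le tendsto_const_nhds h (fun _ => zero_le)
      fun n => (measure_mono fun ω hω => ?_).trans (measure_union_le _ _)
    by_contra hc
    simp only [Set.mem_union, Set.mem_ofPred_eq, not_or, not_not] at hc
    exact hω ⟨hc.1, hc.2⟩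

lemma eventually_whp {P : ∀ n, Measure (Ω n)} {p : (Σ n, Ω n) → Prop} :
    (∀ᶠ x in whp P, p x) ↔ Tendsto (fun n => P n {ω | ¬ p ⟨n, ω⟩}) atTop (𝓝 0) :=
  Iff.rfl

lemma eventually_whp_of_ae {P : ∀ n, Measure (Ω n)} {p : (Σ n, Ω n) → Prop}
    (h : ∀ᶠ n in atTop, ∀ᵐ ω ∂P n, p ⟨n, ω⟩) : ∀ᶠ x in whp P, p x := by
  rw [eventually_whp]
  refine tendsto_const_nhds.congr' ?_
  filter_upwards [h] with n hn
  exact (ae_iff.1 hn).symm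

lemma tendsto_fst_whp (P : ∀ n, Measure (Ω n)) : Tendsto Sigma.fst (whp P) atTop := by
  intro S hS
  exact eventually_whp_of_ae (p := fun x => x.1 ∈ S) (by
    filter_upwards [hS] with n hn
    exact Eventually.of_forall fun _ => hn)

variable {E : Type*} [TopologicalSpace E] [MeasurableSpace E]

/-- Weak convergence of the laws of `X n` under `P n`, in terms of open sets. -/
def WeaklyTendsto (P : ∀ n, Measure (Ω n)) (X : ∀ n, Ω n → E) (μ : Measure E) : Prop :=
  ∀ G : Set E, IsOpen G → μ G ≤ liminf (fun n => P n (X n ⁻¹' G)) atTop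

lemma WeaklyTendsto.limsup_closed_le [OpensMeasurableSpace E] {P : ∀ n, Measure (Ω n)}
    [∀ n, IsProbabilityMeasure (P n)] {X : ∀ n, Ω n → E} (hX : ∀ n, Measurable (X n))
    {μ : Measure E} [IsProbabilityMeasure μ] (h : WeaklyTendsto P X μ) {F : Set E}
    (hF : IsClosed F) : limsup (fun n => P n (X n ⁻¹' F)) atTop ≤ μ F := by
  have : ∀ n, IsProbabilityMeasure ((P n).map (X n)) := fun n =>
    Measure.isProbabilityMeasure_map (hX n).aemeasurable
  have h1 := limsup_measure_compl_le_of_le_liminf_measure (L := atTop) (μ := μ)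
    (μs := fun n => (P n).map (X n)) hF.isOpen_compl.measurableSet (by
      simp_rw [Measure.map_apply (hX _) hF.isOpen_compl.measurableSet]
      exact h _ hF.isOpen_compl)
  rw [compl_compl] at h1
  simpa only [Measure.map_apply (hX _) hF.measurableSet] using h1

/-- **Slutsky's lemma** in a form that requires no measurability of the perturbation. -/
lemma WeaklyTendsto.convergesInLaw [OpensMeasurableSpace E] [FirstCountableTopology E]
    {P : ∀ n, Measure (Ω n)}
    [∀ n, IsProbabilityMeasure (P n)] {X : ∀ n, Ω n → E} (hX : ∀ n, Measurable (X n))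
    {μ : Measure E} [IsProbabilityMeasure μ] (h : WeaklyTendsto P X μ)
    {F : Type*} [TopologicalSpace F] [FirstCountableTopology F] {Y : (Σ n, Ω n) → F} {c : F}
    (hY : Tendsto Y (whp P) (𝓝 c)) {H : E → F → ℝ}
    (hH : ∀ x, ContinuousAt (Function.uncurry H) (x, c))
    {R : ∀ n, Ω n → ℝ} (hR : ∀ᶠ x in whp P, R x.1 x.2 = H (X x.1 x.2) (Y x)) :
    ConvergesInLaw P R (μ.map fun x => H x c) := by
  have hHc : Continuous fun x => H x c := continuous_iff_continuousAt.2 fun x =>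
    (hH x).comp (f := fun x => (x, c)) (by fun_prop)
  have key : ∀ A : Set ℝ, IsClosed A →
      limsup (fun n => P n {ω | R n ω ∈ A}) atTop ≤ μ ((fun x => H x c) ⁻¹' A) := by
    intro A hA
    obtain ⟨N, hN⟩ := (𝓝 c).exists_antitone_basis
    -- The event `R n ∈ A` with `Y` in `N k` forces `X n` into this set. It is closed, so the
    -- portmanteau bound for `X` applies, and only `X` has to be measurable.
    let C : ℕ → Set E := fun k => closure {x | ∃ y ∈ N k, H x y ∈ A}
    have hCanti : Antitone C := fun i j hij => closure_mono fun x ⟨y, hy, hxy⟩ =>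
      ⟨y, hN.antitone hij hy, hxy⟩
    -- Joint continuity of `H` at `(x, c)` is used here: a point in every closure would have nearby
    -- pairs on which `H` lies in the closed set `A`.
    have hC : ⋂ k, C k ⊆ (fun x => H x c) ⁻¹' A := by
      intro x hx
      rw [Set.mem_iInter] at hx
      by_contra hxA
      have h1 : ∀ᶠ q in 𝓝 (x, c), Function.uncurry H q ∈ Aᶜ :=
        (hH x).eventually (hA.isOpen_compl.mem_nhds hxA)
      rw [nhds_prod_eq] at h1
      obtain ⟨U, hU, V, hV, hUV⟩ := Filter.mem_prod_iff.1 h1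
      obtain ⟨k, -, hk⟩ := hN.1.mem_iff.1 hV
      obtain ⟨x', hx'U, y, hy, hxy⟩ := mem_closure_iff_nhds.1 (hx k) U hU
      exact hUV (Set.mk_mem_prod hx'U (hk hy)) hxy
    have hstep : ∀ k, limsup (fun n => P n {ω | R n ω ∈ A}) atTop ≤ μ (C k) := by
      intro k
      have hbad : Tendsto (fun n => P n {ω | ¬ (R n ω = H (X n ω) (Y ⟨n, ω⟩) ∧ Y ⟨n, ω⟩ ∈ N k)})
          atTop (𝓝 0) := hR.and (hY.eventually (hN.1.mem_of_mem trivial))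
      have hle : ∀ n, P n {ω | R n ω ∈ A} ≤ P n (X n ⁻¹' C k) +
          P n {ω | ¬ (R n ω = H (X n ω) (Y ⟨n, ω⟩) ∧ Y ⟨n, ω⟩ ∈ N k)} := by
        intro n
        refine (measure_mono fun ω hω => ?_).trans (measure_union_le _ _)
        by_cases hg : R n ω = H (X n ω) (Y ⟨n, ω⟩) ∧ Y ⟨n, ω⟩ ∈ N k
        · left
          exact subset_closure ⟨_, hg.2, hg.1 ▸ hω⟩
        · exact Or.inr hg
      calc limsup (fun n => P n {ω | R n ω ∈ A}) atTop
          ≤ limsup (fun n => P n (X n ⁻¹' C k) + P n {ω | ¬ (R n ω = H (X n ω) (Y ⟨n, ω⟩) ∧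
              Y ⟨n, ω⟩ ∈ N k)}) atTop := limsup_le_limsup (Eventually.of_forall hle)
        _ ≤ μ (C k) := by
          refine (ENNReal.limsup_add_of_right_tendsto_zero hbad _).trans_le ?_
          exact h.limsup_closed_le hX isClosed_closure
    have hlim := tendsto_measure_iInter_atTop (μ := μ) (s := C)
      (fun k => isClosed_closure.measurableSet.nullMeasurableSet) hCanti ⟨0, measure_ne_top _ _⟩
    exact (ge_of_tendsto' hlim hstep).trans (measure_mono hC)
  have hpush : ∀ A : Set ℝ, MeasurableSet A →
      (μ.map fun x => H x c) A = μ ((fun x => H x c) ⁻¹' A) := fun A hA =>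
    Measure.map_apply hHc.measurable hA
  have : IsProbabilityMeasure (μ.map fun x => H x c) :=
    Measure.isProbabilityMeasure_map hHc.aemeasurable
  intro B hB hfr
  set Q := μ.map fun x => H x c with hQ
  have hcl : Q (closure B) = Q B := by
    refine le_antisymm ?_ (measure_mono subset_closure)
    calc Q (closure B) ≤ Q (B ∪ frontier B) := measure_mono (by
            rw [closure_eq_self_union_frontier])
      _ ≤ Q B + Q (frontier B) := measure_union_le _ _
      _ = Q B := by rw [hfr, add_zero]
  have hint : Q (interior B)ᶜ = 1 - Q B := by
    rw [← prob_compl_eq_one_sub hB]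
    refine le_antisymm ?_ (measure_mono (Set.compl_subset_compl.2 interior_subset))
    calc Q (interior B)ᶜ ≤ Q (Bᶜ ∪ frontier B) := measure_mono fun x hx => by
            by_cases hxB : x ∈ B
            · exact Or.inr ⟨subset_closure hxB, hx⟩
            · exact Or.inl hxB
      _ ≤ Q Bᶜ + Q (frontier B) := measure_union_le _ _
      _ = Q Bᶜ := by rw [hfr, add_zero]
  refine tendsto_of_le_liminf_of_limsup_le ?_ ?_
  · have h1 := key (interior B)ᶜ isOpen_interior.isClosed_compl
    rw [← hpush _ isOpen_interior.measurableSet.compl, hint] at h1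
    -- `R n` need not be measurable, so subadditivity of the outer measure replaces the complement
    -- rule.
    have h2 : ∀ n, 1 - P n {ω | R n ω ∈ (interior B)ᶜ} ≤ P n {ω | R n ω ∈ B} := by
      intro n
      rw [tsub_le_iff_right, ← measure_univ (μ := P n)]
      refine (measure_mono fun ω _ => ?_).trans (measure_union_le _ _)
      by_cases hω : R n ω ∈ B
      · exact Or.inl hω
      · exact Or.inr fun h => hω (interior_subset h)
    calc Q B = 1 - (1 - Q B) := (ENNReal.sub_sub_cancel ENNReal.one_ne_top prob_le_one).symm
      _ ≤ 1 - limsup (fun n => P n {ω | R n ω ∈ (interior B)ᶜ}) atTop := tsub_le_tsub_left h1 _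
      _ = liminf (fun n => 1 - P n {ω | R n ω ∈ (interior B)ᶜ}) atTop :=
          (ENNReal.liminf_const_sub _ _ ENNReal.one_ne_top).symm
      _ ≤ _ := liminf_le_liminf (Eventually.of_forall h2)
  · calc limsup (fun n => P n {ω | R n ω ∈ B}) atTop
        ≤ limsup (fun n => P n {ω | R n ω ∈ closure B}) atTop :=
          limsup_le_limsup (Eventually.of_forall fun n => measure_mono fun ω hω =>
            subset_closure hω)
      _ ≤ Q (closure B) := by
          rw [hpush _ isClosed_closure.measurableSet]
          exact key _ isClosed_closure
      _ = Q B := hcl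

/-- Lower semicontinuous nonnegative functions of weakly convergent sequences. -/
lemma WeaklyTendsto.lintegral_le_liminf [OpensMeasurableSpace E] {P : ∀ n, Measure (Ω n)}
    {X : ∀ n, Ω n → E} (hX : ∀ n, Measurable (X n)) {μ : Measure E} (h : WeaklyTendsto P X μ)
    {f : E → ℝ} (hf0 : 0 ≤ f) (hfm : Measurable f) (hf : ∀ t, 0 ≤ t → IsOpen {x | t < f x}) :
    ∫⁻ x, ENNReal.ofReal (f x) ∂μ ≤
      liminf (fun n => ∫⁻ ω, ENNReal.ofReal (f (X n ω)) ∂P n) atTop := by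
  -- Layer cake turns both sides into integrals over levels `t > 0` of measures of open sets; Fatou
  -- in `t` then finishes.
  have e1 : ∀ n, ∫⁻ ω, ENNReal.ofReal (f (X n ω)) ∂P n =
      ∫⁻ t in Set.Ioi (0 : ℝ), P n {ω | t < f (X n ω)} := fun n =>
    lintegral_eq_lintegral_meas_lt _ (Eventually.of_forall fun ω => hf0 _)
      (hfm.comp (hX n)).aemeasurable
  simp_rw [e1]
  rw [lintegral_eq_lintegral_meas_lt _ (Eventually.of_forall hf0) hfm.aemeasurable]
  refine le_trans ?_ (lintegral_liminf_le fun n => Antitone.measurable fun s t hst =>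
    measure_mono fun ω hω => lt_of_le_of_lt hst hω)
  refine setLIntegral_mono' measurableSet_Ioi fun t ht => ?_
  exact h _ (hf t (le_of_lt ht))

/-! ### Change of measure: Le Cam's lemmas -/

section LeCam

variable [OpensMeasurableSpace E] {P Q : ∀ n, Measure (Ω n)}
  {L : ∀ n, Ω n → ENNReal} {X : ∀ n, Ω n → E} {μ : Measure E} {k : E → ℝ}

/-- The joint lower bound behind Le Cam's first and third lemmas. -/
lemma WeaklyTendsto.tilted_le_liminf (hL : ∀ n, Measurable (L n))
    (hQ : ∀ n, Q n = (P n).withDensity (L n)) (hX : ∀ n, Measurable (X n))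
    (h : WeaklyTendsto P X μ) (hk : Continuous k) (hk0 : ∀ x, 0 ≤ k x)
    (hLk : ∀ η : ℝ, 0 ≤ η → η < 1 →
      ∀ᶠ x in whp P, ENNReal.ofReal (η * k (X x.1 x.2)) ≤ L x.1 x.2)
    {G : Set E} (hG : IsOpen G) {S : Set (Σ n, Ω n)} (hS : S ∈ whp P) :
    ∫⁻ x in G, ENNReal.ofReal (k x) ∂μ ≤
      liminf (fun n => Q n (X n ⁻¹' G ∩ {ω | (⟨n, ω⟩ : Σ n, Ω n) ∈ S})) atTop := by
  -- Truncating at `j` makes the loss on the bad event at most `j` times its probability, and the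
  -- factor `j / (j + 1) < 1` is the slack `η` allowed by `hLk`. Both disappear monotonically as `j
  -- → ∞`.
  let g : ℕ → E → ℝ := fun j => G.indicator fun x => (j / (j + 1 : ℝ)) * min (k x) j
  have hg0 : ∀ j, 0 ≤ g j := fun j x => Set.indicator_nonneg (fun x _ =>
    mul_nonneg (by positivity) (le_min (hk0 x) (by positivity))) x
  have hgc : ∀ j : ℕ, Continuous fun x => (j / (j + 1 : ℝ)) * min (k x) j := fun j => by fun_prop
  have hgm : ∀ j, Measurable (g j) := fun j => (hgc j).measurable.indicator hG.measurableSet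
  have hgo : ∀ j t, 0 ≤ t → IsOpen {x | t < g j x} := by
    intro j t ht
    have : {x | t < g j x} = G ∩ {x | t < (j / (j + 1 : ℝ)) * min (k x) j} := by
      ext x
      by_cases hx : x ∈ G <;> simp [g, hx, ht]
    rw [this]
    exact hG.inter (isOpen_lt continuous_const (hgc j))
  have hj : ∀ j : ℕ, (j / (j + 1 : ℝ)) < 1 := fun j => by
    rw [div_lt_one (by positivity)]; linarith
  have hstep : ∀ j, ∫⁻ x, ENNReal.ofReal (g j x) ∂μ ≤
      liminf (fun n => Q n (X n ⁻¹' G ∩ {ω | (⟨n, ω⟩ : Σ n, Ω n) ∈ S})) atTop := by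
    intro j
    have hgood := (hLk _ (by positivity) (hj j)).and (show ∀ᶠ x in whp P, x ∈ S from hS)
    -- The bad event need not be measurable; its measurable hull has the same outer probability.
    let B : ∀ n, Set (Ω n) := fun n => toMeasurable (P n) {ω | ¬ (ENNReal.ofReal ((j / (j + 1 : ℝ))
      * k (X n ω)) ≤ L n ω ∧ (⟨n, ω⟩ : Σ n, Ω n) ∈ S)}
    have hB : Tendsto (fun n => (j : ENNReal) * P n (B n)) atTop (𝓝 0) := by
      have := ENNReal.Tendsto.const_mul (a := (j : ENNReal)) (eventually_whp.1 hgood)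
        (Or.inr (ENNReal.natCast_ne_top j))
      simpa [B, measure_toMeasurable] using this
    refine ((h.lintegral_le_liminf hX (hg0 j) (hgm j) (hgo j)).trans
      (liminf_le_liminf (Eventually.of_forall fun n => ?_))).trans_eq
      (ENNReal.liminf_add_of_right_tendsto_zero hB _)
    have hBm : MeasurableSet (B n) := measurableSet_toMeasurable _ _
    have hXG : MeasurableSet (X n ⁻¹' G) := hX n hG.measurableSet
    have hnB : ∀ ω, ω ∉ B n → ENNReal.ofReal ((j / (j + 1 : ℝ)) * k (X n ω)) ≤ L n ω ∧
        (⟨n, ω⟩ : Σ n, Ω n) ∈ S := by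
      intro ω hω
      by_contra hc
      exact hω (subset_toMeasurable _ _ hc)
    calc ∫⁻ ω, ENNReal.ofReal (g j (X n ω)) ∂P n
        ≤ ∫⁻ ω, (X n ⁻¹' G ∩ (B n)ᶜ).indicator (L n) ω + (B n).indicator (fun _ => (j : ENNReal)) ω
            ∂P n := by
          refine lintegral_mono fun ω => ?_
          by_cases hω : ω ∈ B n
          · refine le_add_left ?_
            rw [Set.indicator_of_mem hω, ← ENNReal.ofReal_natCast]
            refine ENNReal.ofReal_le_ofReal ?_
            refine Set.indicator_apply_le' (fun _ => ?_) fun _ => by positivity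
            have := min_le_right (k (X n ω)) (j : ℝ)
            have h0 : 0 ≤ min (k (X n ω)) (j : ℝ) := le_min (hk0 _) (by positivity)
            nlinarith [(hj j).le, show (0 : ℝ) ≤ j / (j + 1 : ℝ) by positivity]
          · refine le_add_right ?_
            by_cases hωG : X n ω ∈ G
            · rw [Set.indicator_of_mem (show ω ∈ X n ⁻¹' G ∩ (B n)ᶜ from ⟨hωG, hω⟩)]
              refine le_trans (ENNReal.ofReal_le_ofReal ?_) (hnB ω hω).1
              simp only [g, Set.indicator_of_mem hωG]
              exact mul_le_mul_of_nonneg_left (min_le_left _ _) (by positivity)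
            · simp [g, hωG]
      _ = Q n (X n ⁻¹' G ∩ (B n)ᶜ) + j * P n (B n) := by
          rw [lintegral_add_left ((hL n).indicator (hXG.inter hBm.compl)),
            lintegral_indicator (hXG.inter hBm.compl), lintegral_indicator hBm, hQ n,
            withDensity_apply _ (hXG.inter hBm.compl), setLIntegral_const]
      _ ≤ _ := by
          exact add_le_add (measure_mono fun ω hω => ⟨hω.1, (hnB ω hω.2).2⟩) le_rfl
  have hmono : Tendsto (fun j : ℕ => ∫⁻ x, ENNReal.ofReal (g j x) ∂μ) atTop
      (𝓝 (∫⁻ x in G, ENNReal.ofReal (k x) ∂μ)) := by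
    rw [← lintegral_indicator hG.measurableSet]
    refine lintegral_tendsto_of_tendsto_of_monotone
      (fun j => (hgm j).ennreal_ofReal.aemeasurable) (Eventually.of_forall fun x => ?_)
      (Eventually.of_forall fun x => ?_)
    · intro i j hij
      refine ENNReal.ofReal_le_ofReal (Set.indicator_le_indicator ?_)
      have hij' : (i : ℝ) ≤ j := by exact_mod_cast hij
      refine mul_le_mul ?_ (min_le_min_left _ hij') (le_min (hk0 x) (by positivity))
        (by positivity)
      rw [div_le_div_iff₀ (by positivity) (by positivity)]
      nlinarith
    · by_cases hx : x ∈ G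
      · simp only [g, Set.indicator_of_mem hx]
        refine ENNReal.tendsto_ofReal ?_
        have h1 : Tendsto (fun j : ℕ => (j / (j + 1 : ℝ))) atTop (𝓝 1) :=
          tendsto_natCast_div_add_atTop 1
        have h2 : Tendsto (fun j : ℕ => min (k x) (j : ℝ)) atTop (𝓝 (k x)) := by
          refine tendsto_const_nhds.congr' ?_
          filter_upwards [eventually_ge_atTop ⌈k x⌉₊] with j hj
          exact (min_eq_left (Nat.ceil_le.1 hj)).symm
        simpa using h1.mul h2
      · simp [g, hx]
  exact le_of_tendsto' hmono hstep

/-- **Le Cam's third lemma**: weak limits under contiguous alternatives. -/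
lemma WeaklyTendsto.tilt (hL : ∀ n, Measurable (L n))
    (hQ : ∀ n, Q n = (P n).withDensity (L n)) (hX : ∀ n, Measurable (X n))
    (h : WeaklyTendsto P X μ) (hk : Continuous k) (hk0 : ∀ x, 0 ≤ k x)
    (hLk : ∀ η : ℝ, 0 ≤ η → η < 1 →
      ∀ᶠ x in whp P, ENNReal.ofReal (η * k (X x.1 x.2)) ≤ L x.1 x.2) :
    WeaklyTendsto Q X (μ.withDensity fun x => ENNReal.ofReal (k x)) := by
  intro G hG
  rw [withDensity_apply _ hG.measurableSet]
  simpa using h.tilted_le_liminf hL hQ hX hk hk0 hLk hG univ_mem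

/-- **Le Cam's first lemma**: contiguity of the alternatives. -/
lemma WeaklyTendsto.contiguous [∀ n, IsProbabilityMeasure (Q n)] (hL : ∀ n, Measurable (L n))
    (hQ : ∀ n, Q n = (P n).withDensity (L n)) (hX : ∀ n, Measurable (X n))
    (h : WeaklyTendsto P X μ) (hk : Continuous k) (hk0 : ∀ x, 0 ≤ k x)
    (hLk : ∀ η : ℝ, 0 ≤ η → η < 1 →
      ∀ᶠ x in whp P, ENNReal.ofReal (η * k (X x.1 x.2)) ≤ L x.1 x.2)
    (hk1 : ∫⁻ x, ENNReal.ofReal (k x) ∂μ = 1) : whp Q ≤ whp P := by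
  intro S hS
  -- The slices of `S` may be non-measurable. `T` is a measurable core with the same defect under
  -- `P`, so the complement rule under `Q` becomes available.
  let T : Set (Σ n, Ω n) := {x | x.2 ∉ toMeasurable (P x.1) {ω | (⟨x.1, ω⟩ : Σ n, Ω n) ∉ S}}
  have hTS : T ⊆ S := by
    rintro ⟨n, ω⟩ hω
    by_contra hc
    exact hω (subset_toMeasurable _ _ hc)
  have hT : T ∈ whp P := by
    change Tendsto (fun n => P n {ω | ¬ ω ∉ toMeasurable (P n) _}) atTop (𝓝 0)
    simpa [measure_toMeasurable] using eventually_whp.1 (show ∀ᶠ x in whp P, x ∈ S from hS)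
  refine Filter.mem_of_superset ?_ hTS
  -- With the whole space as open set, total tilted mass one means that no mass of `Q n` escapes
  -- from `T`.
  have h1 := h.tilted_le_liminf hL hQ hX hk hk0 hLk isOpen_univ hT
  simp only [Measure.restrict_univ, hk1, Set.preimage_univ, Set.univ_inter] at h1
  have hm : ∀ n, MeasurableSet {ω | (⟨n, ω⟩ : Σ n, Ω n) ∈ T} := fun n =>
    (measurableSet_toMeasurable (P n) {ω | (⟨n, ω⟩ : Σ n, Ω n) ∉ S}).compl
  have h2 : Tendsto (fun n => Q n {ω | (⟨n, ω⟩ : Σ n, Ω n) ∈ T}) atTop (𝓝 1) :=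
    tendsto_of_le_liminf_of_limsup_le h1 (limsup_le_of_le (by isBoundedDefault)
      (Eventually.of_forall fun n => prob_le_one))
  have h3 : Tendsto (fun n => 1 - Q n {ω | (⟨n, ω⟩ : Σ n, Ω n) ∈ T}) atTop (𝓝 (1 - 1)) :=
    ENNReal.Tendsto.sub tendsto_const_nhds h2 (Or.inl ENNReal.one_ne_top)
  rw [tsub_self] at h3
  refine h3.congr fun n => ?_
  rw [← prob_compl_eq_one_sub (hm n)]
  rfl

end LeCam

end HighProbability

end

section

/-! ### Independent samples -/

section Samples

variable {O : Type*} [MeasurableSpace O] {P : Measure O} [IsProbabilityMeasure P]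

lemma ae_pi_forall {ι : Type*} [Fintype ι] {p : O → Prop} (h : ∀ᵐ o ∂P, p o) :
    ∀ᵐ d ∂(Measure.pi fun _ : ι => P), ∀ i, p (d i) :=
  eventually_all.2 fun _ => Measure.tendsto_eval_ae_ae.eventually h

/-- This realizes the samples of all sizes on one sequence space, where the strong law of large
numbers can be applied. -/
lemma map_infinitePi_fin (n : ℕ) :
    (Measure.infinitePi fun _ : ℕ => P).map (fun ω (i : Fin n) => ω i) =
      Measure.pi fun _ : Fin n => P := by
  rw [← Measure.infinitePi_eq_pi]
  exact Measure.map_infinitePi_infinitePi_of_inj (P := fun _ : ℕ => P) Fin.val_injective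

/-- The weak law of large numbers for samples of increasing size. -/
lemma tendsto_average_whp {f : O → ℝ} (hf : Integrable f P) :
    Tendsto (fun x : Σ n, Fin n → O => (x.1 : ℝ)⁻¹ * ∑ i, f (x.2 i))
      (whp fun n => Measure.pi fun _ : Fin n => P) (𝓝 (∫ o, f o ∂P)) := by
  -- A measurable version of `f` agrees with `f` at all the sample points almost surely, so the
  -- averages coincide.
  wlog hm : Measurable f generalizing f
  · have h1 := this (hf.congr hf.1.ae_eq_mk) hf.1.stronglyMeasurable_mk.measurable
    rw [← integral_congr_ae hf.1.ae_eq_mk] at h1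
    refine h1.congr' (eventually_whp_of_ae (Eventually.of_forall fun n => ?_))
    filter_upwards [ae_pi_forall (ι := Fin n) hf.1.ae_eq_mk] with d hd
    simp_rw [hd]
  let Pi := Measure.infinitePi fun _ : ℕ => P
  have hev : ∀ i, Pi.map (fun ω => ω i) = P := fun i =>
    Measure.infinitePi_map_eval (fun _ : ℕ => P) i
  have hid : ∀ i, IdentDistrib (fun ω : ℕ → O => f (ω i)) (fun ω => f (ω 0)) Pi Pi := fun i =>
    IdentDistrib.comp (u := f) ⟨(measurable_pi_apply i).aemeasurable,
      (measurable_pi_apply 0).aemeasurable, by rw [hev, hev]⟩ hm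
  have hint : Integrable (fun ω : ℕ → O => f (ω 0)) Pi := by
    rw [← hev 0] at hf
    exact hf.comp_measurable (measurable_pi_apply 0)
  have hlln := strong_law_ae_real (μ := Pi) (fun i ω => f (ω i)) hint
    (fun i j hij => (iIndepFun_infinitePi (P := fun _ : ℕ => P) (X := fun _ => f)
      fun _ => hm).indepFun hij) hid
  have hmean : ∫ ω, f (ω 0) ∂Pi = ∫ o, f o ∂P := by
    conv_rhs => rw [← hev 0]
    rw [integral_map (measurable_pi_apply 0).aemeasurable (by fun_prop)]
  rw [hmean] at hlln
  have hmeas := tendstoInMeasure_of_tendsto_ae (μ := Pi)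
    (f := fun n ω => (∑ i ∈ Finset.range n, f (ω i)) / n)
    (fun n => (Finset.measurable_sum _ fun i _ => hm.comp (measurable_pi_apply i)).div_const _
      |>.aestronglyMeasurable) hlln
  rw [tendstoInMeasure_iff_dist] at hmeas
  rw [Metric.tendsto_nhds]
  intro ε hε
  rw [eventually_whp]
  refine (hmeas ε hε).congr fun n => ?_
  rw [← map_infinitePi_fin, Measure.map_apply (by fun_prop)]
  · congr 1
    ext ω
    simp only [Set.mem_preimage, Set.mem_ofPred_eq, not_lt, Finset.sum_range]
    rw [div_eq_inv_mul]
  · simp only [not_lt]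
    have hs : Measurable fun d : Fin n → O => ∑ i, f (d i) :=
      Finset.measurable_sum _ fun i _ => hm.comp (measurable_pi_apply i)
    exact measurableSet_le measurable_const ((hs.const_mul _).dist measurable_const)

omit [IsProbabilityMeasure P] in
/-- A product of measures with densities has the product density. -/
lemma pi_withDensity_eq {ι : Type*} [Fintype ι] {P : ι → Measure O}
    [∀ i, IsProbabilityMeasure (P i)] {f : ι → O → ENNReal} (hf : ∀ i, Measurable (f i))
    [∀ i, IsProbabilityMeasure ((P i).withDensity (f i))] :
    (Measure.pi fun i => (P i).withDensity (f i)) =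
      (Measure.pi P).withDensity fun d => ∏ i, f i (d i) := by
  classical
  refine Measure.pi_eq fun s hs => ?_
  rw [withDensity_apply _ (MeasurableSet.univ_pi hs),
    ← lintegral_indicator (MeasurableSet.univ_pi hs)]
  have h1 : ∀ d : ι → O, (Set.univ.pi s).indicator (fun d => ∏ i, f i (d i)) d =
      ∏ i, (s i).indicator (f i) (d i) := by
    intro d
    by_cases hd : d ∈ Set.univ.pi s
    · rw [Set.indicator_of_mem hd]
      exact Finset.prod_congr rfl fun i _ => (Set.indicator_of_mem (hd i trivial) _).symm
    · rw [Set.indicator_of_notMem hd]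
      simp only [Set.mem_pi, Set.mem_univ, true_imp_iff, not_forall] at hd
      obtain ⟨i, hi⟩ := hd
      exact (Finset.prod_eq_zero (Finset.mem_univ i) (Set.indicator_of_notMem hi _)).symm
  simp_rw [h1]
  have hm : ∀ i, Measurable ((s i).indicator (f i)) := fun i => (hf i).indicator (hs i)
  rw [lintegral_prod_eq_prod_lintegral_of_indepFun Finset.univ
    (fun i (d : ι → O) => (s i).indicator (f i) (d i))
    (iIndepFun_pi fun i => (hm i).aemeasurable) fun i => (hm i).comp (measurable_pi_apply i)]
  refine Finset.prod_congr rfl fun i _ => ?_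
  rw [withDensity_apply _ (hs i), ← lintegral_indicator (hs i)]
  conv_rhs => rw [← (measurePreserving_eval P i).lintegral_comp (hm i)]

/-- Factors may be replaced by their conditional means given the first argument of `F`. -/
lemma integral_mul_prod_eq {c : O → O} (hc : Measurable c) {ψ m : O → ℂ}
    (hψ : Measurable ψ) (hψ1 : ∀ o, ‖ψ o‖ ≤ 1) (hm : Measurable m) (hm1 : ∀ o, ‖m o‖ ≤ 1)
    (H : ∀ h : O → ℂ, Measurable h → (∀ o, ‖h o‖ ≤ 1) →
      ∫ o, h (c o) * ψ o ∂P = ∫ o, h (c o) * m o ∂P) :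
    ∀ (n : ℕ) (F : (Fin n → O) → ℂ), Measurable F → (∀ d, ‖F d‖ ≤ 1) →
      ∫ d, F (fun i => c (d i)) * ∏ i, ψ (d i) ∂(Measure.pi fun _ : Fin n => P) =
      ∫ d, F (fun i => c (d i)) * ∏ i, m (d i) ∂(Measure.pi fun _ : Fin n => P) := by
  intro n
  induction n with
  | zero => simp
  | succ n ih =>
    intro F hF hF1
    have hmp := (measurePreserving_piFinSuccAbove (fun _ : Fin (n + 1) => P) 0).symm
    have hprod : ∀ g : O → ℂ, (∀ o, ‖g o‖ ≤ 1) → ∀ (k : ℕ) (d : Fin k → O),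
        ‖∏ i, g (d i)‖ ≤ 1 := fun g hg k d => by
      rw [norm_prod]
      exact Finset.prod_le_one (fun _ _ => norm_nonneg _) fun _ _ => hg _
    -- One observation is split off and the others are integrated first. For a fixed first
    -- observation the induction hypothesis changes the inner integral, which is then a bounded
    -- function of `c o`, as `H` requires.
    have hstep : ∀ g : O → ℂ, Measurable g → (∀ o, ‖g o‖ ≤ 1) →
        ∫ d, F (fun i => c (d i)) * ∏ i, g (d i) ∂(Measure.pi fun _ : Fin (n + 1) => P) =
        ∫ o, (∫ d, F (Fin.cons (c o) fun i => c (d i)) * ∏ i, g (d i)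
          ∂(Measure.pi fun _ : Fin n => P)) * g o ∂P := by
      intro g hg hg1
      have hcons : Measurable fun q : O × (Fin n → O) =>
          (Fin.cons (c q.1) (fun i => c (q.2 i)) : Fin (n + 1) → O) := by
        refine measurable_pi_lambda _ fun i => ?_
        refine Fin.cases ?_ (fun i => ?_) i
        · exact hc.comp measurable_fst
        · exact hc.comp ((measurable_pi_apply i).comp measurable_snd)
      rw [← hmp.integral_comp']
      have e1 : ∀ q : O × (Fin n → O),
          F (fun i => c ((MeasurableEquiv.piFinSuccAbove (fun _ => O) 0).symm q i)) *
            ∏ i, g ((MeasurableEquiv.piFinSuccAbove (fun _ => O) 0).symm q i) =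
          F (Fin.cons (c q.1) fun i => c (q.2 i)) * (∏ i, g (q.2 i)) * g q.1 := by
        intro q
        have : (MeasurableEquiv.piFinSuccAbove (fun _ => O) 0).symm q =
            (Fin.cons q.1 q.2 : Fin (n + 1) → O) := by
          funext i
          refine Fin.cases ?_ (fun i => ?_) i <;>
            simp [MeasurableEquiv.piFinSuccAbove_symm_apply, Fin.insertNthEquiv]
        have h2 : (fun i => c ((Fin.cons q.1 q.2 : Fin (n + 1) → O) i)) =
            (Fin.cons (c q.1) fun i => c (q.2 i) : Fin (n + 1) → O) := by
          funext i
          refine Fin.cases ?_ (fun i => ?_) i <;> simp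
        rw [this, h2, Fin.prod_univ_succ]
        simp only [Fin.cons_zero, Fin.cons_succ]
        ring
      simp_rw [e1]
      rw [integral_prod]
      · simp_rw [integral_mul_const]
      · refine Integrable.of_bound (C := 1) ?_ (Eventually.of_forall fun q => ?_)
        · refine Measurable.aestronglyMeasurable (((hF.comp hcons).mul ?_).mul
            (hg.comp measurable_fst))
          exact Finset.measurable_prod _ fun i _ =>
            hg.comp ((measurable_pi_apply i).comp measurable_snd)
        · rw [norm_mul, norm_mul]
          exact mul_le_one₀ (mul_le_one₀ (hF1 _) (norm_nonneg _) (hprod g hg1 _ _))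
            (norm_nonneg _) (hg1 _)
    rw [hstep ψ hψ hψ1, hstep m hm hm1]
    have hcons' : ∀ o, Measurable fun d : Fin n → O => (Fin.cons o d : Fin (n + 1) → O) := by
      intro o
      refine measurable_pi_lambda _ fun i => ?_
      refine Fin.cases ?_ (fun i => ?_) i
      · simp
      · simpa using measurable_pi_apply i
    have e2 : ∀ o, ∫ d, F (Fin.cons (c o) fun i => c (d i)) * ∏ i, ψ (d i)
          ∂(Measure.pi fun _ : Fin n => P) =
        ∫ d, F (Fin.cons (c o) fun i => c (d i)) * ∏ i, m (d i)
          ∂(Measure.pi fun _ : Fin n => P) := fun o =>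
      ih (fun d => F (Fin.cons (c o) d)) (hF.comp (hcons' _)) fun d => hF1 _
    simp_rw [e2]
    refine H (fun o => ∫ d, F (Fin.cons o fun i => c (d i)) * ∏ i, m (d i)
      ∂(Measure.pi fun _ : Fin n => P)) ?_ fun o => ?_
    · have hmeas : Measurable fun q : O × (Fin n → O) =>
          F (Fin.cons q.1 fun i => c (q.2 i)) * ∏ i, m (q.2 i) := by
        refine (hF.comp (measurable_pi_lambda _ fun i => ?_)).mul
          (Finset.measurable_prod _ fun i _ => hm.comp
            ((measurable_pi_apply i).comp measurable_snd))
        refine Fin.cases ?_ (fun i => ?_) i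
        · simpa using measurable_fst
        · exact hc.comp ((measurable_pi_apply i).comp measurable_snd)
      exact hmeas.stronglyMeasurable.integral_prod_right.measurable
    · refine (norm_integral_le_of_norm_le_const (C := 1) (Eventually.of_forall fun d => ?_)).trans ?_
      · rw [norm_mul]
        exact mul_le_one₀ (hF1 _) (norm_nonneg _) (hprod m hm1 _ _)
      · simp

/-- The second order expansion of a characteristic function at zero. -/
lemma tendsto_charFun_expansion {f : O → ℝ} (hf : Measurable f) (hmean : ∫ o, f o ∂P = 0)
    (hL2 : MemLp f 2 P) :
    Tendsto (fun n : ℕ => (n : ℂ) * (∫ o, Complex.exp (((Real.sqrt n)⁻¹ * f o : ℝ) * Complex.I) ∂P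
      - 1)) atTop (𝓝 (-(∫ o, f o ^ 2 ∂P : ℝ) / 2)) := by
  have hint : MemLp id 2 (P.map f) := (memLp_map_measure_iff (by fun_prop) hf.aemeasurable).2 hL2
  have : IsProbabilityMeasure (P.map f) := Measure.isProbabilityMeasure_map hf.aemeasurable
  have h1 := taylor_isLittleO_univ (x₀ := (0 : ℝ)) (contDiff_charFun hint)
  simp_rw [taylorWithinEval_charFun_two_zero hf.aemeasurable hint, hmean, sub_zero] at h1
  have h0 : Tendsto (fun n : ℕ => (Real.sqrt n)⁻¹) atTop (𝓝 0) :=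
    tendsto_inv_atTop_zero.comp (Real.tendsto_sqrt_atTop.comp tendsto_natCast_atTop_atTop)
  -- At `t = 1/√n` the remainder `o(t²)` is divided by `t² = 1/n`, which produces the factor `n`.
  have h2 := (h1.comp_tendsto h0).tendsto_inv_smul_nhds_zero
  have h3 := h2.add_const (-((∫ o, f o ^ 2 ∂P : ℝ) : ℂ) / 2)
  rw [zero_add] at h3
  refine h3.congr' ?_
  filter_upwards [eventually_gt_atTop 0] with n hn
  have hn' : (0 : ℝ) < n := by exact_mod_cast hn
  have hsq : ((Real.sqrt n)⁻¹) ^ 2 = (n : ℝ)⁻¹ := by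
    rw [inv_pow, Real.sq_sqrt hn'.le]
  have hchar : charFun (P.map f) (Real.sqrt n)⁻¹ =
      ∫ o, Complex.exp (((Real.sqrt n)⁻¹ * f o : ℝ) * Complex.I) ∂P := by
    rw [charFun_apply_real, integral_map hf.aemeasurable (by fun_prop)]
    simp
  have hsqC : (((Real.sqrt n)⁻¹ : ℝ) : ℂ) ^ 2 = (n : ℂ)⁻¹ := by
    rw [← Complex.ofReal_pow, hsq]; simp
  have hn0 : (n : ℂ) ≠ 0 := by exact_mod_cast hn.ne'
  simp only [Function.comp_apply, hchar, Pi.pow_apply, hsq, hsqC, Complex.ofReal_zero, zero_mul,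
    add_zero]
  rw [inv_inv, Complex.real_smul]
  generalize ∫ o, Complex.exp (((Real.sqrt n)⁻¹ * f o : ℝ) * Complex.I) ∂P = z
  push_cast
  field_simp
  ring

/-! ### Central limit theorem conditional on the reduced data -/

section ConditionalCLT

variable {T : Set O} (hT : MeasurableSet T) (hPT : P T ≠ 0) {c : O → O} (hc : Measurable c)
  {o₀ : O} (hcT : ∀ o ∈ T, c o = o₀) {f : O → ℝ} (hf : Measurable f) (hf0 : ∀ o ∉ T, f o = 0)
  (hmean : ∫ o, f o ∂P = 0) (hL2 : MemLp f 2 P)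

include hT hPT hc hcT hf hf0 hmean hL2 in
/-- **Conditional central limit theorem**: the normalized sum of `f` over the observations in `T`
is asymptotically normal and independent of the reduced data `c ∘ d`, which retain nothing about
observations in `T` beyond their being there. -/
lemma conditional_clt (F : ∀ n, (Fin n → O) → ℂ) (hF : ∀ n, Measurable (F n))
    (hF1 : ∀ n d, ‖F n d‖ ≤ 1) :
    Tendsto (fun n : ℕ =>
      ∫ d, F n (fun i => c (d i)) * Complex.exp (((Real.sqrt n)⁻¹ * ∑ i, f (d i) : ℝ) * Complex.I)
        ∂(Measure.pi fun _ : Fin n => P)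
      - Real.exp (-(∫ o, f o ^ 2 ∂P) / 2) *
        ∫ d, F n (fun i => c (d i)) ∂(Measure.pi fun _ : Fin n => P)) atTop (𝓝 0) := by
  classical
  set σ2 := ∫ o, f o ^ 2 ∂P with hσ2
  set e := Real.exp (-σ2 / 2) with he
  set π := P.real T with hπ
  have hπ0 : 0 < π := ENNReal.toReal_pos hPT (measure_ne_top _ _)
  let ψ : ℕ → O → ℂ := fun n o => Complex.exp (((Real.sqrt n)⁻¹ * f o : ℝ) * Complex.I)
  have hψm : ∀ n, Measurable (ψ n) := fun n => by fun_prop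
  have hψ1 : ∀ n o, ‖ψ n o‖ ≤ 1 := fun n o => (Complex.norm_exp_ofReal_mul_I _).le
  have hψint : ∀ n, Integrable (ψ n) P := fun n =>
    Integrable.of_bound (C := 1) (hψm n).aestronglyMeasurable (Eventually.of_forall (hψ1 n))
  let φ : ℕ → ℂ := fun n => ∫ o in T, ψ n o ∂P
  have hψT : ∀ n, ∀ o ∉ T, ψ n o = 1 := fun n o ho => by simp [ψ, hf0 o ho]
  have hφ : ∀ n, ‖φ n‖ ≤ π := fun n => by
    have := norm_setIntegral_le_of_norm_le_const (μ := P) (s := T) (f := ψ n) (C := 1)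
      (measure_lt_top _ _) fun o _ => hψ1 n o
    simpa using this
  -- This is the conditional mean of `ψ n` given `c`: on `T` the map `c` is constant, so `ψ n` is
  -- averaged over `T`; off `T` it equals one already.
  let m : ℕ → O → ℂ := fun n o => if o ∈ T then φ n / π else 1
  have hmm : ∀ n, Measurable (m n) := fun n =>
    Measurable.ite hT measurable_const measurable_const
  have hm1 : ∀ n o, ‖m n o‖ ≤ 1 := fun n o => by
    simp only [m]
    split_ifs
    · rw [norm_div, Complex.norm_real, Real.norm_of_nonneg hπ0.le]
      exact (div_le_one hπ0).2 (hφ n)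
    · simp
  have hcompl : P.real Tᶜ = 1 - π := by
    rw [hπ, measureReal_compl hT]; simp
  have hψtot : ∀ n, ∫ o, ψ n o ∂P = φ n + (1 - π) := fun n => by
    rw [← integral_add_compl hT (hψint n), setIntegral_congr_fun hT.compl (g := fun _ => (1 : ℂ))
      fun o ho => hψT n o ho, setIntegral_const, hcompl]
    simp [φ]
  have hsplit : ∀ n (h : O → ℂ), Measurable h → (∀ o, ‖h o‖ ≤ 1) →
      ∫ o, h (c o) * ψ n o ∂P = ∫ o, h (c o) * m n o ∂P := by
    intro n h hh hh1
    have hint : ∀ g : O → ℂ, Measurable g → (∀ o, ‖g o‖ ≤ 1) →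
        Integrable (fun o => h (c o) * g o) P := fun g hg hg1 =>
      Integrable.of_bound (C := 1) ((hh.comp hc).mul hg).aestronglyMeasurable
        (Eventually.of_forall fun o => by
          rw [norm_mul]; exact mul_le_one₀ (hh1 _) (norm_nonneg _) (hg1 _))
    rw [← integral_add_compl hT (hint _ (hψm n) (hψ1 n)),
      ← integral_add_compl hT (hint _ (hmm n) (hm1 n))]
    congr 1
    · rw [setIntegral_congr_fun hT (g := fun o => h o₀ * ψ n o) fun o ho => by
        simp only [hcT o ho]]
      rw [setIntegral_congr_fun hT (f := fun o => h (c o) * m n o)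
        (g := fun o => h o₀ * (φ n / π)) fun o ho => by simp only [hcT o ho, m, if_pos ho]]
      rw [integral_const_mul, setIntegral_const]
      change h o₀ * φ n = _
      rw [Complex.real_smul]
      have : (π : ℂ) ≠ 0 := by exact_mod_cast hπ0.ne'
      field_simp
      rw [← hπ, mul_comm]
    · refine setIntegral_congr_fun hT.compl fun o ho => ?_
      simp only [hψT n o ho, m, if_neg ho]
  have hmtot : ∀ n, ∫ o, m n o ∂P = ∫ o, ψ n o ∂P := fun n => by
    simpa using (hsplit n (fun _ => 1) measurable_const (by simp)).symm
  set g : ℕ → ℂ := fun n => ∫ o, ψ n o ∂P - 1 with hg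
  have hgl : Tendsto (fun n : ℕ => (n : ℂ) * g n) atTop (𝓝 (-(σ2 : ℂ) / 2)) :=
    tendsto_charFun_expansion hf hmean hL2
  have hpow1 : Tendsto (fun n : ℕ => (∫ o, m n o ∂P) ^ n) atTop (𝓝 (e : ℂ)) := by
    have := Complex.tendsto_one_add_pow_exp_of_tendsto hgl
    rw [he, Complex.ofReal_exp]
    push_cast
    refine this.congr fun n => ?_
    rw [hmtot, hg]; ring
  -- To first order in `g n` this agrees with the squared modulus of the mean `1 + g n`. Since `g n`
  -- is of order `1/n`, the `n`-th powers have the same limit `e * e`, and so the product of the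
  -- conditional means has asymptotically no variance.
  have hsqtot : ∀ n, ∫ o, ‖m n o‖ ^ 2 ∂P = 1 + (2 * (g n).re + ‖g n‖ ^ 2 / π) := by
    intro n
    have hi : Integrable (fun o => ‖m n o‖ ^ 2) P :=
      Integrable.of_bound (C := 1) ((hmm n).norm.pow_const 2).aestronglyMeasurable
        (Eventually.of_forall fun o => by
          rw [Real.norm_of_nonneg (by positivity)]; exact pow_le_one₀ (norm_nonneg _) (hm1 n o))
    rw [← integral_add_compl hT hi,
      setIntegral_congr_fun hT (g := fun o => ‖φ n / π‖ ^ 2) fun o ho => by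
        simp only [m, if_pos ho],
      setIntegral_congr_fun hT.compl (g := fun o => (1 : ℝ)) fun o ho => by
        simp [m, if_neg (show o ∉ T from ho)],
      setIntegral_const, setIntegral_const, hcompl, ← hπ]
    have h1 : φ n = g n + π := by rw [hg]; simp only [hψtot]; ring
    have h2 : ‖φ n‖ ^ 2 = ‖g n‖ ^ 2 + 2 * π * (g n).re + π ^ 2 := by
      rw [h1, ← Complex.normSq_eq_norm_sq, ← Complex.normSq_eq_norm_sq, Complex.normSq_apply,
        Complex.normSq_apply]
      simp; ring
    rw [norm_div, Complex.norm_real, Real.norm_of_nonneg hπ0.le, div_pow, h2]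
    simp only [smul_eq_mul]
    field_simp
    ring
  have hpow2 : Tendsto (fun n : ℕ => (∫ o, ‖m n o‖ ^ 2 ∂P) ^ n) atTop (𝓝 (e * e)) := by
    simp_rw [hsqtot]
    have hee : e * e = Real.exp (-σ2) := by rw [he, ← Real.exp_add]; ring_nf
    rw [hee]
    refine Real.tendsto_one_add_pow_exp_of_tendsto ?_
    have hre : Tendsto (fun n : ℕ => (n : ℝ) * (g n).re) atTop (𝓝 (-σ2 / 2)) := by
      have := (Complex.continuous_re.tendsto _).comp hgl
      have h2 : (-(σ2 : ℂ) / 2).re = -σ2 / 2 := by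
        rw [show (-(σ2 : ℂ) / 2) = ((-σ2 / 2 : ℝ) : ℂ) by push_cast; ring, Complex.ofReal_re]
      rw [h2] at this
      refine this.congr fun n => ?_
      simp
    have hnn : Tendsto (fun n : ℕ => ((n : ℝ)⁻¹) * ‖(n : ℂ) * g n‖ ^ 2 / π) atTop (𝓝 0) := by
      have := ((tendsto_inv_atTop_zero.comp (tendsto_natCast_atTop_atTop (R := ℝ))).mul
        (hgl.norm.pow 2)).div_const π
      simpa using this
    have := (hre.const_mul 2).add hnn
    rw [show 2 * (-σ2 / 2) + 0 = -σ2 by ring] at this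
    refine this.congr' ?_
    filter_upwards [eventually_gt_atTop 0] with n hn
    have hn' : (n : ℝ) ≠ 0 := by exact_mod_cast hn.ne'
    rw [norm_mul, Complex.norm_natCast]
    field_simp
  have hprodm : ∀ n (d : Fin n → O), ‖∏ i, m n (d i)‖ ≤ 1 := fun n d => by
    rw [norm_prod]
    exact Finset.prod_le_one (fun _ _ => norm_nonneg _) fun _ _ => hm1 n _
  have hprodmeas : ∀ n, Measurable fun d : Fin n → O => ∏ i, m n (d i) := fun n =>
    Finset.measurable_prod _ fun i _ => (hmm n).comp (measurable_pi_apply i)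
  let D : ∀ n, (Fin n → O) → ℝ := fun n d => ‖∏ i, m n (d i) - (e : ℂ)‖
  have hDmeas : ∀ n, Measurable (D n) := fun n => ((hprodmeas n).sub measurable_const).norm
  have he0 : 0 < e := Real.exp_pos _
  have hDb : ∀ n d, D n d ≤ 1 + e := fun n d => by
    refine (norm_sub_le _ _).trans (add_le_add (hprodm n d) ?_)
    rw [Complex.norm_real, Real.norm_of_nonneg he0.le]
  have hDL : ∀ n, MemLp (D n) 2 (Measure.pi fun _ : Fin n => P) := fun n =>
    MemLp.of_bound (hDmeas n).aestronglyMeasurable (1 + e) (Eventually.of_forall fun d => by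
      rw [Real.norm_of_nonneg (norm_nonneg _)]; exact hDb n d)
  -- The square of the modulus is expanded, and independence makes both moments of the product into
  -- `n`-th powers.
  have hDsq : ∀ n, ∫ d, D n d ^ 2 ∂(Measure.pi fun _ : Fin n => P) =
      (∫ o, ‖m n o‖ ^ 2 ∂P) ^ n - 2 * e * ((∫ o, m n o ∂P) ^ n).re + e * e := by
    intro n
    have h1 : ∀ d : Fin n → O, D n d ^ 2 =
        ∏ i, ‖m n (d i)‖ ^ 2 - 2 * e * (∏ i, m n (d i)).re + e * e := by
      intro d
      simp only [D]
      rw [Finset.prod_pow, ← norm_prod, ← Complex.normSq_eq_norm_sq, ← Complex.normSq_eq_norm_sq,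
        Complex.normSq_apply, Complex.normSq_apply]
      simp; ring
    simp_rw [h1]
    have hi1 : Integrable (fun d : Fin n → O => ∏ i, ‖m n (d i)‖ ^ 2)
        (Measure.pi fun _ : Fin n => P) := by
      refine Integrable.of_bound (C := 1) ?_ (Eventually.of_forall fun d => ?_)
      · exact (Finset.measurable_prod _ fun i _ => ((hmm n).comp
          (measurable_pi_apply i)).norm.pow_const 2).aestronglyMeasurable
      · rw [Finset.prod_pow, ← norm_prod, Real.norm_of_nonneg (by positivity)]
        exact pow_le_one₀ (norm_nonneg _) (hprodm n d)
    have hi2 : Integrable (fun d : Fin n → O => ∏ i, m n (d i))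
        (Measure.pi fun _ : Fin n => P) :=
      Integrable.of_bound (C := 1) (hprodmeas n).aestronglyMeasurable
        (Eventually.of_forall (hprodm n))
    have hi3 : Integrable (fun d : Fin n → O => 2 * e * (∏ i, m n (d i)).re)
        (Measure.pi fun _ : Fin n => P) := hi2.re.const_mul _
    have hi4 : Integrable (fun d : Fin n → O => ∏ i, ‖m n (d i)‖ ^ 2 -
        2 * e * (∏ i, m n (d i)).re) (Measure.pi fun _ : Fin n => P) := hi1.sub hi3
    rw [integral_add hi4 (integrable_const _), integral_sub hi1 hi3, integral_const_mul]
    have h2 := integral_re hi2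
    simp only [RCLike.re_eq_complex_re] at h2
    rw [h2, integral_fintype_prod_eq_pow (ι := Fin n) (fun o => ‖m n o‖ ^ 2) (μ := P),
      integral_fintype_prod_eq_pow (ι := Fin n) (m n) (μ := P)]
    simp
  have hD0 : Tendsto (fun n => ∫ d, D n d ∂(Measure.pi fun _ : Fin n => P)) atTop (𝓝 0) := by
    have h1 : Tendsto (fun n => ∫ d, D n d ^ 2 ∂(Measure.pi fun _ : Fin n => P)) atTop (𝓝 0) := by
      simp_rw [hDsq]
      have := (hpow2.sub (((Complex.continuous_re.tendsto _).comp hpow1).const_mul (2 * e))).add_const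
        (e * e)
      rw [Complex.ofReal_re, show e * e - 2 * e * e + e * e = 0 by ring] at this
      exact this
    have h2 := (Real.continuous_sqrt.tendsto _).comp h1
    rw [Real.sqrt_zero] at h2
    refine squeeze_zero (fun n => integral_nonneg fun d => norm_nonneg _) (fun n => ?_) h2
    -- The mean of `D n` is bounded by its root mean square because its variance is nonnegative.
    refine Real.le_sqrt_of_sq_le ?_
    have := variance_nonneg (D n) (Measure.pi fun _ : Fin n => P)
    rw [variance_eq_sub (hDL n)] at this
    simpa using this
  rw [tendsto_zero_iff_norm_tendsto_zero]
  refine squeeze_zero (fun n => norm_nonneg _) (fun n => ?_) hD0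
  have hexp : ∀ d : Fin n → O, Complex.exp (((Real.sqrt n)⁻¹ * ∑ i, f (d i) : ℝ) * Complex.I) =
      ∏ i, ψ n (d i) := by
    intro d
    rw [← Complex.exp_sum, ← Finset.sum_mul, ← Complex.ofReal_sum, Finset.mul_sum]
  simp_rw [hexp]
  rw [integral_mul_prod_eq hc (hψm n) (hψ1 n) (hmm n) (hm1 n) (hsplit n) n (F n) (hF n) (hF1 n)]
  have hcn : Measurable fun d : Fin n → O => F n fun i => c (d i) :=
    (hF n).comp (measurable_pi_lambda _ fun i => hc.comp (measurable_pi_apply i))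
  rw [← integral_const_mul, ← integral_sub]
  · refine (norm_integral_le_integral_norm _).trans (integral_mono_of_nonneg
      (Eventually.of_forall fun d => norm_nonneg _) ((hDL n).integrable (by norm_num))
      (Eventually.of_forall fun d => ?_))
    calc ‖F n (fun i => c (d i)) * ∏ i, m n (d i) - (e : ℂ) * F n fun i => c (d i)‖
        = ‖F n fun i => c (d i)‖ * D n d := by
          rw [mul_comm (e : ℂ), ← mul_sub, norm_mul]
      _ ≤ 1 * D n d := mul_le_mul_of_nonneg_right (hF1 n _) (norm_nonneg _)
      _ = D n d := one_mul _
  · refine Integrable.of_bound (C := 1) (hcn.mul (hprodmeas n)).aestronglyMeasurable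
      (Eventually.of_forall fun d => ?_)
    rw [norm_mul]
    exact mul_le_one₀ (hF1 n _) (norm_nonneg _) (hprodm n d)
  · exact (Integrable.of_bound (C := 1) hcn.aestronglyMeasurable
      (Eventually.of_forall fun d => hF1 n _)).const_mul _

end ConditionalCLT

end Samples

end

section

/-! ### Weak convergence and characteristic functions -/

section CharFun

variable {Ω : ℕ → Type*} [∀ n, MeasurableSpace (Ω n)] {P : ∀ n, Measure (Ω n)}
  [∀ n, IsProbabilityMeasure (P n)]

/-- This portmanteau implication brings the assumed normality of the estimator into the open-set
form used by the rest of the argument. -/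
lemma ConvergesInLaw.weaklyTendsto {E : Type*} [TopologicalSpace E]
    [TopologicalSpace.PseudoMetrizableSpace E] [MeasurableSpace E] [BorelSpace E]
    {X : ∀ n, Ω n → E} (hX : ∀ n, Measurable (X n)) {μ : Measure E} [IsProbabilityMeasure μ]
    (h : ConvergesInLaw P X μ) : WeaklyTendsto P X μ := by
  intro G hG
  have : ∀ n, IsProbabilityMeasure ((P n).map (X n)) := fun n =>
    Measure.isProbabilityMeasure_map (hX n).aemeasurable
  have := le_liminf_measure_open_of_forall_tendsto_measure (L := atTop) (μ := μ)
    (μs := fun n => (P n).map (X n)) (fun {B} hB hfr => by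
      simp_rw [Measure.map_apply (hX _) hB]
      exact h B hB hfr) G hG
  simpa only [Measure.map_apply (hX _) hG.measurableSet] using this

variable {E : Type*} [NormedAddCommGroup E] [InnerProductSpace ℝ E] [FiniteDimensional ℝ E]
  [MeasurableSpace E] [BorelSpace E]

lemma WeaklyTendsto.tendsto_charFun {X : ∀ n, Ω n → E} (hX : ∀ n, Measurable (X n))
    {μ : Measure E} [IsProbabilityMeasure μ] (h : WeaklyTendsto P X μ) (t : E) :
    Tendsto (fun n => ∫ ω, Complex.exp ((inner ℝ (X n ω) t : ℝ) * Complex.I) ∂P n) atTop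
      (𝓝 (charFun μ t)) := by
  have h1 : Tendsto (β := ProbabilityMeasure E)
      (fun n => ⟨(P n).map (X n), Measure.isProbabilityMeasure_map (hX n).aemeasurable⟩) atTop
      (𝓝 ⟨μ, inferInstance⟩) := by
    refine tendsto_of_forall_isOpen_le_liminf' fun G hG => ?_
    simp only [ProbabilityMeasure.coe_mk, Measure.map_apply (hX _) hG.measurableSet]
    exact h G hG
  have h2 := ProbabilityMeasure.tendsto_iff_tendsto_charFun.1 h1 t
  simp only [ProbabilityMeasure.coe_mk, charFun_apply] at h2 ⊢
  refine h2.congr fun n => ?_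
  rw [integral_map (hX n).aemeasurable (by fun_prop)]

/-- Lévy's continuity theorem is applied on the L² product, which is an inner product space and on
which characters factor. The result is carried back to the ordinary product, which has the same
topology. -/
lemma weaklyTendsto_prod_of_tendsto_charFun {F : Type*} [NormedAddCommGroup F]
    [InnerProductSpace ℝ F] [FiniteDimensional ℝ F] [MeasurableSpace F] [BorelSpace F]
    {X : ∀ n, Ω n → E} {Y : ∀ n, Ω n → F} (hX : ∀ n, Measurable (X n))
    (hY : ∀ n, Measurable (Y n)) {μ : Measure E} {ν : Measure F} [IsProbabilityMeasure μ]
    [IsProbabilityMeasure ν]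
    (h : ∀ s t, Tendsto (fun n => ∫ ω, Complex.exp ((inner ℝ (X n ω) s : ℝ) * Complex.I) *
      Complex.exp ((inner ℝ (Y n ω) t : ℝ) * Complex.I) ∂P n) atTop
      (𝓝 (charFun μ s * charFun ν t))) :
    WeaklyTendsto P (fun n ω => (X n ω, Y n ω)) (μ.prod ν) := by
  have hXY : ∀ n, Measurable fun ω => WithLp.toLp 2 (X n ω, Y n ω) := fun n =>
    (WithLp.prod_continuous_toLp 2 E F).measurable.comp ((hX n).prodMk (hY n))
  have hlp : Measurable (WithLp.toLp 2 : E × F → WithLp 2 (E × F)) :=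
    (WithLp.prod_continuous_toLp 2 E F).measurable
  have h1 : Tendsto (β := ProbabilityMeasure (WithLp 2 (E × F)))
      (fun n => ⟨(P n).map fun ω => WithLp.toLp 2 (X n ω, Y n ω),
        Measure.isProbabilityMeasure_map (hXY n).aemeasurable⟩) atTop
      (𝓝 ⟨(μ.prod ν).map (WithLp.toLp 2),
        Measure.isProbabilityMeasure_map hlp.aemeasurable⟩) := by
    refine ProbabilityMeasure.tendsto_of_tendsto_charFun fun t => ?_
    simp only [ProbabilityMeasure.coe_mk, charFun_prod]
    refine (h _ _).congr fun n => ?_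
    rw [charFun_apply, integral_map (hXY n).aemeasurable (by fun_prop)]
    refine integral_congr_ae (Eventually.of_forall fun ω => ?_)
    simp only [WithLp.prod_inner_apply]
    rw [← Complex.exp_add]
    push_cast
    ring_nf
  intro G hG
  have hG' : IsOpen ((WithLp.ofLp : WithLp 2 (E × F) → E × F) ⁻¹' G) :=
    hG.preimage (WithLp.prod_continuous_ofLp 2 E F)
  have h2 := ProbabilityMeasure.le_liminf_measure_open_of_tendsto h1 hG'
  simp only [ProbabilityMeasure.coe_mk, Measure.map_apply (hXY _) hG'.measurableSet,
    Measure.map_apply hlp hG'.measurableSet] at h2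
  exact h2

omit [FiniteDimensional ℝ E] in
/-- Weakly convergent sequences are bounded in probability. -/
lemma WeaklyTendsto.tendsto_smul_zero {X : ∀ n, Ω n → E} (hX : ∀ n, Measurable (X n))
    {μ : Measure E} [IsProbabilityMeasure μ] (h : WeaklyTendsto P X μ) {a : ℕ → ℝ}
    (ha : Tendsto a atTop (𝓝 0)) :
    Tendsto (fun x : Σ n, Ω n => a x.1 • X x.1 x.2) (whp P) (𝓝 0) := by
  rw [Metric.tendsto_nhds]
  intro ε hε
  rw [eventually_whp]
  let C : ℕ → Set E := fun k => {x | (k : ℝ) ≤ ‖x‖}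
  have hC : ∀ k, IsClosed (C k) := fun k => isClosed_le continuous_const continuous_norm
  have hlim : Tendsto (fun k => μ (C k)) atTop (𝓝 0) := by
    have := tendsto_measure_iInter_atTop (μ := μ) (s := C)
      (fun k => (hC k).measurableSet.nullMeasurableSet) (fun i j hij x hx =>
        le_trans (Nat.cast_le.2 hij) (show (j : ℝ) ≤ ‖x‖ from hx)) ⟨0, measure_ne_top _ _⟩
    have hemp : ⋂ k, C k = ∅ := by
      ext x
      simp only [Set.mem_iInter, Set.mem_empty_iff_false, iff_false, not_forall]
      obtain ⟨k, hk⟩ := exists_nat_gt ‖x‖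
      exact ⟨k, not_le.2 hk⟩
    rwa [hemp, measure_empty] at this
  refine tendsto_of_le_liminf_of_limsup_le zero_le (ge_of_tendsto' hlim fun k => ?_)
  refine le_trans (limsup_le_limsup ?_) (h.limsup_closed_le hX (hC k))
  -- Once `|a n| * k < ε`, the event `‖a n • X n‖ ≥ ε` forces `‖X n‖ ≥ k`, so its limiting
  -- probability is at most the tail `μ (C k)`.
  have h1 : ∀ᶠ n in atTop, |a n| * k < ε := by
    have := (ha.abs.mul_const (k : ℝ))
    simp only [abs_zero, zero_mul] at this
    exact this.eventually (gt_mem_nhds hε)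
  filter_upwards [h1] with n hn
  refine measure_mono fun ω hω => ?_
  change (k : ℝ) ≤ ‖X n ω‖
  have hω' : ¬ dist (a n • X n ω) 0 < ε := hω
  rw [dist_zero_right, norm_smul, Real.norm_eq_abs, not_lt] at hω'
  by_contra hc
  push Not at hc
  nlinarith [abs_nonneg (a n)]

end CharFun

/-! ### Gaussian laws -/

section Gaussian

open scoped MatrixOrder

variable {ι κ : Type*} [Fintype ι] [DecidableEq ι] [Fintype κ] [DecidableEq κ]

lemma withDensity_comp_map {α β : Type*} [MeasurableSpace α] [MeasurableSpace β] {μ : Measure α}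
    {g : α → β} (hg : Measurable g) {f : β → ENNReal} (hf : Measurable f) :
    (μ.map g).withDensity f = (μ.withDensity fun x => f (g x)).map g := by
  ext s hs
  rw [withDensity_apply _ hs, Measure.map_apply hg hs, withDensity_apply _ (hg hs),
    setLIntegral_map hs hf hg]

/-- Completing the square: −x²/2 + ax − a²/2 = −(x − a)²/2. -/
lemma gaussianReal_tilt (a : ℝ) :
    (gaussianReal 0 1).withDensity (fun x => ENNReal.ofReal (Real.exp (a * x - a ^ 2 / 2))) =
      gaussianReal a 1 := by
  rw [gaussianReal_of_var_ne_zero _ one_ne_zero, gaussianReal_of_var_ne_zero _ one_ne_zero,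
    ← withDensity_mul _ (measurable_gaussianPDF _ _) (by fun_prop)]
  congr 1
  funext x
  simp only [Pi.mul_apply, gaussianPDF_def, gaussianPDFReal_def]
  rw [← ENNReal.ofReal_mul (by positivity), mul_assoc, ← Real.exp_add]
  congr 3
  push_cast
  ring

omit [DecidableEq ι] in
lemma map_add_pi_gaussianReal (a : ι → ℝ) :
    (Measure.pi fun _ : ι => gaussianReal 0 1).map (fun x i => a i + x i) =
      Measure.pi fun i => gaussianReal (a i) 1 := by
  rw [Measure.pi_map_pi (f := fun i x => a i + x) fun i => by fun_prop]
  simp_rw [gaussianReal_map_const_add, zero_add]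

omit [DecidableEq ι] in
-- The exponent is a sum over coordinates, so the one-dimensional tilts multiply up to a tilt of the
-- product law.
lemma stdGaussian_tilt (a : EuclideanSpace ℝ ι) :
    (stdGaussian (EuclideanSpace ℝ ι)).withDensity
        (fun x => ENNReal.ofReal (Real.exp (a.ofLp ⬝ᵥ x.ofLp - a.ofLp ⬝ᵥ a.ofLp / 2))) =
      (stdGaussian (EuclideanSpace ℝ ι)).map fun x => a + x := by
  have hlp : Measurable (WithLp.toLp 2 : (ι → ℝ) → EuclideanSpace ℝ ι) := by fun_prop
  rw [← map_pi_eq_stdGaussian, withDensity_comp_map hlp (by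
    simp only [dotProduct]; fun_prop), Measure.map_map (by fun_prop) hlp]
  have h1 : ∀ i, IsProbabilityMeasure ((gaussianReal 0 1).withDensity
      fun x => ENNReal.ofReal (Real.exp (a i * x - a i ^ 2 / 2))) := fun i => by
    rw [gaussianReal_tilt]; infer_instance
  have h2 : (Measure.pi fun _ : ι => gaussianReal 0 1).withDensity
      (fun x => ENNReal.ofReal (Real.exp (a.ofLp ⬝ᵥ x - a.ofLp ⬝ᵥ a.ofLp / 2))) =
      Measure.pi fun i => gaussianReal (a i) 1 := by
    rw [show (fun i => gaussianReal (a i) 1) = fun i => (gaussianReal 0 1).withDensity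
      fun x => ENNReal.ofReal (Real.exp (a i * x - a i ^ 2 / 2)) from
      funext fun i => (gaussianReal_tilt _).symm]
    rw [pi_withDensity_eq fun i => by fun_prop]
    congr 1
    funext x
    rw [← ENNReal.ofReal_prod_of_nonneg fun i _ => (Real.exp_pos _).le, ← Real.exp_sum]
    congr 2
    simp only [dotProduct, Finset.sum_sub_distrib, Finset.sum_div, pow_two]
  rw [h2, ← map_add_pi_gaussianReal, Measure.map_map hlp (by fun_prop)]
  rfl

lemma sqrt_mul_sqrt_of_posSemidef {J : Matrix ι ι ℝ} (hJ : J.PosSemidef) :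
    CFC.sqrt J * CFC.sqrt J = J := CFC.sqrt_mul_sqrt_self _ hJ.nonneg

lemma transpose_sqrt (J : Matrix ι ι ℝ) : (CFC.sqrt J)ᵀ = CFC.sqrt J := by
  have := (CFC.sqrt_nonneg J).isSelfAdjoint
  rw [← conjTranspose_eq_transpose_of_trivial]
  exact this

lemma multivariateGaussian_eq_map (m : EuclideanSpace ℝ ι) (J : Matrix ι ι ℝ) :
    multivariateGaussian m J = (stdGaussian (EuclideanSpace ℝ ι)).map fun x =>
      m + WithLp.toLp 2 (CFC.sqrt J *ᵥ x.ofLp) := rfl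

/-- Exponential tilting shifts the mean of a centred Gaussian law. -/
lemma multivariateGaussian_tilt {J : Matrix ι ι ℝ} (hJ : J.PosSemidef) (δ : EuclideanSpace ℝ ι) :
    (multivariateGaussian 0 J).withDensity
        (fun u => ENNReal.ofReal (Real.exp (δ.ofLp ⬝ᵥ u.ofLp - δ.ofLp ⬝ᵥ J *ᵥ δ.ofLp / 2))) =
      multivariateGaussian (WithLp.toLp 2 (J *ᵥ δ.ofLp)) J := by
  have hA := sqrt_mul_sqrt_of_posSemidef hJ
  have hAT := transpose_sqrt J
  rw [multivariateGaussian_eq_map, multivariateGaussian_eq_map,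
    withDensity_comp_map (by fun_prop) (by simp only [dotProduct]; fun_prop)]
  set A := CFC.sqrt J
  -- With `A` the symmetric square root of `J`, δ·Ax = Aδ·x and δ·Jδ = ‖Aδ‖². This is the standard
  -- tilt by Aδ, and `A` maps that shift to Jδ.
  have h1 : ∀ x : EuclideanSpace ℝ ι,
      δ.ofLp ⬝ᵥ ((0 : EuclideanSpace ℝ ι) + WithLp.toLp 2 (A *ᵥ x.ofLp)).ofLp -
        δ.ofLp ⬝ᵥ J *ᵥ δ.ofLp / 2 =
      (WithLp.toLp 2 (A *ᵥ δ.ofLp) : EuclideanSpace ℝ ι).ofLp ⬝ᵥ x.ofLp -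
        (WithLp.toLp 2 (A *ᵥ δ.ofLp) : EuclideanSpace ℝ ι).ofLp ⬝ᵥ
          (WithLp.toLp 2 (A *ᵥ δ.ofLp) : EuclideanSpace ℝ ι).ofLp / 2 := by
    intro x
    rw [zero_add]
    simp only
    have e : ∀ y : ι → ℝ, δ.ofLp ⬝ᵥ A *ᵥ y = (A *ᵥ δ.ofLp) ⬝ᵥ y := fun y => by
      rw [dotProduct_mulVec, ← mulVec_transpose, hAT]
    rw [← e, ← e, mulVec_mulVec, hA]
  simp_rw [h1, stdGaussian_tilt]
  rw [Measure.map_map (by fun_prop) (by fun_prop)]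
  congr 1
  funext x
  ext i
  simp [mulVec_add, mulVec_mulVec, hA]

/-- Sums of independent Gaussian vectors. -/
lemma map_add_multivariateGaussian {J : Matrix ι ι ℝ} (hJ : J.PosSemidef) {S : Matrix κ κ ℝ}
    (hS : S.PosSemidef) (m : EuclideanSpace ℝ ι) (B : Matrix ι κ ℝ) :
    ((multivariateGaussian m J).prod (multivariateGaussian 0 S)).map
        (fun q => q.1 + WithLp.toLp 2 (B *ᵥ q.2.ofLp)) =
      multivariateGaussian m (J + B * S * Bᵀ) := by
  have hV : (J + B * S * Bᵀ).PosSemidef := by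
    have := hS.mul_mul_conjTranspose_same B
    rw [conjTranspose_eq_transpose_of_trivial] at this
    exact hJ.add this
  have hm : Measurable fun q : EuclideanSpace ℝ ι × EuclideanSpace ℝ κ =>
      q.1 + (WithLp.toLp 2 (B *ᵥ q.2.ofLp) : EuclideanSpace ℝ ι) := by fun_prop
  have := Measure.isProbabilityMeasure_map (μ := (multivariateGaussian m J).prod
    (multivariateGaussian 0 S)) hm.aemeasurable
  refine Measure.ext_of_charFun ?_
  funext t
  rw [charFun_apply, integral_map hm.aemeasurable (by fun_prop)]
  have h1 : ∀ q : EuclideanSpace ℝ ι × EuclideanSpace ℝ κ,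
      Complex.exp ((inner ℝ (q.1 + (WithLp.toLp 2 (B *ᵥ q.2.ofLp) : EuclideanSpace ℝ ι)) t : ℝ)
        * Complex.I) = Complex.exp ((inner ℝ q.1 t : ℝ) * Complex.I) *
        Complex.exp ((inner ℝ q.2 (WithLp.toLp 2 (Bᵀ *ᵥ t.ofLp) : EuclideanSpace ℝ κ) : ℝ)
          * Complex.I) := by
    intro q
    rw [← Complex.exp_add, ← add_mul, ← Complex.ofReal_add, inner_add_left]
    congr 5
    simp only [EuclideanSpace.inner_eq_star_dotProduct, star_trivial]
    rw [dotProduct_mulVec, ← mulVec_transpose]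
  simp_rw [h1]
  rw [integral_prod_mul (fun u : EuclideanSpace ℝ ι => Complex.exp ((inner ℝ u t : ℝ) * Complex.I))
    (fun w : EuclideanSpace ℝ κ => Complex.exp ((inner ℝ w
      (WithLp.toLp 2 (Bᵀ *ᵥ t.ofLp) : EuclideanSpace ℝ κ) : ℝ) * Complex.I)),
    ← charFun_apply, ← charFun_apply, charFun_multivariateGaussian hJ,
    charFun_multivariateGaussian hS, charFun_multivariateGaussian hV, ← Complex.exp_add]
  congr 1
  have h2 : (Bᵀ *ᵥ t.ofLp) ⬝ᵥ S *ᵥ (Bᵀ *ᵥ t.ofLp) = t.ofLp ⬝ᵥ (B * S * Bᵀ) *ᵥ t.ofLp := by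
    rw [← mulVec_mulVec, ← mulVec_mulVec, dotProduct_mulVec t.ofLp B, ← mulVec_transpose]
  simp only [h2, add_mulVec, dotProduct_add, inner_zero_right]
  push_cast
  ring

/-- The squared norm of a standard Gaussian vector translated by `a` is noncentral chi-squared. -/
lemma map_sq_norm_stdGaussian {p : ℕ} (a : Vec p) :
    (stdGaussian (Vec p)).map (fun x => ‖a + x‖ ^ 2) = chiSquared (p + 1) (‖a‖ ^ 2) := by
  -- A reflection moves `a` to the first coordinate axis and preserves both the norm and the
  -- standard Gaussian law; this matches the choice of means in `chiSquared`.
  let e : Vec p := ‖a‖ • EuclideanSpace.single 0 1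
  have hae : ‖a‖ = ‖e‖ := by simp [e, norm_smul]
  let R := Submodule.reflection (ℝ ∙ (a - e))ᗮ
  have hR : R a = e := Submodule.reflection_sub hae
  have h1 : (fun x : Vec p => ‖a + x‖ ^ 2) = (fun x => ‖e + x‖ ^ 2) ∘ R := by
    funext x
    rw [Function.comp_apply, ← hR, ← map_add, LinearIsometryEquiv.norm_map]
  have h2 : (stdGaussian (Vec p)).map R = stdGaussian (Vec p) := stdGaussian_map R
  rw [h1, ← Measure.map_map (by fun_prop) R.continuous.measurable, h2, ← map_pi_eq_stdGaussian,
    Measure.map_map (by fun_prop) (by fun_prop), chiSquared, Real.sqrt_sq (norm_nonneg _),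
    ← map_add_pi_gaussianReal fun i : Fin (p + 1) => if i.val = 0 then ‖a‖ else 0,
    Measure.map_map (by fun_prop) (by fun_prop)]
  congr 1
  funext x
  simp only [Function.comp_apply, EuclideanSpace.real_norm_sq_eq]
  refine Finset.sum_congr rfl fun i _ => ?_
  congr 1
  simp only [e, PiLp.add_apply, PiLp.smul_apply, smul_eq_mul, PiLp.single_apply]
  by_cases hi : i = 0
  · simp [hi]
  · simp [hi, Fin.val_ne_zero_iff.2 hi]

/-- The Mahalanobis norm of a Gaussian vector is noncentral chi-squared. -/
lemma map_quadraticForm_multivariateGaussian {p : ℕ} (m : Vec p) {V : Mat p} (hV : V.PosDef) :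
    (multivariateGaussian m V).map (fun z => z.ofLp ⬝ᵥ V⁻¹ *ᵥ z.ofLp) =
      chiSquared (p + 1) (m.ofLp ⬝ᵥ V⁻¹ *ᵥ m.ofLp) := by
  have hA := sqrt_mul_sqrt_of_posSemidef hV.posSemidef
  have hAT := transpose_sqrt V
  rw [multivariateGaussian_eq_map, Measure.map_map (by simp only [dotProduct]; fun_prop)
    (by fun_prop)]
  set A := CFC.sqrt V with hAdef
  have hdet : IsUnit A.det := by
    have h1 : A.det * A.det = V.det := by rw [← det_mul, hA]
    exact isUnit_iff_ne_zero.2 fun h0 => hV.det_pos.ne' (by rw [← h1, h0, zero_mul])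
  have hAi : A * A⁻¹ = 1 := mul_nonsing_inv A hdet
  -- Whitening: the form becomes ‖A⁻¹m + x‖² with `x` standard Gaussian.
  have hVi : V⁻¹ = A⁻¹ * A⁻¹ := by rw [← hA, Matrix.mul_inv_rev]
  have hAiT : (A⁻¹)ᵀ = A⁻¹ := by rw [transpose_nonsing_inv, hAT]
  have hq : ∀ z : Fin (p + 1) → ℝ, z ⬝ᵥ V⁻¹ *ᵥ z = (A⁻¹ *ᵥ z) ⬝ᵥ (A⁻¹ *ᵥ z) := fun z => by
    rw [hVi, ← mulVec_mulVec, dotProduct_mulVec, ← mulVec_transpose, hAiT]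
  have hn : ∀ v : Fin (p + 1) → ℝ, v ⬝ᵥ v = ‖(WithLp.toLp 2 v : Vec p)‖ ^ 2 := fun v => by
    rw [EuclideanSpace.real_norm_sq_eq]
    simp [dotProduct, pow_two]
  rw [hq m.ofLp, hn, ← map_sq_norm_stdGaussian]
  congr 1
  funext x
  rw [Function.comp_apply, hq, hn]
  congr 2
  ext i
  simp [mulVec_add, mulVec_mulVec, nonsing_inv_mul A hdet]

end Gaussian

end

section

/-! ### Calculus of generalized linear models -/

namespace GLM

/-- The law of the response with canonical parameter `γ`. -/
def response (M : GLM) (γ : ℝ) : Measure ℝ :=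
  M.ν.withDensity fun y => ENNReal.ofReal (M.density γ y)

/-- The dominating measure that makes the model a natural exponential family. -/
def baseMeasure (M : GLM) : Measure ℝ :=
  M.ν.withDensity fun y => ENNReal.ofReal (Real.exp (M.c y M.φ))

/-- The log-likelihood of a response as a function of the linear predictor, up to a constant. -/
def logLik (M : GLM) (η y : ℝ) : ℝ :=
  (y * M.canonical η - M.b (M.canonical η)) / M.a M.φ

/-- The derivative of the log-likelihood with respect to the linear predictor. -/
def scoreFun (M : GLM) (η y : ℝ) : ℝ :=
  (y - deriv M.b (M.canonical η)) * deriv M.canonical η / M.a M.φ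

/-- The second derivative of the log-likelihood with respect to the linear predictor. -/
def scoreDeriv (M : GLM) (η y : ℝ) : ℝ :=
  ((y - deriv M.b (M.canonical η)) * deriv (deriv M.canonical) η -
    deriv (deriv M.b) (M.canonical η) * deriv M.canonical η ^ 2) / M.a M.φ

variable {M : GLM} (hM : M.IsRegular)

/-! ### The response as a natural exponential family -/

section ExponentialFamily

lemma density_eq (γ y : ℝ) : M.density γ y = Real.exp (M.c y M.φ) *
    (Real.exp (γ / M.a M.φ * y) * Real.exp (-(M.b γ / M.a M.φ))) := by
  rw [density, ← Real.exp_add, ← Real.exp_add]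
  congr 1
  ring

include hM

lemma IsRegular.isProbabilityMeasure_response {γ : ℝ} (hγ : γ ∈ M.Γ) :
    IsProbabilityMeasure (M.response γ) :=
  ⟨by rw [response, withDensity_apply _ MeasurableSet.univ, Measure.restrict_univ,
    hM.normalized γ hγ]⟩

/-- The normalization of the density, solved for the Laplace transform of the base measure. This
identifies `b` with a cumulant generating function up to scaling by `a φ`, and the moments of the
response follow from it. -/
lemma IsRegular.lintegral_exp {γ : ℝ} (hγ : γ ∈ M.Γ) :
    ∫⁻ y, ENNReal.ofReal (Real.exp (γ / M.a M.φ * y)) ∂M.baseMeasure =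
      ENNReal.ofReal (Real.exp (M.b γ / M.a M.φ)) := by
  have hc := hM.measurable_c
  have h1 := hM.normalized γ hγ
  simp_rw [density_eq, ENNReal.ofReal_mul (Real.exp_pos _).le] at h1
  rw [baseMeasure, lintegral_withDensity_eq_lintegral_mul _ (by fun_prop) (by fun_prop)]
  have h2 : (∫⁻ y, ENNReal.ofReal (Real.exp (M.c y M.φ)) *
      ENNReal.ofReal (Real.exp (γ / M.a M.φ * y)) ∂M.ν) *
      ENNReal.ofReal (Real.exp (-(M.b γ / M.a M.φ))) = 1 := by
    rw [← h1, ← lintegral_mul_const _ (by fun_prop)]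
    simp_rw [mul_assoc]
  have h3 : ENNReal.ofReal (Real.exp (-(M.b γ / M.a M.φ))) *
      ENNReal.ofReal (Real.exp (M.b γ / M.a M.φ)) = 1 := by
    rw [← ENNReal.ofReal_mul (Real.exp_pos _).le, ← Real.exp_add]
    simp
  calc _ = (∫⁻ y, ENNReal.ofReal (Real.exp (M.c y M.φ)) *
      ENNReal.ofReal (Real.exp (γ / M.a M.φ * y)) ∂M.ν) *
      (ENNReal.ofReal (Real.exp (-(M.b γ / M.a M.φ))) *
        ENNReal.ofReal (Real.exp (M.b γ / M.a M.φ))) := by rw [h3, mul_one]; rfl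
    _ = _ := by rw [← mul_assoc, h2, one_mul]

lemma IsRegular.mem_integrableExpSet {γ : ℝ} (hγ : γ ∈ M.Γ) :
    γ / M.a M.φ ∈ integrableExpSet id M.baseMeasure := by
  refine ⟨by fun_prop, ?_⟩
  rw [hasFiniteIntegral_iff_ofReal (Eventually.of_forall fun _ => (Real.exp_pos _).le)]
  simp only [id]
  rw [hM.lintegral_exp hγ]
  exact ENNReal.ofReal_lt_top

lemma IsRegular.mgf_eq {γ : ℝ} (hγ : γ ∈ M.Γ) :
    mgf id M.baseMeasure (γ / M.a M.φ) = Real.exp (M.b γ / M.a M.φ) := by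
  rw [mgf, integral_eq_lintegral_of_nonneg_ae (Eventually.of_forall fun _ => (Real.exp_pos _).le)
    (by fun_prop)]
  simp only [id]
  rw [hM.lintegral_exp hγ, ENNReal.toReal_ofReal (Real.exp_pos _).le]

/-- Since `Γ` is open, exponential moments exist near `γ / a φ`. That is what analyticity of the
cumulant generating function and the moments of tilted laws require. -/
lemma IsRegular.mem_interior {γ : ℝ} (hγ : γ ∈ M.Γ) :
    γ / M.a M.φ ∈ interior (integrableExpSet id M.baseMeasure) := by
  refine _root_.mem_interior.2 ⟨{t | t * M.a M.φ ∈ M.Γ}, fun t ht => ?_,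
    hM.isOpen.preimage (continuous_mul_const _), ?_⟩
  · have := hM.mem_integrableExpSet ht
    rwa [mul_div_cancel_right₀ _ hM.a_pos.ne'] at this
  · change γ / M.a M.φ * M.a M.φ ∈ M.Γ
    rwa [div_mul_cancel₀ _ hM.a_pos.ne']

lemma IsRegular.b_eq {γ : ℝ} (hγ : γ ∈ M.Γ) :
    M.b γ = M.a M.φ * cgf id M.baseMeasure (γ / M.a M.φ) := by
  rw [cgf, hM.mgf_eq hγ, Real.log_exp, mul_div_cancel₀ _ hM.a_pos.ne']

lemma IsRegular.response_eq_tilted {γ : ℝ} (hγ : γ ∈ M.Γ) :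
    M.response γ = M.baseMeasure.tilted (γ / M.a M.φ * id ·) := by
  have hc := hM.measurable_c
  have h1 : ∫ y, Real.exp (γ / M.a M.φ * id y) ∂M.baseMeasure = Real.exp (M.b γ / M.a M.φ) :=
    hM.mgf_eq hγ
  rw [Measure.tilted, h1, baseMeasure, ← withDensity_mul _ (by fun_prop) (by fun_prop), response]
  congr 1
  funext y
  rw [Pi.mul_apply, ← ENNReal.ofReal_mul (Real.exp_pos _).le, density_eq, Real.exp_neg]
  rfl

lemma IsRegular.b_eventuallyEq {γ : ℝ} (hγ : γ ∈ M.Γ) :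
    M.b =ᶠ[𝓝 γ] fun γ => M.a M.φ * cgf id M.baseMeasure (γ / M.a M.φ) := by
  filter_upwards [hM.isOpen.mem_nhds hγ] with γ' hγ' using hM.b_eq hγ'

/-- `IsRegular` postulates no smoothness of `b`; it is inherited from the cumulant generating
function with which `b` agrees locally. -/
lemma IsRegular.analyticAt_b {γ : ℝ} (hγ : γ ∈ M.Γ) : AnalyticAt ℝ M.b γ := by
  refine AnalyticAt.congr ?_ (hM.b_eventuallyEq hγ).symm
  refine analyticAt_const.mul ?_
  exact AnalyticAt.comp (f := fun γ => γ / M.a M.φ) (analyticAt_cgf (hM.mem_interior hγ))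
    (analyticAt_id.div_const)

lemma IsRegular.deriv_b {γ : ℝ} (hγ : γ ∈ M.Γ) :
    deriv M.b γ = deriv (cgf id M.baseMeasure) (γ / M.a M.φ) := by
  rw [(hM.b_eventuallyEq hγ).deriv_eq]
  have h1 : HasDerivAt (cgf id M.baseMeasure) _ (γ / M.a M.φ) :=
    (analyticAt_cgf (hM.mem_interior hγ)).differentiableAt.hasDerivAt
  have h2 := (h1.comp γ ((hasDerivAt_id γ).div_const (M.a M.φ))).const_mul (M.a M.φ)
  rw [show (fun γ => M.a M.φ * cgf id M.baseMeasure (γ / M.a M.φ)) =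
    fun y => M.a M.φ * (cgf id M.baseMeasure ∘ fun x => id x / M.a M.φ) y from rfl, h2.deriv]
  field_simp [hM.a_pos.ne']

lemma IsRegular.deriv_deriv_b {γ : ℝ} (hγ : γ ∈ M.Γ) :
    M.a M.φ * deriv (deriv M.b) γ = iteratedDeriv 2 (cgf id M.baseMeasure) (γ / M.a M.φ) := by
  have h0 : deriv M.b =ᶠ[𝓝 γ] fun γ => deriv (cgf id M.baseMeasure) (γ / M.a M.φ) := by
    filter_upwards [hM.isOpen.mem_nhds hγ] with γ' hγ' using hM.deriv_b hγ'
  rw [h0.deriv_eq, iteratedDeriv_succ, iteratedDeriv_one]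
  have h1 : HasDerivAt (deriv (cgf id M.baseMeasure)) _ (γ / M.a M.φ) :=
    (analyticAt_cgf (hM.mem_interior hγ)).deriv.differentiableAt.hasDerivAt
  have h2 := h1.comp γ ((hasDerivAt_id γ).div_const (M.a M.φ))
  rw [show (fun γ => deriv (cgf id M.baseMeasure) (γ / M.a M.φ)) =
    (deriv (cgf id M.baseMeasure) ∘ fun x => id x / M.a M.φ) from rfl, h2.deriv]
  field_simp [hM.a_pos.ne']

lemma IsRegular.memLp_response {γ : ℝ} (hγ : γ ∈ M.Γ) : MemLp id 2 (M.response γ) := by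
  rw [hM.response_eq_tilted hγ]
  exact_mod_cast memLp_tilted_mul (hM.mem_interior hγ) 2

lemma IsRegular.integral_response {γ : ℝ} (hγ : γ ∈ M.Γ) :
    ∫ y, y ∂M.response γ = deriv M.b γ := by
  rw [hM.deriv_b hγ, ← integral_tilted_mul_self (hM.mem_interior hγ), hM.response_eq_tilted hγ]
  rfl

lemma IsRegular.integral_sq_response {γ : ℝ} (hγ : γ ∈ M.Γ) :
    ∫ y, (y - deriv M.b γ) ^ 2 ∂M.response γ = M.a M.φ * deriv (deriv M.b) γ := by
  rw [hM.deriv_deriv_b hγ, ← variance_tilted_mul (hM.mem_interior hγ),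
    ← hM.response_eq_tilted hγ, variance_eq_integral (by fun_prop)]
  simp [hM.integral_response hγ]

end ExponentialFamily

/-! ### The canonical parameter as a function of the linear predictor -/

section Link

include hM

lemma IsRegular.injOn_deriv_b : Set.InjOn (deriv M.b) M.Γ := by
  refine (strictMonoOn_of_deriv_pos hM.ordConnected.convex (fun γ hγ =>
    (hM.analyticAt_b hγ).deriv.continuousAt.continuousWithinAt) fun γ hγ =>
    hM.variance_pos γ (interior_subset hγ)).injOn

lemma IsRegular.injOn_link : Set.InjOn (fun γ => M.g (deriv M.b γ)) M.Γ := fun _ h1 _ h2 h =>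
  hM.injOn_deriv_b h1 h2 (hM.link_injOn (Set.mem_image_of_mem _ h1) (Set.mem_image_of_mem _ h2) h)

/-- The derivative `b''` does not vanish, so `b'` is locally open. Openness turns `ContDiffOn` of
the link on the mean space into `ContDiffAt` at each mean. -/
lemma IsRegular.isOpen_means : IsOpen (deriv M.b '' M.Γ) := by
  rw [isOpen_iff_mem_nhds]
  rintro _ ⟨γ, hγ, rfl⟩
  have h1 : ContDiffAt ℝ 1 (deriv M.b) γ := (hM.analyticAt_b hγ).deriv.contDiffAt
  rw [← (h1.hasStrictDerivAt one_ne_zero).map_nhds_eq (hM.variance_pos γ hγ).ne']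
  exact image_mem_map (hM.isOpen.mem_nhds hγ)

lemma IsRegular.contDiffAt_link {γ : ℝ} (hγ : γ ∈ M.Γ) :
    ContDiffAt ℝ 2 (fun γ => M.g (deriv M.b γ)) γ :=
  ContDiffAt.comp γ (hM.link_contDiff.contDiffAt (hM.isOpen_means.mem_nhds
    (Set.mem_image_of_mem _ hγ))) (hM.analyticAt_b hγ).deriv.contDiffAt

lemma IsRegular.deriv_link_ne {γ : ℝ} (hγ : γ ∈ M.Γ) :
    deriv (fun γ => M.g (deriv M.b γ)) γ ≠ 0 := by
  have h1 : DifferentiableAt ℝ M.g (deriv M.b γ) :=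
    (hM.link_contDiff.contDiffAt (hM.isOpen_means.mem_nhds
      (Set.mem_image_of_mem _ hγ))).differentiableAt two_ne_zero
  have h2 := h1.hasDerivAt.comp γ (hM.analyticAt_b hγ).deriv.differentiableAt.hasDerivAt
  rw [show (fun γ => M.g (deriv M.b γ)) = M.g ∘ deriv M.b from rfl, h2.deriv]
  exact mul_ne_zero (hM.link_deriv_ne _ (Set.mem_image_of_mem _ hγ)) (hM.variance_pos γ hγ).ne'

lemma IsRegular.isOpen_predictorRange : IsOpen M.predictorRange := by
  rw [predictorRange, isOpen_iff_mem_nhds]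
  rintro _ ⟨γ, hγ, rfl⟩
  rw [← ((hM.contDiffAt_link hγ).hasStrictDerivAt two_ne_zero).map_nhds_eq (hM.deriv_link_ne hγ)]
  exact image_mem_map (hM.isOpen.mem_nhds hγ)

omit hM in
lemma canonical_mem {η : ℝ} (hη : η ∈ M.predictorRange) : M.canonical η ∈ M.Γ :=
  Function.invFunOn_mem hη

omit hM in
lemma link_canonical {η : ℝ} (hη : η ∈ M.predictorRange) :
    M.g (deriv M.b (M.canonical η)) = η :=
  Function.invFunOn_eq (f := fun γ => M.g (deriv M.b γ)) hη

/-- The choice made by `invFunOn` is unique because γ ↦ g(b'(γ)) is injective on `Γ`. So `canonical`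
agrees near `η` with the local inverse from the inverse function theorem, which is C². -/
lemma IsRegular.contDiffAt_canonical {η : ℝ} (hη : η ∈ M.predictorRange) :
    ContDiffAt ℝ 2 M.canonical η := by
  obtain ⟨γ, hγ, rfl⟩ := hη
  have hc := hM.contDiffAt_link hγ
  have hd := (hc.differentiableAt two_ne_zero).hasDerivAt.hasFDerivAt_equiv (hM.deriv_link_ne hγ)
  refine (hc.to_localInverse hd two_ne_zero).congr_of_eventuallyEq ?_
  have hs := hc.hasStrictFDerivAt' hd two_ne_zero
  have h1 : ∀ᶠ y in 𝓝 (M.g (deriv M.b γ)), hc.localInverse hd two_ne_zero y ∈ M.Γ := by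
    have h2 : ContinuousAt (hc.localInverse hd two_ne_zero) (M.g (deriv M.b γ)) :=
      (hc.to_localInverse hd two_ne_zero).continuousAt
    refine h2.eventually (hM.isOpen.mem_nhds ?_)
    rw [show hc.localInverse hd two_ne_zero (M.g (deriv M.b γ)) = γ from
      hc.localInverse_apply_image hd two_ne_zero]
    exact hγ
  filter_upwards [h1, hs.eventually_right_inverse] with y hy1 hy2
  have hy : y ∈ M.predictorRange := ⟨_, hy1, hy2⟩
  exact hM.injOn_link (canonical_mem hy) hy1 ((link_canonical hy).trans hy2.symm)

lemma IsRegular.hasDerivAt_canonical {η : ℝ} (hη : η ∈ M.predictorRange) :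
    HasDerivAt M.canonical (deriv M.canonical η) η :=
  ((hM.contDiffAt_canonical hη).differentiableAt two_ne_zero).hasDerivAt

lemma IsRegular.contDiffAt_deriv_canonical {η : ℝ} (hη : η ∈ M.predictorRange) :
    ContDiffAt ℝ 1 (deriv M.canonical) η :=
  (hM.contDiffAt_canonical hη).derivWithin (m := 1) (by norm_num)

lemma IsRegular.hasDerivAt_mean {η : ℝ} (hη : η ∈ M.predictorRange) :
    HasDerivAt (fun η => deriv M.b (M.canonical η))
      (deriv (deriv M.b) (M.canonical η) * deriv M.canonical η) η :=
  (hM.analyticAt_b (canonical_mem hη)).deriv.differentiableAt.hasDerivAt.comp η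
    (hM.hasDerivAt_canonical hη)

lemma IsRegular.hasDerivAt_logLik {η : ℝ} (hη : η ∈ M.predictorRange) (y : ℝ) :
    HasDerivAt (fun η => M.logLik η y) (M.scoreFun η y) η := by
  have h1 := hM.hasDerivAt_canonical hη
  have h2 := (hM.analyticAt_b (canonical_mem hη)).differentiableAt.hasDerivAt.comp η h1
  refine (((h1.const_mul y).sub h2).div_const (M.a M.φ)).congr_deriv ?_
  rw [scoreFun]
  ring

lemma IsRegular.hasDerivAt_scoreFun {η : ℝ} (hη : η ∈ M.predictorRange) (y : ℝ) :
    HasDerivAt (fun η => M.scoreFun η y) (M.scoreDeriv η y) η := by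
  have h1 := ((hM.contDiffAt_deriv_canonical hη).differentiableAt one_ne_zero).hasDerivAt
  refine ((((hM.hasDerivAt_mean hη).const_sub y).mul h1).div_const (M.a M.φ)).congr_deriv ?_
  rw [scoreDeriv]
  ring

lemma IsRegular.continuousAt_scoreDeriv {η : ℝ} (hη : η ∈ M.predictorRange) (y : ℝ) :
    ContinuousAt (fun η => M.scoreDeriv η y) η := by
  have h1 := hM.hasDerivAt_mean hη |>.continuousAt
  have h2 := (hM.contDiffAt_deriv_canonical hη).continuousAt
  have h3 : ContinuousAt (deriv (deriv M.canonical)) η :=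
    ((hM.contDiffAt_deriv_canonical hη).derivWithin (m := 0) (by norm_num)).continuousAt
  have h4 : ContinuousAt (fun η => deriv (deriv M.b) (M.canonical η)) η :=
    ContinuousAt.comp (hM.analyticAt_b (canonical_mem hη)).deriv.deriv.continuousAt
      (hM.hasDerivAt_canonical hη).continuousAt
  unfold scoreDeriv
  exact (((continuousAt_const.sub h1).mul h3).sub (h4.mul (h2.pow 2))).div_const _

lemma IsRegular.measurable_comp_canonical {f : ℝ → ℝ} (hf : ContinuousOn f M.Γ) :
    Measurable fun η => f (M.canonical η) := by
  classical
  have h1 : (fun η => f (M.canonical η)) = M.predictorRange.piecewise (fun η => f (M.canonical η))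
      -- Outside the predictor range `invFunOn` returns one fixed default value. The function is
      -- therefore continuous on an open set and constant elsewhere.
      fun _ => f (Classical.choice inferInstance) := by
    funext η
    by_cases hη : η ∈ M.predictorRange
    · rw [Set.piecewise_eq_of_mem _ _ _ hη]
    · rw [Set.piecewise_eq_of_notMem _ _ _ hη, canonical, Function.invFunOn_neg hη]
  rw [h1]
  refine ContinuousOn.measurable_piecewise ?_ continuousOn_const
    hM.isOpen_predictorRange.measurableSet
  exact hf.comp (fun η hη => (hM.hasDerivAt_canonical hη).continuousAt.continuousWithinAt)
    fun η hη => canonical_mem hη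

lemma IsRegular.measurable_canonical : Measurable M.canonical :=
  hM.measurable_comp_canonical continuousOn_id

lemma IsRegular.measurable_logLik : Measurable (Function.uncurry M.logLik) := by
  have h1 := hM.measurable_canonical
  have h2 := hM.measurable_comp_canonical (f := M.b) fun γ hγ =>
    (hM.analyticAt_b hγ).continuousAt.continuousWithinAt
  unfold logLik Function.uncurry
  exact ((measurable_snd.mul (h1.comp measurable_fst)).sub (h2.comp measurable_fst)).div_const _

lemma IsRegular.measurable_scoreFun : Measurable (Function.uncurry M.scoreFun) := by
  have h1 := hM.measurable_canonical
  have h2 := measurable_deriv M.b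
  have h3 := measurable_deriv M.canonical
  unfold scoreFun Function.uncurry
  fun_prop

lemma IsRegular.measurable_scoreDeriv : Measurable (Function.uncurry M.scoreDeriv) := by
  have h1 := hM.measurable_canonical
  have h2 := measurable_deriv M.b
  have h3 := measurable_deriv M.canonical
  have h4 := measurable_deriv (deriv M.b)
  have h5 := measurable_deriv (deriv M.canonical)
  unfold scoreDeriv Function.uncurry
  fun_prop

omit hM in
lemma density_canonical_eq (η y : ℝ) :
    M.density (M.canonical η) y = Real.exp (M.logLik η y + M.c y M.φ) := rfl

lemma IsRegular.measurable_density :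
    Measurable fun q : ℝ × ℝ => M.density (M.canonical q.1) q.2 := by
  simp only [density_canonical_eq]
  exact (hM.measurable_logLik.add (hM.measurable_c.comp measurable_snd)).exp

end Link

/-! ### Bartlett identities -/

section Bartlett

variable {η : ℝ} (hη : η ∈ M.predictorRange)

include hM hη

lemma IsRegular.memLp_residual : MemLp (fun y => y - deriv M.b (M.canonical η)) 2
    (M.response (M.canonical η)) := by
  have := hM.isProbabilityMeasure_response (canonical_mem hη)
  exact (hM.memLp_response (canonical_mem hη)).sub (memLp_const _)

lemma IsRegular.integral_residual :
    ∫ y, (y - deriv M.b (M.canonical η)) ∂M.response (M.canonical η) = 0 := by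
  have := hM.isProbabilityMeasure_response (canonical_mem hη)
  rw [integral_sub (f := fun y => y)
    ((hM.memLp_response (canonical_mem hη)).integrable (by norm_num)) (integrable_const _), hM.integral_response (canonical_mem hη)]
  simp

lemma IsRegular.memLp_scoreFun : MemLp (M.scoreFun η) 2 (M.response (M.canonical η)) := by
  have := (hM.memLp_residual hη).mul_const (deriv M.canonical η / M.a M.φ)
  refine this.congr_norm ?_ ?_
  · exact (hM.measurable_scoreFun.comp (measurable_const.prodMk measurable_id)).aestronglyMeasurable
  · exact Eventually.of_forall fun y => by simp only [scoreFun, mul_div_assoc]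

/-- The score has mean zero. -/
lemma IsRegular.integral_scoreFun : ∫ y, M.scoreFun η y ∂M.response (M.canonical η) = 0 := by
  simp only [scoreFun]
  simp_rw [mul_div_assoc]
  rw [integral_mul_const, hM.integral_residual hη, zero_mul]

/-- The information identity: the variance of the score is minus the mean of its derivative. -/
lemma IsRegular.integral_scoreFun_sq :
    ∫ y, M.scoreFun η y ^ 2 ∂M.response (M.canonical η) =
      -∫ y, M.scoreDeriv η y ∂M.response (M.canonical η) := by
  have := hM.isProbabilityMeasure_response (canonical_mem hη)
  have h1 : ∀ y, M.scoreFun η y ^ 2 = (y - deriv M.b (M.canonical η)) ^ 2 *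
      (deriv M.canonical η / M.a M.φ) ^ 2 := fun y => by rw [scoreFun]; ring
  have h2 : ∀ y, M.scoreDeriv η y = (y - deriv M.b (M.canonical η)) *
      (deriv (deriv M.canonical) η / M.a M.φ) -
      deriv (deriv M.b) (M.canonical η) * deriv M.canonical η ^ 2 / M.a M.φ := fun y => by
    rw [scoreDeriv]; ring
  simp_rw [h1, h2]
  rw [integral_mul_const, hM.integral_sq_response (canonical_mem hη),
    integral_sub (((hM.memLp_residual hη).integrable (by norm_num)).mul_const _)
      (integrable_const _), integral_mul_const, hM.integral_residual hη]
  have := hM.a_pos.ne'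
  simp
  field_simp

/-- The information identity, weakened to an inequality in `[0, ∞]`, can be integrated over the
covariates before any integrability of the squared score is known. -/
lemma IsRegular.lintegral_scoreFun_sq_le :
    ∫⁻ y, ENNReal.ofReal (M.scoreFun η y ^ 2) ∂M.response (M.canonical η) ≤
      ∫⁻ y, ‖M.scoreDeriv η y‖ₑ ∂M.response (M.canonical η) := by
  rw [← ofReal_integral_eq_lintegral_ofReal (hM.memLp_scoreFun hη).integrable_sq
    (Eventually.of_forall fun y => sq_nonneg _), hM.integral_scoreFun_sq hη]
  refine le_trans ?_ (enorm_integral_le_lintegral_enorm _)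
  rw [← ofReal_norm, Real.norm_eq_abs]
  exact ENNReal.ofReal_le_ofReal (neg_le_abs _)

end Bartlett

end GLM

end

section

/-! ### One observation -/

namespace GLM

variable {p : ℕ} {M : GLM}

/-- The score of an observation at `ϑ = θ + β`, in closed form. -/
def treatedScore (M : GLM) (ϑ : Vec p) (o : Obs p) : Vec p :=
  if o.1.2 then M.scoreFun (inner ℝ ϑ o.1.1) o.2 • o.1.1 else 0

/-- The scalar factor in the derivative of the score of an observation at `ϑ = θ + β`. -/
def curvature (M : GLM) (ϑ : Vec p) (o : Obs p) : ℝ :=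
  if o.1.2 then M.scoreDeriv (inner ℝ ϑ o.1.1) o.2 else 0

lemma linPred_true (θ β x : Vec p) : linPred θ β x true = inner ℝ (θ + β) x := by
  simp [linPred, inner_add_left]

lemma linPred_false (θ β x : Vec p) : linPred θ β x false = inner ℝ θ x := by
  simp [linPred]

lemma linPred_zero (θ x : Vec p) (a : Bool) : linPred θ 0 x a = inner ℝ θ x := by
  simp [linPred]

lemma measurable_linPred (θ β : Vec p) :
    Measurable fun z : Vec p × Bool => linPred θ β z.1 z.2 := by
  have h1 : Measurable fun a : Bool => if a then (1 : ℝ) else 0 := measurable_of_countable _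
  have h2 : ∀ θ : Vec p, Measurable fun z : Vec p × Bool => (inner ℝ θ z.1 : ℝ) := fun θ =>
    (measurable_const.inner measurable_fst)
  exact (h2 θ).add ((h2 β).mul (h1.comp measurable_snd))

lemma measurableSet_treated : MeasurableSet {o : Obs p | o.1.2 = true} :=
  (measurable_snd.comp measurable_fst) (MeasurableSet.singleton true)

section Measurability

variable (hM : M.IsRegular)
include hM

lemma IsRegular.measurable_treatedScore (ϑ : Vec p) : Measurable (M.treatedScore ϑ) := by
  refine Measurable.ite measurableSet_treated ?_ measurable_const
  exact (hM.measurable_scoreFun.comp (f := fun o : Obs p => ((inner ℝ ϑ o.1.1 : ℝ), o.2))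
    (by fun_prop)).smul (by fun_prop)

lemma IsRegular.measurable_curvature (ϑ : Vec p) : Measurable (M.curvature ϑ) := by
  refine Measurable.ite measurableSet_treated ?_ measurable_const
  exact hM.measurable_scoreDeriv.comp (f := fun o : Obs p => ((inner ℝ ϑ o.1.1 : ℝ), o.2))
    (by fun_prop)

end Measurability

/-! ### Derivatives of the score -/

section Derivatives

variable (hM : M.IsRegular)
include hM

/-- By the chain rule ∂μ/∂β = b''(γ) γ'(η) x, and the factor b''(γ) cancels against the variance
function. What remains depends on θ and β only through their sum. -/
lemma IsRegular.obsScore_eq {θ β : Vec p} {o : Obs p}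
    (h : o.1.2 = true → inner ℝ (θ + β) o.1.1 ∈ M.predictorRange) :
    M.obsScore θ β o = M.treatedScore (θ + β) o := by
  obtain ⟨⟨x, a⟩, y⟩ := o
  cases a with
  | false => simp [obsScore, treatedScore]
  | true =>
    have hη : inner ℝ (θ + β) x ∈ M.predictorRange := h rfl
    have hlin : ∀ β', linPred θ β' x true = inner ℝ (θ + β') x := fun β' => linPred_true θ β' x
    have hg : HasGradientAt (fun β' => M.mean θ β' x true)
        ((deriv (deriv M.b) (M.canonical (inner ℝ (θ + β) x)) *
          deriv M.canonical (inner ℝ (θ + β) x)) • x) β := by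
      have h1 : HasFDerivAt (fun β' : Vec p => (inner ℝ (θ + β') x : ℝ)) (innerSL ℝ x) β := by
        have := ((innerSL ℝ x).hasFDerivAt (x := θ + β)).comp β ((hasFDerivAt_id β).const_add θ)
        refine this.congr_of_eventuallyEq (Eventually.of_forall fun β' => ?_) |>.congr_fderiv ?_
        · simp [real_inner_comm]
        · rfl
      have h2 := (hM.hasDerivAt_mean hη).comp_hasFDerivAt β h1
      rw [hasGradientAt_iff_hasFDerivAt]
      simp only [GLM.mean, hlin]
      refine h2.congr_fderiv ?_
      ext v
      simp
    simp only [obsScore, treatedScore, if_true]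
    rw [hg.gradient, GLM.mean, GLM.varFun, linPred_true, scoreFun, smul_smul]
    congr 1
    have h1 := hM.a_pos.ne'
    have h2 := (hM.variance_pos _ (canonical_mem hη)).ne'
    field_simp

/-- The derivative of the score of one observation. -/
def scoreFDeriv (M : GLM) (ϑ : Vec p) (o : Obs p) : Vec p →L[ℝ] Vec p :=
  M.curvature ϑ o • (innerSL ℝ o.1.1).smulRight o.1.1

omit hM in
lemma norm_scoreFDeriv (ϑ : Vec p) (o : Obs p) :
    ‖M.scoreFDeriv ϑ o‖ = |M.curvature ϑ o| * ‖o.1.1‖ ^ 2 := by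
  rw [scoreFDeriv, norm_smul, ContinuousLinearMap.norm_smulRight_apply, innerSL_apply_norm,
    Real.norm_eq_abs, pow_two]

lemma IsRegular.hasFDerivAt_treatedScore {ϑ : Vec p} {o : Obs p}
    (h : o.1.2 = true → inner ℝ ϑ o.1.1 ∈ M.predictorRange) :
    HasFDerivAt (fun ϑ => M.treatedScore ϑ o) (M.scoreFDeriv ϑ o) ϑ := by
  obtain ⟨⟨x, a⟩, y⟩ := o
  cases a with
  | false =>
    simp only [treatedScore, scoreFDeriv, curvature]
    simpa using hasFDerivAt_const (0 : Vec p) ϑ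
  | true =>
    have hη : inner ℝ ϑ x ∈ M.predictorRange := h rfl
    have h1 : HasFDerivAt (fun ϑ : Vec p => (inner ℝ ϑ x : ℝ)) (innerSL ℝ x) ϑ := by
      refine ((innerSL ℝ x).hasFDerivAt (x := ϑ)).congr_of_eventuallyEq
        (Eventually.of_forall fun β' => ?_)
      simp [real_inner_comm]
    have h2 := ((hM.hasDerivAt_scoreFun hη y).comp_hasFDerivAt ϑ h1).smul_const x
    simp only [treatedScore, scoreFDeriv, curvature, if_true]
    refine h2.congr_fderiv ?_
    ext v
    simp [mul_assoc]

lemma IsRegular.eventually_mem_predictorRange {ϑ : Vec p} {o : Obs p}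
    (h : o.1.2 = true → inner ℝ ϑ o.1.1 ∈ M.predictorRange) :
    ∀ᶠ ϑ' in 𝓝 ϑ, o.1.2 = true → inner ℝ ϑ' o.1.1 ∈ M.predictorRange := by
  by_cases ho : o.1.2 = true
  · have h1 : ContinuousAt (fun ϑ' : Vec p => (inner ℝ ϑ' o.1.1 : ℝ)) ϑ := by fun_prop
    filter_upwards [h1.eventually (hM.isOpen_predictorRange.mem_nhds (h ho))] with ϑ' h' _ using h'
  · exact Eventually.of_forall fun _ h' => absurd h' ho

lemma IsRegular.hasFDerivAt_obsScore_right {θ β : Vec p} {o : Obs p}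
    (h : o.1.2 = true → inner ℝ (θ + β) o.1.1 ∈ M.predictorRange) :
    HasFDerivAt (fun β' => M.obsScore θ β' o) (M.scoreFDeriv (θ + β) o) β := by
  have h1 := (hM.hasFDerivAt_treatedScore h).comp β ((hasFDerivAt_id β).const_add θ)
  refine h1.congr_of_eventuallyEq ?_
  have h2 : ContinuousAt (fun β' : Vec p => θ + β') β := by fun_prop
  filter_upwards [h2.eventually (hM.eventually_mem_predictorRange h)] with β' h'
  exact hM.obsScore_eq h'

lemma IsRegular.hasFDerivAt_obsScore_left {θ β : Vec p} {o : Obs p}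
    (h : o.1.2 = true → inner ℝ (θ + β) o.1.1 ∈ M.predictorRange) :
    HasFDerivAt (fun θ' => M.obsScore θ' β o) (M.scoreFDeriv (θ + β) o) θ := by
  have h1 := (hM.hasFDerivAt_treatedScore h).comp θ ((hasFDerivAt_id θ).add_const β)
  refine h1.congr_of_eventuallyEq ?_
  have h2 : ContinuousAt (fun θ' : Vec p => θ' + β) θ := by fun_prop
  filter_upwards [h2.eventually (hM.eventually_mem_predictorRange h)] with θ' h'
  exact hM.obsScore_eq h'

omit hM in
lemma scoreFDeriv_apply (ϑ : Vec p) (o : Obs p) (i j : Fin (p + 1)) :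
    M.scoreFDeriv ϑ o (EuclideanSpace.single j 1) i =
      M.curvature ϑ o * (o.1.1 i * o.1.1 j) := by
  simp [scoreFDeriv, EuclideanSpace.inner_single_right, mul_comm]

/-- Minus the average derivative of the score of a sample at `ϑ = θ + β`, in closed form. -/
def sampleInfo (M : GLM) {n : ℕ} (d : Fin n → Obs p) (ϑ : Vec p) : Mat p :=
  Matrix.of fun i j => -((n : ℝ)⁻¹ * ∑ k, M.curvature ϑ (d k) * ((d k).1.1 i * (d k).1.1 j))

variable {n : ℕ} {d : Fin n → Obs p} {θ β : Vec p}
  (h : ∀ k, (d k).1.2 = true → inner ℝ (θ + β) (d k).1.1 ∈ M.predictorRange)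
include h

lemma IsRegular.infoBetaBar_eq : M.infoBetaBar d θ β = M.sampleInfo d (θ + β) := by
  have h1 : HasFDerivAt (fun β' => M.score d θ β') (∑ k, M.scoreFDeriv (θ + β) (d k)) β :=
    HasFDerivAt.fun_sum fun k _ => hM.hasFDerivAt_obsScore_right (h k)
  ext i j
  simp [infoBetaBar, jacobian, h1.fderiv, sampleInfo,
    scoreFDeriv_apply]

lemma IsRegular.infoThetaBar_eq : M.infoThetaBar d θ β = M.sampleInfo d (θ + β) := by
  have h1 : HasFDerivAt (fun θ' => M.score d θ' β) (∑ k, M.scoreFDeriv (θ + β) (d k)) θ :=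
    HasFDerivAt.fun_sum fun k _ => hM.hasFDerivAt_obsScore_left (h k)
  ext i j
  simp [infoThetaBar, jacobian, h1.fderiv, sampleInfo,
    scoreFDeriv_apply]

lemma IsRegular.score_eq : M.score d θ β = ∑ k, M.treatedScore (θ + β) (d k) :=
  Finset.sum_congr rfl fun k _ => hM.obsScore_eq (h k)

end Derivatives

/-! ### Taylor expansions of the score and the log-likelihood -/

section Taylor

variable (hM : M.IsRegular)
include hM

/-- First order expansion of the score and second order expansion of the log-likelihood in the
linear predictor. -/
lemma IsRegular.taylor_scoreFun {η s C y : ℝ}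
    (hr : ∀ t ∈ Set.Icc (0 : ℝ) 1, η + t * s ∈ M.predictorRange)
    (hC : ∀ t ∈ Set.Icc (0 : ℝ) 1, |M.scoreDeriv (η + t * s) y - M.scoreDeriv η y| ≤ C) :
    |M.scoreFun (η + s) y - M.scoreFun η y - M.scoreDeriv η y * s| ≤ C * |s| ∧
    |M.logLik (η + s) y - M.logLik η y - M.scoreFun η y * s - M.scoreDeriv η y * s ^ 2 / 2| ≤
      C * s ^ 2 := by
  have hlin : ∀ t : ℝ, HasDerivAt (fun t : ℝ => η + t * s) s t := fun t => by
    simpa using ((hasDerivAt_id t).mul_const s).const_add η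
  -- After the linear part is subtracted, the `t`-derivative is at most `C * |s|`, so the mean value
  -- inequality applies. The bound is kept for all `t` because the remainder at `t`, times `s`, is
  -- the derivative needed for the log-likelihood.
  have h1 : ∀ t ∈ Set.Icc (0 : ℝ) 1,
      |M.scoreFun (η + t * s) y - M.scoreFun η y - M.scoreDeriv η y * (t * s)| ≤ C * |s| := by
    intro t ht
    have hd : ∀ τ ∈ Set.Icc (0 : ℝ) 1, HasDerivWithinAt
        (fun t => M.scoreFun (η + t * s) y - M.scoreDeriv η y * (t * s))
        (M.scoreDeriv (η + τ * s) y * s - M.scoreDeriv η y * s) (Set.Icc 0 1) τ := by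
      intro τ hτ
      have e1 : HasDerivAt (fun t => M.scoreFun (η + t * s) y) _ τ :=
        HasDerivAt.comp (h₂ := fun η => M.scoreFun η y) (h := fun t => η + t * s) τ
          (hM.hasDerivAt_scoreFun (hr τ hτ) y) (hlin τ)
      have e2 := ((hasDerivAt_id τ).mul_const s).const_mul (M.scoreDeriv η y)
      refine (e1.sub (e2.congr_deriv ?_)).hasDerivWithinAt
      simp
    have := (convex_Icc (0 : ℝ) 1).norm_image_sub_le_of_norm_hasDerivWithin_le hd
      (C := C * |s|) (fun τ hτ => by
        rw [← sub_mul, norm_mul, Real.norm_eq_abs, Real.norm_eq_abs]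
        exact mul_le_mul_of_nonneg_right (hC τ hτ) (abs_nonneg _))
      (Set.left_mem_Icc.2 zero_le_one) ht
    have hC0 : 0 ≤ C := (abs_nonneg _).trans (hC 0 (Set.left_mem_Icc.2 zero_le_one))
    rw [Real.norm_eq_abs, Real.norm_eq_abs, sub_zero, abs_of_nonneg ht.1] at this
    simp only [zero_mul, add_zero, mul_zero, sub_zero] at this
    calc _ = |M.scoreFun (η + t * s) y - M.scoreDeriv η y * (t * s) - M.scoreFun η y| := by
          congr 1; ring
      _ ≤ C * |s| * t := this
      _ ≤ C * |s| := mul_le_of_le_one_right (mul_nonneg hC0 (abs_nonneg _)) ht.2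
  refine ⟨by simpa using h1 1 (Set.right_mem_Icc.2 zero_le_one), ?_⟩
  have hd : ∀ τ ∈ Set.Icc (0 : ℝ) 1, HasDerivWithinAt
      (fun t => M.logLik (η + t * s) y - M.scoreFun η y * s * t -
        M.scoreDeriv η y * s ^ 2 / 2 * t ^ 2)
      (M.scoreFun (η + τ * s) y * s - M.scoreFun η y * s -
        M.scoreDeriv η y * s ^ 2 * τ) (Set.Icc 0 1) τ := by
    intro τ hτ
    have e1 : HasDerivAt (fun t => M.logLik (η + t * s) y) _ τ :=
      HasDerivAt.comp (h₂ := fun η => M.logLik η y) (h := fun t => η + t * s) τ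
        (hM.hasDerivAt_logLik (hr τ hτ) y) (hlin τ)
    have e2 := (hasDerivAt_id τ).const_mul (M.scoreFun η y * s)
    have e3 := ((hasDerivAt_id τ).pow 2).const_mul (M.scoreDeriv η y * s ^ 2 / 2)
    refine ((e1.sub (e2.congr_deriv ?_)).sub (e3.congr_deriv ?_)).hasDerivWithinAt
    · simp
    · simp; ring
  have := (convex_Icc (0 : ℝ) 1).norm_image_sub_le_of_norm_hasDerivWithin_le hd
    (C := C * s ^ 2) (fun τ hτ => by
      rw [Real.norm_eq_abs]
      calc _ = |M.scoreFun (η + τ * s) y - M.scoreFun η y - M.scoreDeriv η y * (τ * s)| * |s| := by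
            rw [← abs_mul]; congr 1; ring
        _ ≤ C * |s| * |s| := mul_le_mul_of_nonneg_right (h1 τ hτ) (abs_nonneg _)
        _ = C * s ^ 2 := by rw [mul_assoc, ← sq, sq_abs])
    (Set.left_mem_Icc.2 zero_le_one) (Set.right_mem_Icc.2 zero_le_one)
  simp only [Real.norm_eq_abs, zero_mul, mul_zero, add_zero, one_mul, mul_one, sub_zero, one_pow,
    abs_one, ne_eq, OfNat.ofNat_ne_zero, not_false_eq_true, zero_pow] at this
  calc _ = |M.logLik (η + s) y - M.scoreFun η y * s - M.scoreDeriv η y * s ^ 2 / 2 -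
        M.logLik η y| := by congr 1; ring
    _ ≤ _ := this

/-- The log-likelihood contribution of a treated subject relative to `θ`. -/
lemma IsRegular.taylor_obs {θ h : Vec p} {o : Obs p} {w r : ℝ} (hh : ‖h‖ < r)
    (hr : o.1.2 = true → ∀ ϑ ∈ Metric.ball θ r, inner ℝ ϑ o.1.1 ∈ M.predictorRange)
    (hw : ∀ ϑ ∈ Metric.ball θ r, |M.curvature ϑ o - M.curvature θ o| * ‖o.1.1‖ ^ 2 ≤ w) :
    ‖M.treatedScore (θ + h) o - M.treatedScore θ o -
      (M.curvature θ o * inner ℝ h o.1.1) • o.1.1‖ ≤ w * ‖h‖ ∧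
    |M.logLik (linPred θ h o.1.1 o.1.2) o.2 - M.logLik (linPred θ 0 o.1.1 o.1.2) o.2 -
      inner ℝ h (M.treatedScore θ o) - M.curvature θ o * (inner ℝ h o.1.1) ^ 2 / 2| ≤
        w * ‖h‖ ^ 2 := by
  have hr0 : 0 < r := (norm_nonneg h).trans_lt hh
  have hw0 : 0 ≤ w := by simpa using hw θ (Metric.mem_ball_self hr0)
  obtain ⟨⟨x, a⟩, y⟩ := o
  cases a with
  | false =>
    simp only [treatedScore, curvature, linPred_false]
    constructor
    · simpa using mul_nonneg hw0 (norm_nonneg h)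
    · simpa using mul_nonneg hw0 (sq_nonneg ‖h‖)
  | true =>
    simp only [treatedScore, curvature, linPred_true, if_true, add_zero] at hr hw ⊢
    -- The scalar expansion will be used with `C = w / ‖x‖ ^ 2`.
    by_cases hx : x = 0
    · subst hx
      simp
      constructor <;> positivity
    have hxp : 0 < ‖x‖ := norm_pos_iff.2 hx
    have hball : ∀ t ∈ Set.Icc (0 : ℝ) 1, θ + t • h ∈ Metric.ball θ r := by
      intro t ht
      rw [Metric.mem_ball, dist_eq_norm, add_sub_cancel_left, norm_smul, Real.norm_eq_abs,
        abs_of_nonneg ht.1]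
      exact (mul_le_of_le_one_left (norm_nonneg _) ht.2).trans_lt hh
    have hin : ∀ t : ℝ, (inner ℝ (θ + t • h) x : ℝ) = inner ℝ θ x + t * inner ℝ h x := fun t => by
      rw [inner_add_left, real_inner_smul_left]
    have hs : |(inner ℝ h x : ℝ)| ≤ ‖h‖ * ‖x‖ := abs_real_inner_le_norm h x
    obtain ⟨h1, h2⟩ := hM.taylor_scoreFun (η := inner ℝ θ x) (s := inner ℝ h x)
      (C := w / ‖x‖ ^ 2) (y := y)
      (fun t ht => by rw [← hin]; exact hr trivial _ (hball t ht))
      (fun t ht => by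
        rw [← hin, le_div_iff₀ (by positivity)]
        exact hw _ (hball t ht))
    constructor
    · rw [inner_add_left, ← sub_smul, ← sub_smul, norm_smul, Real.norm_eq_abs]
      calc _ ≤ w / ‖x‖ ^ 2 * |inner ℝ h x| * ‖x‖ :=
            mul_le_mul_of_nonneg_right h1 (norm_nonneg _)
        _ ≤ w / ‖x‖ ^ 2 * (‖h‖ * ‖x‖) * ‖x‖ := by gcongr
        _ = w * ‖h‖ := by field_simp
    · rw [inner_add_left, real_inner_smul_right]
      refine h2.trans ?_
      calc _ ≤ w / ‖x‖ ^ 2 * (‖h‖ * ‖x‖) ^ 2 :=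
            mul_le_mul_of_nonneg_left (sq_le_sq.2 (hs.trans (le_abs_self _)))
              (by positivity)
        _ = w * ‖h‖ ^ 2 := by field_simp

end Taylor

end GLM

end

section

namespace GLM

/-! ### The law of one observation -/

variable {p : ℕ} {M : GLM} (hM : M.IsRegular) {ρ : Measure (Vec p × Bool)}
  [IsProbabilityMeasure ρ] {θ β : Vec p}

section ObsLaw

include hM

lemma IsRegular.measurable_obsDensity (θ β : Vec p) : Measurable fun o : Obs p =>
    M.density (M.canonical (linPred θ β o.1.1 o.1.2)) o.2 :=
  hM.measurable_density.comp
    (((measurable_linPred θ β).comp measurable_fst).prodMk measurable_snd)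

omit [IsProbabilityMeasure ρ] in
lemma IsRegular.lintegral_obsLaw {f : Obs p → ENNReal} (hf : Measurable f) :
    ∫⁻ o, f o ∂M.obsLaw ρ θ β =
      ∫⁻ z, ∫⁻ y, f (z, y) ∂M.response (M.canonical (linPred θ β z.1 z.2)) ∂ρ := by
  have := hM.sigmaFinite
  have hd := (hM.measurable_obsDensity θ β).ennreal_ofReal
  rw [obsLaw, lintegral_withDensity_eq_lintegral_mul _ hd hf,
    lintegral_prod _ (hd.mul hf).aemeasurable]
  refine lintegral_congr fun z => ?_
  exact (lintegral_withDensity_eq_lintegral_mul M.ν (hd.comp measurable_prodMk_left)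
    (hf.comp (measurable_prodMk_left (x := z)))).symm

lemma IsRegular.integral_obsLaw {f : Obs p → ℝ} (hf : Integrable f (M.obsLaw ρ θ β)) :
    ∫ o, f o ∂M.obsLaw ρ θ β =
      ∫ z, ∫ y, f (z, y) ∂M.response (M.canonical (linPred θ β z.1 z.2)) ∂ρ := by
  have := hM.sigmaFinite
  have hd := (hM.measurable_obsDensity θ β).ennreal_ofReal
  have htop : ∀ o : Obs p, ENNReal.ofReal (M.density (M.canonical (linPred θ β o.1.1 o.1.2)) o.2)
      < ⊤ := fun o => ENNReal.ofReal_lt_top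
  rw [obsLaw, integrable_withDensity_iff_integrable_smul' hd (Eventually.of_forall htop)] at hf
  rw [obsLaw, integral_withDensity_eq_integral_toReal_smul hd (Eventually.of_forall htop),
    integral_prod _ hf]
  refine integral_congr_ae (Eventually.of_forall fun z => ?_)
  exact (integral_withDensity_eq_integral_toReal_smul (μ := M.ν)
    (hd.comp (measurable_prodMk_left (x := z)))
    (Eventually.of_forall fun y => htop (z, y)) fun y => f (z, y)).symm

lemma IsRegular.isProbabilityMeasure_obsLaw
    (hr : ∀ᵐ z ∂ρ, linPred θ β z.1 z.2 ∈ M.predictorRange) :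
    IsProbabilityMeasure (M.obsLaw ρ θ β) := by
  constructor
  rw [← setLIntegral_one, Measure.restrict_univ, hM.lintegral_obsLaw measurable_const]
  have h1 : ∀ᵐ z ∂ρ, ∫⁻ _, 1 ∂M.response (M.canonical (linPred θ β z.1 z.2)) = 1 := by
    filter_upwards [hr] with z hz
    have := hM.isProbabilityMeasure_response (canonical_mem hz)
    simp
  rw [lintegral_congr_ae h1]
  simp

omit [IsProbabilityMeasure ρ] in
lemma IsRegular.obsLaw_eq_withDensity (θ β : Vec p) : M.obsLaw ρ θ β =
    (M.obsLaw ρ θ 0).withDensity fun o => ENNReal.ofReal (Real.exp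
      (M.logLik (linPred θ β o.1.1 o.1.2) o.2 - M.logLik (linPred θ 0 o.1.1 o.1.2) o.2)) := by
  have h1 : ∀ β : Vec p, Measurable fun o : Obs p => M.logLik (linPred θ β o.1.1 o.1.2) o.2 :=
    fun β => hM.measurable_logLik.comp
      (((measurable_linPred θ β).comp measurable_fst).prodMk measurable_snd)
  have h2 : Measurable fun o : Obs p => ENNReal.ofReal (Real.exp
      (M.logLik (linPred θ β o.1.1 o.1.2) o.2 - M.logLik (linPred θ 0 o.1.1 o.1.2) o.2)) :=
    ((h1 β).sub (h1 0)).exp.ennreal_ofReal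
  rw [obsLaw, obsLaw, ← withDensity_mul _ (hM.measurable_obsDensity θ 0).ennreal_ofReal h2]
  congr 1
  funext o
  rw [Pi.mul_apply, density_canonical_eq, density_canonical_eq,
    ← ENNReal.ofReal_mul (Real.exp_pos _).le, ← Real.exp_add]
  congr 2
  ring

omit hM [IsProbabilityMeasure ρ] in
lemma ae_obsLaw_of_ae {q : Vec p × Bool → Prop} (h : ∀ᵐ z ∂ρ, q z) :
    ∀ᵐ o ∂M.obsLaw ρ θ β, q o.1 :=
  (withDensity_absolutelyContinuous _ _).ae_le
    (Measure.quasiMeasurePreserving_fst.ae h)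

end ObsLaw

/-! ### Moments of the score -/

section Moments

variable (hr : ∀ᵐ z ∂ρ, linPred θ 0 z.1 z.2 ∈ M.predictorRange) (t : Vec p)
  (hc : Integrable (fun o : Obs p => M.curvature θ o * (inner ℝ t o.1.1) ^ 2) (M.obsLaw ρ θ 0))

include hM hr hc

omit [IsProbabilityMeasure ρ] in
-- Square integrability of the score comes from integrability of its derivative: given the
-- covariates, the second moment of the score is at most the mean modulus of the derivative.
lemma IsRegular.memLp_inner_treatedScore :
    MemLp (fun o => (inner ℝ t (M.treatedScore θ o) : ℝ)) 2 (M.obsLaw ρ θ 0) := by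
  have hms : Measurable fun o => (inner ℝ t (M.treatedScore θ o) : ℝ) :=
    measurable_const.inner (hM.measurable_treatedScore θ)
  have hmc : Measurable fun o : Obs p => M.curvature θ o * (inner ℝ t o.1.1) ^ 2 :=
    (hM.measurable_curvature θ).mul
      ((measurable_const.inner (measurable_fst.comp measurable_fst)).pow_const 2)
  rw [memLp_two_iff_integrable_sq hms.aestronglyMeasurable]
  refine ⟨(hms.pow_const 2).aestronglyMeasurable, ?_⟩
  rw [hasFiniteIntegral_iff_ofReal (Eventually.of_forall fun o => sq_nonneg _)]
  refine lt_of_le_of_lt ?_ hc.2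
  rw [hM.lintegral_obsLaw (hms.pow_const 2).ennreal_ofReal, hM.lintegral_obsLaw hmc.enorm]
  refine lintegral_mono_ae ?_
  filter_upwards [hr] with z hz
  obtain ⟨x, a⟩ := z
  cases a with
  | false => simp [treatedScore]
  | true =>
    simp only [treatedScore, curvature, if_true, linPred_zero] at hz ⊢
    have h1 : ∀ y, ENNReal.ofReal ((inner ℝ t (M.scoreFun (inner ℝ θ x) y • x)) ^ 2) =
        ENNReal.ofReal (M.scoreFun (inner ℝ θ x) y ^ 2) *
          ENNReal.ofReal ((inner ℝ t x) ^ 2) := fun y => by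
      rw [real_inner_smul_right, mul_pow, ENNReal.ofReal_mul (sq_nonneg _)]
    have h2 : ∀ y, ‖M.scoreDeriv (inner ℝ θ x) y * (inner ℝ t x) ^ 2‖ₑ =
        ‖M.scoreDeriv (inner ℝ θ x) y‖ₑ * ENNReal.ofReal ((inner ℝ t x) ^ 2) := fun y => by
      rw [enorm_mul, Real.enorm_of_nonneg (sq_nonneg _)]
    simp_rw [h1, h2]
    rw [lintegral_mul_const' _ _ ENNReal.ofReal_ne_top,
      lintegral_mul_const' _ _ ENNReal.ofReal_ne_top]
    exact mul_le_mul_left (hM.lintegral_scoreFun_sq_le hz) _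

lemma IsRegular.integral_inner_treatedScore :
    ∫ o, (inner ℝ t (M.treatedScore θ o) : ℝ) ∂M.obsLaw ρ θ 0 = 0 := by
  have := hM.isProbabilityMeasure_obsLaw hr
  rw [hM.integral_obsLaw ((hM.memLp_inner_treatedScore hr t hc).integrable (by norm_num))]
  have h1 : ∀ᵐ z ∂ρ, ∫ y, (inner ℝ t (M.treatedScore θ (z, y)) : ℝ)
      ∂M.response (M.canonical (linPred θ 0 z.1 z.2)) = 0 := by
    filter_upwards [hr] with z hz
    obtain ⟨x, a⟩ := z
    cases a with
    | false => simp [treatedScore]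
    | true =>
      simp only [treatedScore, if_true, linPred_zero, real_inner_smul_right] at hz ⊢
      rw [integral_mul_const, hM.integral_scoreFun hz, zero_mul]
  rw [integral_congr_ae h1, integral_zero]

lemma IsRegular.integral_inner_treatedScore_sq :
    ∫ o, (inner ℝ t (M.treatedScore θ o) : ℝ) ^ 2 ∂M.obsLaw ρ θ 0 =
      -∫ o, M.curvature θ o * (inner ℝ t o.1.1) ^ 2 ∂M.obsLaw ρ θ 0 := by
  rw [hM.integral_obsLaw (hM.memLp_inner_treatedScore hr t hc).integrable_sq,
    hM.integral_obsLaw hc, ← integral_neg]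
  refine integral_congr_ae ?_
  filter_upwards [hr] with z hz
  obtain ⟨x, a⟩ := z
  cases a with
  | false => simp [treatedScore, curvature]
  | true =>
    simp only [treatedScore, curvature, if_true, linPred_zero, real_inner_smul_right,
      mul_pow] at hz ⊢
    rw [integral_mul_const, integral_mul_const, hM.integral_scoreFun_sq hz, neg_mul]

end Moments

end GLM

end

section

lemma inner_eq_dotProduct {ι : Type*} [Fintype ι] (x y : EuclideanSpace ℝ ι) :
    inner ℝ x y = x.ofLp ⬝ᵥ y.ofLp := by
  rw [EuclideanSpace.inner_eq_star_dotProduct, star_trivial, dotProduct_comm]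

lemma abs_apply_mul_apply_le {ι : Type*} [Fintype ι] (x : EuclideanSpace ℝ ι) (i j : ι) :
    |x i * x j| ≤ ‖x‖ ^ 2 := by
  rw [abs_mul, pow_two]
  exact mul_le_mul (PiLp.norm_apply_le x i) (PiLp.norm_apply_le x j) (abs_nonneg _)
    (norm_nonneg _)

lemma sq_inner_le {E : Type*} [NormedAddCommGroup E] [InnerProductSpace ℝ E] (t x : E) :
    (inner ℝ t x : ℝ) ^ 2 ≤ ‖t‖ ^ 2 * ‖x‖ ^ 2 := by
  rw [← mul_pow]
  exact sq_le_sq.2 ((abs_real_inner_le_norm t x).trans (le_abs_self _))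

namespace GLM

/-! ### Local uniform bounds -/

variable {p : ℕ} {M : GLM} (hM : M.IsRegular) {ρ : Measure (Vec p × Bool)} {θ₀ : Vec p}

/-- Explicit form of the regularity at `(θ₀, 0)`: on the ball of radius `ε` around `θ₀` the linear
predictors are admissible and the derivative of the score is dominated by `G`. -/
structure LocalBound (M : GLM) (ρ : Measure (Vec p × Bool)) (θ₀ : Vec p) (ε : ℝ)
    (G : Obs p → ℝ) : Prop where
  pos : 0 < ε
  range : ∀ᵐ z ∂ρ, ∀ θ ∈ Metric.ball θ₀ ε, ∀ β ∈ Metric.ball (0 : Vec p) ε,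
    linPred θ β z.1 z.2 ∈ M.predictorRange
  integrable : Integrable G (M.obsLaw ρ θ₀ 0)
  bound : ∀ᵐ o ∂M.obsLaw ρ θ₀ 0, ∀ ϑ ∈ Metric.ball θ₀ ε,
    |M.curvature ϑ o| * ‖o.1.1‖ ^ 2 ≤ G o

lemma LocalBound.mem_range {ε : ℝ} {G : Obs p → ℝ} (hB : M.LocalBound ρ θ₀ ε G) :
    ∀ᵐ o ∂M.obsLaw ρ θ₀ 0, ∀ ϑ ∈ Metric.ball θ₀ ε, inner ℝ ϑ o.1.1 ∈ M.predictorRange := by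
  filter_upwards [ae_obsLaw_of_ae hB.range] with o ho ϑ hϑ
  rw [← linPred_zero ϑ o.1.1 o.1.2]
  exact ho ϑ hϑ 0 (Metric.mem_ball_self hB.pos)

include hM

/-- At β = 0 the derivative of the score is the rank-one operator `scoreFDeriv`, whose norm is
|curvature| ‖x‖². -/
lemma IsRegular.exists_localBound (hreg : M.RegularAt ρ θ₀ 0) :
    ∃ ε G, M.LocalBound ρ θ₀ ε G := by
  obtain ⟨ε, hε, hr, G, hG, hb⟩ := hreg
  refine ⟨ε, G, hε, hr, hG, ?_⟩
  filter_upwards [hb, ae_obsLaw_of_ae hr] with o ho hro ϑ hϑ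
  have h0 := Metric.mem_ball_self (x := (0 : Vec p)) hε
  have h1 : o.1.2 = true → inner ℝ (ϑ + 0) o.1.1 ∈ M.predictorRange := fun _ => by
    rw [add_zero, ← linPred_zero ϑ o.1.1 o.1.2]
    exact hro ϑ hϑ 0 h0
  have h2 := ho ϑ hϑ 0 h0
  rwa [(hM.hasFDerivAt_obsScore_right h1).fderiv, norm_scoreFDeriv, add_zero] at h2

variable {ε : ℝ} {G : Obs p → ℝ} (hB : M.LocalBound ρ θ₀ ε G)

include hB

lemma IsRegular.continuousAt_curvature : ∀ᵐ o ∂M.obsLaw ρ θ₀ 0, ∀ ϑ ∈ Metric.ball θ₀ ε,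
    ContinuousAt (fun ϑ => M.curvature ϑ o) ϑ := by
  filter_upwards [hB.mem_range] with o ho ϑ hϑ
  by_cases h : o.1.2 = true
  · simp only [curvature, h, if_true]
    exact ContinuousAt.comp (f := fun ϑ : Vec p => (inner ℝ ϑ o.1.1 : ℝ))
      (hM.continuousAt_scoreDeriv (ho ϑ hϑ) o.2) (by fun_prop)
  · simp only [curvature, h]
    exact continuousAt_const

/-- The oscillation of the derivative of the score near `θ₀` is dominated by functions whose
integrals tend to zero. -/
lemma IsRegular.exists_envelope {η : ℝ} (hη : 0 < η) : ∃ r > 0, r ≤ ε ∧ ∃ w : Obs p → ℝ,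
    Integrable w (M.obsLaw ρ θ₀ 0) ∧ ∫ o, w o ∂M.obsLaw ρ θ₀ 0 < η ∧
    ∀ᵐ o ∂M.obsLaw ρ θ₀ 0, ∀ ϑ ∈ Metric.ball θ₀ r,
      |M.curvature ϑ o - M.curvature θ₀ o| * ‖o.1.1‖ ^ 2 ≤ w o := by
  classical
  set P := M.obsLaw ρ θ₀ 0
  let D : Vec p → Obs p → ENNReal := fun ϑ o =>
    ENNReal.ofReal (|M.curvature ϑ o - M.curvature θ₀ o| * ‖o.1.1‖ ^ 2)
  let r : ℕ → ℝ := fun m => ε / (m + 1)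
  have hε := hB.pos
  have hr0 : ∀ m, 0 < r m := fun m => by positivity
  have hrε : ∀ m, r m ≤ ε := fun m => div_le_self hε.le (by simp)
  have hrlim : Tendsto r atTop (𝓝 0) := by
    have := tendsto_one_div_add_atTop_nhds_zero_nat.const_mul ε
    simpa [r, div_eq_mul_inv] using this
  -- The supremum runs over a countable dense set to be measurable. Continuity of the curvature
  -- extends the bound to the whole open ball (`hsup`), and domination by `2 * G` with shrinking
  -- radii sends the integrals to zero.
  let E : ℕ → Obs p → ENNReal := fun m o =>
    ⨆ k : ℕ, if TopologicalSpace.denseSeq (Vec p) k ∈ Metric.ball θ₀ (r m) then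
      D (TopologicalSpace.denseSeq (Vec p) k) o else 0
  have hDm : ∀ ϑ, Measurable (D ϑ) := fun ϑ => by
    have h1 := hM.measurable_curvature ϑ
    have h2 := hM.measurable_curvature θ₀
    have h3 : Measurable fun o : Obs p => ‖o.1.1‖ := (measurable_fst.comp measurable_fst).norm
    exact ((h1.sub h2).norm.mul (h3.pow_const 2)).ennreal_ofReal
  have hEm : ∀ m, Measurable (E m) := fun m => Measurable.iSup fun k => by
    by_cases h : TopologicalSpace.denseSeq (Vec p) k ∈ Metric.ball θ₀ (r m)
    · simpa only [h, if_true] using hDm _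
    · simpa only [h, if_false] using measurable_const
  have hD2 : ∀ᵐ o ∂P, ∀ ϑ ∈ Metric.ball θ₀ ε, D ϑ o ≤ ENNReal.ofReal (2 * G o) := by
    filter_upwards [hB.bound] with o ho ϑ hϑ
    refine ENNReal.ofReal_le_ofReal ?_
    calc _ ≤ (|M.curvature ϑ o| + |M.curvature θ₀ o|) * ‖o.1.1‖ ^ 2 :=
          mul_le_mul_of_nonneg_right (abs_sub _ _) (by positivity)
      _ ≤ 2 * G o := by
          have h1 := ho ϑ hϑ
          have h2 := ho θ₀ (Metric.mem_ball_self hε)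
          linarith
  have hE2 : ∀ m, E m ≤ᵐ[P] fun o => ENNReal.ofReal (2 * G o) := fun m => by
    filter_upwards [hD2] with o ho
    refine iSup_le fun k => ?_
    split_ifs with h
    · exact ho _ (Metric.ball_subset_ball (hrε m) h)
    · exact zero_le
  have hfin : ∫⁻ o, ENNReal.ofReal (2 * G o) ∂P ≠ ⊤ :=
    (hB.integrable.const_mul 2).lintegral_lt_top.ne
  have hlim : ∀ᵐ o ∂P, Tendsto (fun m => E m o) atTop (𝓝 0) := by
    filter_upwards [hM.continuousAt_curvature hB] with o ho
    have h1 : Tendsto (fun ϑ => D ϑ o) (𝓝 θ₀) (𝓝 0) := by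
      have h2 := ((ho θ₀ (Metric.mem_ball_self hε)).sub_const (M.curvature θ₀ o)).abs.mul_const
        (‖o.1.1‖ ^ 2)
      have h3 := ENNReal.tendsto_ofReal (h2 : Tendsto _ _ _)
      simpa [D] using h3
    refine ENNReal.tendsto_nhds_zero.2 fun κ hκ => ?_
    obtain ⟨s, hs, hs'⟩ := Metric.eventually_nhds_iff_ball.1
      ((ENNReal.tendsto_nhds_zero.1 h1) κ hκ)
    filter_upwards [hrlim.eventually (gt_mem_nhds hs)] with m hm
    refine iSup_le fun k => ?_
    split_ifs with h
    · exact hs' _ (Metric.ball_subset_ball hm.le h)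
    · exact zero_le
  have hsup : ∀ m, ∀ᵐ o ∂P, ∀ ϑ ∈ Metric.ball θ₀ (r m), D ϑ o ≤ E m o := fun m => by
    filter_upwards [hM.continuousAt_curvature hB] with o ho ϑ hϑ
    by_contra! hlt
    have h2 := ((ho ϑ (Metric.ball_subset_ball (hrε m) hϑ)).sub_const
      (M.curvature θ₀ o)).abs.mul_const (‖o.1.1‖ ^ 2)
    have h3 : ContinuousAt (fun ϑ => D ϑ o) ϑ := ENNReal.tendsto_ofReal (h2 : Tendsto _ _ _)
    have h4 := (h3.eventually (lt_mem_nhds hlt)).and (Metric.isOpen_ball.mem_nhds hϑ)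
    obtain ⟨_, ⟨h5, h6⟩, k, rfl⟩ := mem_closure_iff_nhds.1
      (TopologicalSpace.denseRange_denseSeq (Vec p) ϑ) _ h4
    refine absurd h5 (not_lt.2 ?_)
    refine le_trans ?_ (le_iSup (fun k => if TopologicalSpace.denseSeq (Vec p) k ∈
      Metric.ball θ₀ (r m) then D (TopologicalSpace.denseSeq (Vec p) k) o else 0) k)
    rw [if_pos (Metric.mem_ball.2 h6)]
  have hint := tendsto_lintegral_of_dominated_convergence _ hEm hE2 hfin hlim
  rw [lintegral_zero] at hint
  obtain ⟨m, hm⟩ := (hint.eventually (gt_mem_nhds (ENNReal.ofReal_pos.2 hη))).exists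
  have hEfin : ∀ᵐ o ∂P, E m o < ⊤ := by
    filter_upwards [hE2 m] with o ho using ho.trans_lt ENNReal.ofReal_lt_top
  refine ⟨r m, hr0 m, hrε m, fun o => (E m o).toReal,
    integrable_toReal_of_lintegral_ne_top (hEm m).aemeasurable (hm.trans ENNReal.ofReal_lt_top).ne,
    ?_, ?_⟩
  · rw [integral_toReal (hEm m).aemeasurable hEfin]
    exact (ENNReal.lt_ofReal_iff_toReal_lt (hm.trans ENNReal.ofReal_lt_top).ne).1 hm
  · filter_upwards [hsup m, hEfin] with o ho hfo ϑ hϑ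
    exact (ENNReal.ofReal_le_iff_le_toReal hfo.ne).1 (ho ϑ hϑ)

/-! ### The information matrix -/

lemma IsRegular.integrable_info (i j : Fin (p + 1)) :
    Integrable (fun o : Obs p => M.curvature θ₀ o * (o.1.1 i * o.1.1 j)) (M.obsLaw ρ θ₀ 0) := by
  have h1 : ∀ i, Measurable fun o : Obs p => o.1.1 i := fun i => by fun_prop
  refine hB.integrable.mono' ((hM.measurable_curvature θ₀).mul
    ((h1 i).mul (h1 j))).aestronglyMeasurable ?_
  filter_upwards [hB.bound] with o ho
  rw [norm_mul, Real.norm_eq_abs, Real.norm_eq_abs]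
  exact (mul_le_mul_of_nonneg_left (abs_apply_mul_apply_le _ i j) (abs_nonneg _)).trans
    (ho θ₀ (Metric.mem_ball_self hB.pos))

lemma IsRegular.integrable_curvature_mul_sq (t : Vec p) :
    Integrable (fun o : Obs p => M.curvature θ₀ o * (inner ℝ t o.1.1) ^ 2)
      (M.obsLaw ρ θ₀ 0) := by
  refine (hB.integrable.mul_const (‖t‖ ^ 2)).mono' ((hM.measurable_curvature θ₀).mul
    ((measurable_const.inner (measurable_fst.comp measurable_fst)).pow_const 2)).aestronglyMeasurable
    ?_
  filter_upwards [hB.bound] with o ho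
  rw [norm_mul, Real.norm_eq_abs, Real.norm_eq_abs, abs_of_nonneg (sq_nonneg (inner ℝ t o.1.1))]
  calc _ ≤ |M.curvature θ₀ o| * (‖t‖ ^ 2 * ‖o.1.1‖ ^ 2) :=
        mul_le_mul_of_nonneg_left (sq_inner_le _ _) (abs_nonneg _)
    _ = |M.curvature θ₀ o| * ‖o.1.1‖ ^ 2 * ‖t‖ ^ 2 := by ring
    _ ≤ _ := mul_le_mul_of_nonneg_right (ho θ₀ (Metric.mem_ball_self hB.pos)) (by positivity)

lemma IsRegular.infoBeta_eq : M.infoBeta ρ θ₀ 0 = Matrix.of fun i j =>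
    -∫ o, M.curvature θ₀ o * (o.1.1 i * o.1.1 j) ∂M.obsLaw ρ θ₀ 0 := by
  ext i j
  simp only [infoBeta, Matrix.of_apply]
  rw [← integral_neg]
  refine integral_congr_ae ?_
  filter_upwards [hB.mem_range] with o ho
  have h1 : o.1.2 = true → inner ℝ (θ₀ + 0) o.1.1 ∈ M.predictorRange := fun _ => by
    rw [add_zero]
    exact ho θ₀ (Metric.mem_ball_self hB.pos)
  rw [jacobian, Matrix.of_apply, (hM.hasFDerivAt_obsScore_right h1).fderiv, scoreFDeriv_apply,
    add_zero]

/-- Both are means of the derivative of one function of θ + β. This is why `sandwich`, built from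
the θ-information, is the asymptotic covariance of the score at the estimator. -/
lemma IsRegular.infoTheta_eq : M.infoTheta ρ θ₀ 0 = M.infoBeta ρ θ₀ 0 := by
  rw [hM.infoBeta_eq hB]
  ext i j
  simp only [infoTheta, Matrix.of_apply]
  rw [← integral_neg]
  refine integral_congr_ae ?_
  filter_upwards [hB.mem_range] with o ho
  have h1 : o.1.2 = true → inner ℝ (θ₀ + 0) o.1.1 ∈ M.predictorRange := fun _ => by
    rw [add_zero]
    exact ho θ₀ (Metric.mem_ball_self hB.pos)
  rw [jacobian, Matrix.of_apply, (hM.hasFDerivAt_obsScore_left h1).fderiv, scoreFDeriv_apply,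
    add_zero]

lemma IsRegular.infoBeta_quadratic (t : Vec p) : t.ofLp ⬝ᵥ M.infoBeta ρ θ₀ 0 *ᵥ t.ofLp =
    -∫ o, M.curvature θ₀ o * (inner ℝ t o.1.1) ^ 2 ∂M.obsLaw ρ θ₀ 0 := by
  have h1 : ∀ o : Obs p, M.curvature θ₀ o * (inner ℝ t o.1.1) ^ 2 =
      ∑ i, ∑ j, t i * t j * (M.curvature θ₀ o * (o.1.1 i * o.1.1 j)) := fun o => by
    rw [inner_eq_dotProduct, dotProduct, pow_two, Finset.sum_mul_sum, Finset.mul_sum]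
    refine Finset.sum_congr rfl fun i _ => ?_
    rw [Finset.mul_sum]
    exact Finset.sum_congr rfl fun j _ => by ring
  simp_rw [h1]
  rw [integral_finsetSum _ fun i _ => integrable_finsetSum _ fun j _ =>
    (hM.integrable_info hB i j).const_mul _, hM.infoBeta_eq hB, dotProduct, ← Finset.sum_neg_distrib]
  refine Finset.sum_congr rfl fun i _ => ?_
  rw [integral_finsetSum _ fun j _ => (hM.integrable_info hB i j).const_mul _, mulVec, dotProduct,
    Finset.mul_sum, ← Finset.sum_neg_distrib]
  refine Finset.sum_congr rfl fun j _ => ?_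
  rw [integral_const_mul, Matrix.of_apply]
  ring

omit hM in
lemma LocalBound.linPred_mem :
    ∀ᵐ z ∂ρ, linPred θ₀ 0 z.1 z.2 ∈ M.predictorRange := by
  filter_upwards [hB.range] with z hz
  exact hz θ₀ (Metric.mem_ball_self hB.pos) 0 (Metric.mem_ball_self hB.pos)

variable [IsProbabilityMeasure ρ]

lemma IsRegular.infoBeta_quadratic_eq_integral_sq (t : Vec p) :
    t.ofLp ⬝ᵥ M.infoBeta ρ θ₀ 0 *ᵥ t.ofLp =
      ∫ o, (inner ℝ t (M.treatedScore θ₀ o) : ℝ) ^ 2 ∂M.obsLaw ρ θ₀ 0 := by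
  rw [hM.infoBeta_quadratic hB, hM.integral_inner_treatedScore_sq hB.linPred_mem t
    (hM.integrable_curvature_mul_sq hB t)]

lemma IsRegular.posSemidef_infoBeta : (M.infoBeta ρ θ₀ 0).PosSemidef := by
  refine .of_dotProduct_mulVec_nonneg ?_ fun t => ?_
  · ext i j
    rw [hM.infoBeta_eq hB]
    simp [mul_comm]
  · have := hM.infoBeta_quadratic_eq_integral_sq hB (WithLp.toLp 2 t)
    rw [star_trivial]
    exact this ▸ integral_nonneg fun o => sq_nonneg _

lemma IsRegular.posDef_infoBeta (hdet : IsUnit (M.infoBeta ρ θ₀ 0).det) :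
    (M.infoBeta ρ θ₀ 0).PosDef :=
  (hM.posSemidef_infoBeta hB).posDef_iff_det_ne_zero.2 hdet.ne_zero

omit [IsProbabilityMeasure ρ] in
-- Without treated subjects the information would be zero, hence not invertible. The conditional
-- central limit theorem divides by this probability.
lemma IsRegular.measure_treated_ne_zero (hdet : IsUnit (M.infoBeta ρ θ₀ 0).det) :
    M.obsLaw ρ θ₀ 0 {o | o.1.2 = true} ≠ 0 := by
  intro h0
  have h1 : ∀ᵐ o ∂M.obsLaw ρ θ₀ 0, ¬ o.1.2 = true := by
    rw [ae_iff]
    simpa using h0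
  have h2 : M.infoBeta ρ θ₀ 0 = 0 := by
    rw [hM.infoBeta_eq hB]
    ext i j
    have h3 : (fun o : Obs p => M.curvature θ₀ o * (o.1.1 i * o.1.1 j)) =ᵐ[M.obsLaw ρ θ₀ 0]
        fun _ => 0 := by
      filter_upwards [h1] with o ho
      rw [curvature, if_neg ho, zero_mul]
    simp [integral_congr_ae h3]
  rw [h2, det_zero] at hdet
  exact not_isUnit_zero hdet

end GLM

end

section

namespace GLM

/-! ### Expansions over the sample -/

variable {p : ℕ} {M : GLM}

lemma sampleInfo_mulVec {n : ℕ} (d : Fin n → Obs p) (ϑ t : Vec p) :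
    WithLp.toLp 2 (M.sampleInfo d ϑ *ᵥ t.ofLp) =
      -((n : ℝ)⁻¹ • ∑ k, (M.curvature ϑ (d k) * inner ℝ t (d k).1.1) • (d k).1.1) := by
  ext i
  simp only [mulVec, dotProduct, sampleInfo, Matrix.of_apply, PiLp.neg_apply, PiLp.smul_apply,
    WithLp.ofLp_sum, Finset.sum_apply, inner_eq_dotProduct, smul_eq_mul]
  simp_rw [neg_mul, Finset.sum_neg_distrib, mul_assoc, ← Finset.mul_sum, Finset.sum_mul,
    Finset.mul_sum]
  rw [Finset.sum_comm]
  simp only [neg_inj]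
  refine Finset.sum_congr rfl fun k _ => Finset.sum_congr rfl fun j _ => ?_
  ring

lemma sampleInfo_quadratic {n : ℕ} (d : Fin n → Obs p) (ϑ t : Vec p) :
    t.ofLp ⬝ᵥ M.sampleInfo d ϑ *ᵥ t.ofLp =
      -((n : ℝ)⁻¹ * ∑ k, M.curvature ϑ (d k) * (inner ℝ t (d k).1.1) ^ 2) := by
  have h1 : t.ofLp ⬝ᵥ M.sampleInfo d ϑ *ᵥ t.ofLp =
      inner ℝ t (WithLp.toLp 2 (M.sampleInfo d ϑ *ᵥ t.ofLp)) :=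
    (inner_eq_dotProduct t (WithLp.toLp 2 (M.sampleInfo d ϑ *ᵥ t.ofLp))).symm
  rw [h1, sampleInfo_mulVec, inner_neg_right, real_inner_smul_right, inner_sum]
  congr 2
  refine Finset.sum_congr rfl fun k _ => ?_
  rw [real_inner_smul_right]
  ring

variable (hM : M.IsRegular) {ρ : Measure (Vec p × Bool)} [IsProbabilityMeasure ρ] {θ₀ : Vec p}
  {ε : ℝ} {G : Obs p → ℝ} (hB : M.LocalBound ρ θ₀ ε G)

include hM hB

lemma IsRegular.isProbabilityMeasure_obsLaw_zero : IsProbabilityMeasure (M.obsLaw ρ θ₀ 0) :=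
  hM.isProbabilityMeasure_obsLaw hB.linPred_mem

lemma IsRegular.eventually_forall_mem_range :
    ∀ᶠ x : Σ n, Fin n → Obs p in whp fun n => M.sampleLaw ρ θ₀ 0 n, ∀ i, ∀ ϑ ∈ Metric.ball θ₀ ε,
      inner ℝ ϑ (x.2 i).1.1 ∈ M.predictorRange := by
  have := hM.isProbabilityMeasure_obsLaw_zero hB
  exact eventually_whp_of_ae (Eventually.of_forall fun n => ae_pi_forall hB.mem_range)

/-- The law of large numbers makes the average of the envelope small. The bound holds for all `ϑ` in
the ball at once, so a random `ϑ` may be inserted. -/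
lemma IsRegular.eventually_envelope {η : ℝ} (hη : 0 < η) : ∃ r > 0, r ≤ ε ∧
    ∀ᶠ x : Σ n, Fin n → Obs p in whp fun n => M.sampleLaw ρ θ₀ 0 n, ∃ w : Fin x.1 → ℝ,
      (x.1 : ℝ)⁻¹ * ∑ i, w i ≤ η ∧ ∀ i, ∀ ϑ ∈ Metric.ball θ₀ r,
        |M.curvature ϑ (x.2 i) - M.curvature θ₀ (x.2 i)| * ‖(x.2 i).1.1‖ ^ 2 ≤ w i := by
  have := hM.isProbabilityMeasure_obsLaw_zero hB
  obtain ⟨r, hr, hrε, w, hw, hwη, hwb⟩ := hM.exists_envelope hB hη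
  refine ⟨r, hr, hrε, ?_⟩
  have h1 : ∀ᶠ x : Σ n, Fin n → Obs p in whp fun n => M.sampleLaw ρ θ₀ 0 n,
      ∀ i, ∀ ϑ ∈ Metric.ball θ₀ r,
        |M.curvature ϑ (x.2 i) - M.curvature θ₀ (x.2 i)| * ‖(x.2 i).1.1‖ ^ 2 ≤ w (x.2 i) :=
    eventually_whp_of_ae (Eventually.of_forall fun n => ae_pi_forall hwb)
  have h2 : ∀ᶠ x : Σ n, Fin n → Obs p in whp fun n => M.sampleLaw ρ θ₀ 0 n,
      (x.1 : ℝ)⁻¹ * ∑ i, w (x.2 i) < η := (tendsto_average_whp hw).eventually (gt_mem_nhds hwη)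
  filter_upwards [h1, h2] with x hx1 hx2
  exact ⟨fun i => w (x.2 i), hx2.le, hx1⟩

/-- The law of large numbers handles `θ₀`, and the envelope handles the passage to the random point
`T x`; `T` need not be measurable. -/
lemma IsRegular.tendsto_sampleInfo {T : (Σ n, Fin n → Obs p) → Vec p}
    (hT : Tendsto T (whp fun n => M.sampleLaw ρ θ₀ 0 n) (𝓝 θ₀)) :
    Tendsto (fun x => M.sampleInfo x.2 (T x)) (whp fun n => M.sampleLaw ρ θ₀ 0 n)
      (𝓝 (M.infoBeta ρ θ₀ 0)) := by
  have := hM.isProbabilityMeasure_obsLaw_zero hB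
  refine tendsto_pi_nhds.2 fun i => tendsto_pi_nhds.2 fun j => ?_
  have h0 : Tendsto (fun x => M.sampleInfo x.2 θ₀ i j) (whp fun n => M.sampleLaw ρ θ₀ 0 n)
      (𝓝 (M.infoBeta ρ θ₀ 0 i j)) := by
    rw [hM.infoBeta_eq hB]
    exact (tendsto_average_whp (hM.integrable_info hB i j)).neg
  have h1 : Tendsto (fun x => M.sampleInfo x.2 (T x) i j - M.sampleInfo x.2 θ₀ i j)
      (whp fun n => M.sampleLaw ρ θ₀ 0 n) (𝓝 0) := by
    rw [Metric.tendsto_nhds]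
    intro η hη
    obtain ⟨r, hr, -, h2⟩ := hM.eventually_envelope hB (half_pos hη)
    filter_upwards [h2, hT.eventually (Metric.ball_mem_nhds θ₀ hr)] with x ⟨w, hw1, hw2⟩ hx
    rw [Real.dist_eq, sub_zero]
    refine lt_of_le_of_lt ?_ (half_lt_self hη)
    refine le_trans ?_ hw1
    simp only [sampleInfo, Matrix.of_apply]
    rw [neg_sub_neg, ← mul_sub, ← Finset.sum_sub_distrib, abs_mul,
      abs_of_nonneg (by positivity : (0 : ℝ) ≤ (x.1 : ℝ)⁻¹)]
    refine mul_le_mul_of_nonneg_left ((Finset.abs_sum_le_sum_abs _ _).trans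
      (Finset.sum_le_sum fun k _ => ?_)) (by positivity)
    rw [← sub_mul, abs_mul, abs_sub_comm]
    exact (mul_le_mul_of_nonneg_left (abs_apply_mul_apply_le _ i j) (abs_nonneg _)).trans
      (hw2 k _ hx)
  simpa using h1.add h0

/-- Expansion of the normalized score at a consistent estimator. -/
lemma IsRegular.exists_score_expansion {T : (Σ n, Fin n → Obs p) → Vec p}
    (hT : Tendsto T (whp fun n => M.sampleLaw ρ θ₀ 0 n) (𝓝 θ₀)) :
    ∃ e : (Σ n, Fin n → Obs p) → Vec p,
      Tendsto e (whp fun n => M.sampleLaw ρ θ₀ 0 n) (𝓝 0) ∧ ∀ x,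
      (Real.sqrt x.1)⁻¹ • ∑ i, M.treatedScore (T x) (x.2 i) =
        (Real.sqrt x.1)⁻¹ • ∑ i, M.treatedScore θ₀ (x.2 i) -
        WithLp.toLp 2 (M.sampleInfo x.2 θ₀ *ᵥ (Real.sqrt x.1 • (T x - θ₀)).ofLp) +
        ‖Real.sqrt x.1 • (T x - θ₀)‖ • e x := by
  let R : (Σ n, Fin n → Obs p) → Vec p := fun x =>
    (Real.sqrt x.1)⁻¹ • ∑ i, M.treatedScore (T x) (x.2 i) -
      ((Real.sqrt x.1)⁻¹ • ∑ i, M.treatedScore θ₀ (x.2 i) -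
        WithLp.toLp 2 (M.sampleInfo x.2 θ₀ *ᵥ (Real.sqrt x.1 • (T x - θ₀)).ofLp))
  -- The remainder is written as a norm times `e`, so that the statistic becomes a continuous
  -- function of the error and of convergent quantities. If the norm is zero, the inverse is zero by
  -- convention and the expansion is exact.
  refine ⟨fun x => ‖Real.sqrt x.1 • (T x - θ₀)‖⁻¹ • R x, ?_, fun x => ?_⟩
  · rw [Metric.tendsto_nhds]
    intro η hη
    obtain ⟨r, hr, hrε, h2⟩ := hM.eventually_envelope hB (half_pos hη)
    filter_upwards [h2, hT.eventually (Metric.ball_mem_nhds θ₀ hr),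
      hM.eventually_forall_mem_range hB] with x ⟨w, hw1, hw2⟩ hx hxr
    rw [dist_zero_right]
    refine lt_of_le_of_lt ?_ (half_lt_self hη)
    have hR : ‖R x‖ ≤ η / 2 * ‖Real.sqrt x.1 • (T x - θ₀)‖ := by
      have hs : (Real.sqrt x.1)⁻¹ = (x.1 : ℝ)⁻¹ * Real.sqrt x.1 := by
        rcases eq_or_ne (x.1 : ℝ) 0 with h | h
        · simp [h]
        · have := Real.sqrt_ne_zero'.2 ((Nat.cast_nonneg x.1).lt_of_ne h.symm)
          field_simp
          rw [Real.sq_sqrt (Nat.cast_nonneg x.1)]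
      have hRx : R x = (Real.sqrt x.1)⁻¹ • ∑ i, (M.treatedScore (T x) (x.2 i) -
          M.treatedScore θ₀ (x.2 i) -
          (M.curvature θ₀ (x.2 i) * inner ℝ (T x - θ₀) (x.2 i).1.1) • (x.2 i).1.1) := by
        simp only [R]
        have : ∑ k, (M.curvature θ₀ (x.2 k) * inner ℝ (Real.sqrt x.1 • (T x - θ₀)) (x.2 k).1.1) •
            (x.2 k).1.1 = Real.sqrt x.1 • ∑ k, (M.curvature θ₀ (x.2 k) *
              inner ℝ (T x - θ₀) (x.2 k).1.1) • (x.2 k).1.1 := by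
          rw [Finset.smul_sum]
          refine Finset.sum_congr rfl fun k _ => ?_
          rw [real_inner_smul_left, smul_smul]
          congr 1
          ring
        rw [sampleInfo_mulVec, this, Finset.sum_sub_distrib, Finset.sum_sub_distrib, smul_sub,
          smul_sub, smul_smul, ← hs]
        abel
      rw [hRx, norm_smul, norm_smul, hs]
      have hTx : T x = θ₀ + (T x - θ₀) := by abel
      have hsum : ‖∑ i, (M.treatedScore (T x) (x.2 i) - M.treatedScore θ₀ (x.2 i) -
          (M.curvature θ₀ (x.2 i) * inner ℝ (T x - θ₀) (x.2 i).1.1) • (x.2 i).1.1)‖ ≤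
          (∑ i, w i) * ‖T x - θ₀‖ := by
        rw [Finset.sum_mul]
        refine (norm_sum_le _ _).trans (Finset.sum_le_sum fun i _ => ?_)
        have := (hM.taylor_obs (θ := θ₀) (h := T x - θ₀) (o := x.2 i) (w := w i) (r := r)
          (by rwa [← dist_eq_norm]) (fun _ ϑ hϑ => hxr i ϑ (Metric.ball_subset_ball hrε hϑ))
          (hw2 i)).1
        rwa [← hTx] at this
      rw [norm_mul, Real.norm_of_nonneg (by positivity : (0 : ℝ) ≤ (x.1 : ℝ)⁻¹)]
      calc _ ≤ (x.1 : ℝ)⁻¹ * ‖Real.sqrt x.1‖ * ((∑ i, w i) * ‖T x - θ₀‖) := by gcongr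
        _ = ((x.1 : ℝ)⁻¹ * ∑ i, w i) * (‖Real.sqrt x.1‖ * ‖T x - θ₀‖) := by ring
        _ ≤ _ := by gcongr
    rw [norm_smul, norm_inv, norm_norm]
    exact inv_mul_le_of_le_mul₀ (norm_nonneg _) (half_pos hη).le (by rwa [mul_comm])
  · rcases eq_or_ne ‖Real.sqrt x.1 • (T x - θ₀)‖ 0 with h | h
    · rw [h, zero_smul, add_zero]
      rcases smul_eq_zero.1 (norm_eq_zero.1 h) with h' | h'
      · rw [h']
        have : (x.1 : ℝ) = 0 := by simpa using h'
        simp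
      · rw [sub_eq_zero.1 h']
        simp
    · rw [smul_smul, mul_inv_cancel₀ h, one_smul]
      simp only [R]
      abel

/-- The quadratic approximation of the log-likelihood ratio of local alternatives. -/
lemma IsRegular.tendsto_logLik_expansion (δ : Vec p) {β : ℕ → Vec p}
    (hβ : ∀ᶠ n in atTop, β n = (Real.sqrt n)⁻¹ • δ) :
    Tendsto (fun x : Σ n, Fin n → Obs p =>
      ∑ i, (M.logLik (linPred θ₀ (β x.1) (x.2 i).1.1 (x.2 i).1.2) (x.2 i).2 -
        M.logLik (linPred θ₀ 0 (x.2 i).1.1 (x.2 i).1.2) (x.2 i).2) -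
      (inner ℝ δ ((Real.sqrt x.1)⁻¹ • ∑ i, M.treatedScore θ₀ (x.2 i)) -
        δ.ofLp ⬝ᵥ M.infoBeta ρ θ₀ 0 *ᵥ δ.ofLp / 2))
      (whp fun n => M.sampleLaw ρ θ₀ 0 n) (𝓝 0) := by
  have hA : Tendsto (fun x : Σ n, Fin n → Obs p => δ.ofLp ⬝ᵥ M.sampleInfo x.2 θ₀ *ᵥ δ.ofLp / 2)
      (whp fun n => M.sampleLaw ρ θ₀ 0 n) (𝓝 (δ.ofLp ⬝ᵥ M.infoBeta ρ θ₀ 0 *ᵥ δ.ofLp / 2)) := by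
    have h1 : Continuous fun A : Mat p => δ.ofLp ⬝ᵥ A *ᵥ δ.ofLp / 2 := by fun_prop
    exact (h1.tendsto _).comp (hM.tendsto_sampleInfo hB tendsto_const_nhds)
  -- The second-order Taylor term is exactly the sample information; it is replaced by its limit
  -- only at the end.
  have hmain : Tendsto (fun x : Σ n, Fin n → Obs p =>
      ∑ i, (M.logLik (linPred θ₀ (β x.1) (x.2 i).1.1 (x.2 i).1.2) (x.2 i).2 -
        M.logLik (linPred θ₀ 0 (x.2 i).1.1 (x.2 i).1.2) (x.2 i).2) -
      (inner ℝ δ ((Real.sqrt x.1)⁻¹ • ∑ i, M.treatedScore θ₀ (x.2 i)) -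
        δ.ofLp ⬝ᵥ M.sampleInfo x.2 θ₀ *ᵥ δ.ofLp / 2))
      (whp fun n => M.sampleLaw ρ θ₀ 0 n) (𝓝 0) := by
    rw [Metric.tendsto_nhds]
    intro κ hκ
    -- The remainder will be at most this constant times ‖δ‖²; the added one keeps the choice valid
    -- for `δ = 0`.
    have hη : 0 < κ / (2 * (‖δ‖ ^ 2 + 1)) := by positivity
    obtain ⟨r, hr, hrε, h2⟩ := hM.eventually_envelope hB hη
    have hβ0 : ∀ᶠ n : ℕ in atTop, ‖(Real.sqrt n)⁻¹ • δ‖ < r := by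
      have h3 : Tendsto (fun n : ℕ => (Real.sqrt n)⁻¹ • δ) atTop (𝓝 ((0 : ℝ) • δ)) :=
        (tendsto_inv_atTop_zero.comp (Real.tendsto_sqrt_atTop.comp
          tendsto_natCast_atTop_atTop)).smul_const δ
      rw [zero_smul] at h3
      simpa using h3.eventually (Metric.ball_mem_nhds 0 hr)
    filter_upwards [h2, hM.eventually_forall_mem_range hB,
      (tendsto_fst_whp _).eventually (hβ.and (hβ0.and (eventually_gt_atTop 0)))]
      with x ⟨w, hw1, hw2⟩ hxr ⟨hβx, hβr, hn⟩
    rw [dist_zero_right, Real.norm_eq_abs, hβx]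
    set h := (Real.sqrt x.1)⁻¹ • δ
    have hn' : (0 : ℝ) < x.1 := Nat.cast_pos.2 hn
    have hsq : (Real.sqrt x.1)⁻¹ ^ 2 = (x.1 : ℝ)⁻¹ := by
      rw [inv_pow, Real.sq_sqrt hn'.le]
    have hT : ∀ i, _ := fun i => (hM.taylor_obs (θ := θ₀) (h := h) (o := x.2 i) (w := w i) (r := r)
      hβr (fun _ ϑ hϑ => hxr i ϑ (Metric.ball_subset_ball hrε hϑ)) (hw2 i)).2
    have e1 : (inner ℝ δ ((Real.sqrt x.1)⁻¹ • ∑ i, M.treatedScore θ₀ (x.2 i)) : ℝ) =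
        ∑ i, inner ℝ h (M.treatedScore θ₀ (x.2 i)) := by
      rw [real_inner_smul_right, inner_sum, Finset.mul_sum]
      exact Finset.sum_congr rfl fun i _ => by rw [real_inner_smul_left]
    have e2 : δ.ofLp ⬝ᵥ M.sampleInfo x.2 θ₀ *ᵥ δ.ofLp / 2 =
        -∑ i, M.curvature θ₀ (x.2 i) * (inner ℝ h (x.2 i).1.1) ^ 2 / 2 := by
      rw [sampleInfo_quadratic, ← hsq, Finset.mul_sum, neg_div, Finset.sum_div]
      congr 1
      exact Finset.sum_congr rfl fun i _ => by rw [real_inner_smul_left]; ring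
    rw [e1, e2, sub_neg_eq_add, ← Finset.sum_add_distrib, ← Finset.sum_sub_distrib]
    calc _ ≤ ∑ i, w i * ‖h‖ ^ 2 := by
          refine (Finset.abs_sum_le_sum_abs _ _).trans (Finset.sum_le_sum fun i _ => ?_)
          rw [← sub_sub]
          exact hT i
      _ = ((x.1 : ℝ)⁻¹ * ∑ i, w i) * ‖δ‖ ^ 2 := by
          rw [← Finset.sum_mul, norm_smul, mul_pow, Real.norm_eq_abs, sq_abs, hsq]
          ring
      _ ≤ κ / (2 * (‖δ‖ ^ 2 + 1)) * ‖δ‖ ^ 2 := by gcongr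
      _ < κ := by
          rw [div_mul_eq_mul_div, div_lt_iff₀ (by positivity)]
          nlinarith [sq_nonneg ‖δ‖]
  have := hmain.add ((tendsto_const_nhds (x := δ.ofLp ⬝ᵥ M.infoBeta ρ θ₀ 0 *ᵥ δ.ofLp / 2)).sub hA)
  rw [sub_self, add_zero] at this
  refine this.congr fun x => ?_
  ring

end GLM

end

section

/-! ### The statistic as a quadratic form -/

variable {p : ℕ}

lemma normalDensity_eq (m x : Vec p) (C : Mat p) : normalDensity m C x = normalDensity 0 C 0 *
    Real.exp (-((x - m).ofLp ⬝ᵥ (C⁻¹ *ᵥ (x - m).ofLp)) / 2) := by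
  simp [normalDensity]

lemma continuous_normalDensity (x : Vec p) (C : Mat p) :
    Continuous fun m => normalDensity m C x := by
  unfold normalDensity
  fun_prop

/-- The logarithm of the ratio between the largest normal density and the density at zero. -/
lemma two_mul_log_sSup_normalDensity {C : Mat p} (hC : 0 < C.det)
    (hq : ∀ v : Vec p, 0 ≤ v.ofLp ⬝ᵥ C⁻¹ *ᵥ v.ofLp) (x : Vec p) :
    2 * Real.log (sSup ((fun m => normalDensity m C x) '' {0}ᶜ) / normalDensity 0 C x) =
      x.ofLp ⬝ᵥ C⁻¹ *ᵥ x.ofLp := by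
  have hc : 0 < normalDensity (0 : Vec p) C 0 := by
    simp only [normalDensity]
    positivity
  have hlub : IsLUB ((fun m => normalDensity m C x) '' {0}ᶜ) (normalDensity 0 C 0) := by
    constructor
    · rintro _ ⟨m, -, rfl⟩
      simp only []
      rw [normalDensity_eq]
      refine mul_le_of_le_one_right hc.le (Real.exp_le_one_iff.2 ?_)
      linarith [hq (x - m)]
    -- The maximizer `m = x` is missing from the index set when `x = 0`; density of `{0}ᶜ` and
    -- continuity in `m` recover the peak.
    · intro b hb
      have h1 : IsClosed {m : Vec p | normalDensity m C x ≤ b} :=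
        isClosed_le (continuous_normalDensity x C) continuous_const
      have h2 : ({0}ᶜ : Set (Vec p)) ⊆ {m | normalDensity m C x ≤ b} := fun m hm =>
        hb ⟨m, hm, rfl⟩
      have h3 := (closure_minimal h2 h1) (dense_compl_singleton (0 : Vec p) x)
      have h4 : normalDensity x C x = normalDensity 0 C 0 := by
        rw [normalDensity_eq]
        simp
      exact h4 ▸ h3
  rw [hlub.csSup_eq ⟨_, EuclideanSpace.single 0 1, by simp, rfl⟩, normalDensity_eq 0 x, sub_zero,
    div_mul_cancel_left₀ hc.ne', ← Real.exp_neg, Real.log_exp]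
  ring

/-- An invertible matrix and the scaling by √n permute the nonzero vectors, so the constrained
supremum runs over all nonzero means. -/
lemma image_alternatives {n : ℕ} (hn : 0 < n) {A : Mat p} (hA : IsUnit A.det) :
    (fun β : Vec p => WithLp.toLp 2 (A *ᵥ (β - 0).ofLp)) '' alternatives n (0 : Vec p) =
      {0}ᶜ := by
  have hs : Real.sqrt n ≠ 0 := by positivity
  ext m
  constructor
  · rintro ⟨_, ⟨δ, hδ, rfl⟩, rfl⟩ h0
    have h1 : A *ᵥ ((Real.sqrt n)⁻¹ • δ).ofLp = 0 := by
      simpa using h0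
    have h2 : ((Real.sqrt n)⁻¹ • δ).ofLp = 0 := by
      have := congrArg (A⁻¹ *ᵥ ·) h1
      simpa [mulVec_mulVec, nonsing_inv_mul A hA] using this
    have h3 : (Real.sqrt n)⁻¹ • δ = 0 := by
      ext i
      exact congrFun h2 i
    rcases smul_eq_zero.1 h3 with h | h
    · exact hs (inv_eq_zero.1 h)
    · exact hδ h
  · intro hm
    refine ⟨0 + (Real.sqrt n)⁻¹ • (Real.sqrt n • WithLp.toLp 2 (A⁻¹ *ᵥ m.ofLp)),
      ⟨_, ?_, rfl⟩, ?_⟩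
    · intro h0
      rcases smul_eq_zero.1 h0 with h | h
      · exact hs h
      · apply hm
        have h1 : A⁻¹ *ᵥ m.ofLp = 0 := by simpa using h
        have h2 : m.ofLp = 0 := by
          have := congrArg (A *ᵥ ·) h1
          simpa [mulVec_mulVec, mul_nonsing_inv A hA] using this
        ext i
        exact congrFun h2 i
    · simp only []
      rw [smul_smul, inv_mul_cancel₀ hs, one_smul, zero_add, sub_zero]
      simp [mulVec_mulVec, mul_nonsing_inv A hA]

/-- If `V` has positive quadratic form, so has its inverse. -/
lemma inv_quadratic_nonneg {V : Mat p} (hV : IsUnit V.det)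
    (hq : ∀ v : Vec p, 0 ≤ v.ofLp ⬝ᵥ V *ᵥ v.ofLp) (v : Vec p) :
    0 ≤ v.ofLp ⬝ᵥ V⁻¹ *ᵥ v.ofLp := by
  have h1 := hq (WithLp.toLp 2 (V⁻¹ *ᵥ v.ofLp))
  have h2 : V *ᵥ (V⁻¹ *ᵥ v.ofLp) = v.ofLp := by
    rw [mulVec_mulVec, mul_nonsing_inv V hV, one_mulVec]
  simp only at h1
  rwa [h2, dotProduct_comm] at h1

/-- The conditions on the estimated information `A` and covariance matrix `S` under which the
statistic is a quadratic form in the score. -/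
def Admissible (A S : Mat p) : Prop :=
  IsUnit A.det ∧ 0 < (sandwich A S).det ∧
    ∀ v : Vec p, 0 ≤ v.ofLp ⬝ᵥ sandwich A S *ᵥ v.ofLp

lemma continuous_sandwich : Continuous fun q : Mat p × Mat p => sandwich q.1 q.2 := by
  unfold sandwich
  fun_prop

/-- The estimated covariance matrix need not be symmetric, so openness is proved for the determinant
and the quadratic form instead of for `PosDef`. Compactness of the unit sphere makes positivity
uniform in `v`. -/
lemma eventually_admissible {J S : Mat p} (hJ : J.PosDef) (hV : (sandwich J S).PosDef) :
    ∀ᶠ q in 𝓝 (J, S), Admissible q.1 q.2 := by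
  have h1 : ∀ᶠ q : Mat p × Mat p in 𝓝 (J, S), 0 < q.1.det := by
    have : Continuous fun q : Mat p × Mat p => q.1.det := continuous_fst.matrix_det
    exact this.continuousAt.eventually (lt_mem_nhds hJ.det_pos)
  have h2 : ∀ᶠ q : Mat p × Mat p in 𝓝 (J, S), 0 < (sandwich q.1 q.2).det :=
    continuous_sandwich.matrix_det.continuousAt.eventually (lt_mem_nhds hV.det_pos)
  have h3 : ∀ᶠ q : Mat p × Mat p in 𝓝 (J, S), ∀ v ∈ Metric.sphere (0 : Vec p) 1,
      0 < v.ofLp ⬝ᵥ sandwich q.1 q.2 *ᵥ v.ofLp := by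
    refine (isCompact_sphere (0 : Vec p) 1).eventually_forall_of_forall_eventually fun v hv => ?_
    have hc : Continuous fun z : (Mat p × Mat p) × Vec p =>
        z.2.ofLp ⬝ᵥ sandwich z.1.1 z.1.2 *ᵥ z.2.ofLp := by
      have := continuous_sandwich.comp (continuous_fst (X := Mat p × Mat p) (Y := Vec p))
      have h2 : Continuous fun z : (Mat p × Mat p) × Vec p => z.2.ofLp := by fun_prop
      exact h2.dotProduct (this.matrix_mulVec h2)
    refine hc.continuousAt.eventually (lt_mem_nhds ?_)
    have hv0 : v.ofLp ≠ 0 := fun h => by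
      have : v = 0 := by
        ext i
        exact congrFun h i
      simp [this] at hv
    simpa using hV.dotProduct_mulVec_pos hv0
  filter_upwards [h1, h2, h3] with q hq1 hq2 hq3
  refine ⟨hq1.ne'.isUnit, hq2, fun v => ?_⟩
  rcases eq_or_ne v 0 with rfl | hv
  · simp
  have h4 := hq3 (‖v‖⁻¹ • v) (by simp [norm_smul, norm_ne_zero_iff.2 hv])
  have h5 : (‖v‖⁻¹ • v).ofLp ⬝ᵥ sandwich q.1 q.2 *ᵥ (‖v‖⁻¹ • v).ofLp =
      (‖v‖⁻¹ * ‖v‖⁻¹) * (v.ofLp ⬝ᵥ sandwich q.1 q.2 *ᵥ v.ofLp) := by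
    simp only [WithLp.ofLp_smul, mulVec_smul, dotProduct_smul, smul_dotProduct, smul_eq_mul,
      mul_assoc]
  rw [h5] at h4
  exact (pos_of_mul_pos_right h4 (by positivity)).le

/-- The statistic is a quadratic form in the normalized score. -/
lemma GLM.llr_eq {M : GLM} {n : ℕ} (hn : 0 < n) {d : Fin n → Obs p} {T : Vec p}
    {Shat : Vec p → Mat p} {A : Mat p} (hβ : M.infoBetaBar d T 0 = A)
    (hθ : M.infoThetaBar d T 0 = A) (hA : Admissible A (Shat T)) :
    M.llr 0 T Shat d = ((Real.sqrt n)⁻¹ • M.score d T 0).ofLp ⬝ᵥ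
      (sandwich A (Shat T))⁻¹ *ᵥ ((Real.sqrt n)⁻¹ • M.score d T 0).ofLp := by
  obtain ⟨hA1, hV, hq⟩ := hA
  set V := sandwich A (Shat T) with hVdef
  have hn' : (0 : ℝ) < n := Nat.cast_pos.2 hn
  have hCinv : ((n : ℝ)⁻¹ • V)⁻¹ = (n : ℝ) • V⁻¹ := by
    refine inv_eq_right_inv ?_
    rw [smul_mul_smul_comm, inv_mul_cancel₀ hn'.ne', one_smul, mul_nonsing_inv V hV.ne'.isUnit]
  have hC : 0 < ((n : ℝ)⁻¹ • V).det := by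
    rw [det_smul]
    positivity
  have hCq : ∀ v : Vec p, 0 ≤ v.ofLp ⬝ᵥ ((n : ℝ)⁻¹ • V)⁻¹ *ᵥ v.ofLp := fun v => by
    rw [hCinv, smul_mulVec, dotProduct_smul]
    exact mul_nonneg hn'.le (inv_quadratic_nonneg hV.ne'.isUnit hq v)
  have himg : (fun β => normalDensity (WithLp.toLp 2 (A *ᵥ (β - 0 : Vec p).ofLp)) ((n : ℝ)⁻¹ • V)
      ((n : ℝ)⁻¹ • M.score d T 0)) '' alternatives n (0 : Vec p) =
      (fun m => normalDensity m ((n : ℝ)⁻¹ • V) ((n : ℝ)⁻¹ • M.score d T 0)) '' {0}ᶜ := by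
    rw [← image_alternatives hn hA1, Set.image_image]
  simp only [GLM.llr]
  rw [hβ, hθ, himg, two_mul_log_sSup_normalDensity hC hCq, hCinv]
  -- The covariance `V / n` contributes a factor `n` on inversion, which turns the two factors `1/n`
  -- of the averaged score into `1/√n` each.
  have hsq : (Real.sqrt n)⁻¹ * (Real.sqrt n)⁻¹ = (n : ℝ)⁻¹ := by
    rw [← mul_inv, Real.mul_self_sqrt hn'.le]
  simp only [WithLp.ofLp_smul, mulVec_smul, smul_mulVec, dotProduct_smul, smul_dotProduct,
    smul_eq_mul]
  rw [← mul_assoc, ← mul_assoc, ← mul_assoc, hsq]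
  field_simp

/-! ### Extension by zero -/

open Classical in
/-- The matrix that extends a vector of active coordinates by zero. -/
def padding (θ₀ : Vec p) : Matrix (Fin (p + 1)) (Active θ₀) ℝ :=
  Matrix.of fun i j => if i = j.1 then 1 else 0

open Classical in
lemma padding_mulVec (θ₀ : Vec p) (w : Active θ₀ → ℝ) (i : Fin (p + 1)) :
    (padding θ₀ *ᵥ w) i = if h : θ₀ i ≠ 0 then w ⟨i, h⟩ else 0 := by
  simp only [mulVec, dotProduct, padding, Matrix.of_apply, ite_mul, one_mul, zero_mul]
  split_ifs with h
  · rw [Finset.sum_eq_single ⟨i, h⟩]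
    · simp
    · intro j _ hj
      rw [if_neg]
      rintro rfl
      exact hj rfl
    · simp
  · refine Finset.sum_eq_zero fun j _ => if_neg ?_
    rintro rfl
    exact h j.2

open Classical in
-- This is the form taken by the covariance matrix of a padded random vector; it also makes positive
-- semidefiniteness evident.
lemma padMatrix_eq (θ₀ : Vec p) (S : Matrix (Active θ₀) (Active θ₀) ℝ) :
    padMatrix θ₀ S = padding θ₀ * S * (padding θ₀)ᵀ := by
  ext i j
  have h1 : ∀ k, (padding θ₀ * S) i k = if h : θ₀ i ≠ 0 then S ⟨i, h⟩ k else 0 := fun k =>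
    padding_mulVec θ₀ (fun l => S l k) i
  have h2 : (padding θ₀ * S * (padding θ₀)ᵀ) i j =
      (padding θ₀ *ᵥ fun k => (padding θ₀ * S) i k) j := by
    rw [mul_apply]
    simp only [mulVec, dotProduct, transpose_apply]
    exact Finset.sum_congr rfl fun k _ => mul_comm _ _
  rw [h2, padding_mulVec]
  simp only [h1, padMatrix, Matrix.of_apply]
  by_cases hi : θ₀ i ≠ 0 <;> by_cases hj : θ₀ j ≠ 0 <;> simp [hi, hj]

open Classical in
lemma posSemidef_padMatrix {θ₀ : Vec p} {S : Matrix (Active θ₀) (Active θ₀) ℝ}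
    (hS : S.PosSemidef) : (padMatrix θ₀ S).PosSemidef := by
  rw [padMatrix_eq, ← conjTranspose_eq_transpose_of_trivial]
  exact hS.mul_mul_conjTranspose_same _

lemma posDef_sandwich {J S : Mat p} (hJ : J.PosDef) (hS : S.PosSemidef) :
    (sandwich J S).PosDef := by
  have h1 := hS.mul_mul_conjTranspose_same J
  rw [hJ.isHermitian.eq] at h1
  exact hJ.add_posSemidef h1

end

/-! ### Joint limit of the treatment score and the control-group estimator -/

section

variable {p : ℕ}

lemma measurable_controlPart : Measurable (controlPart : Obs p → Obs p) :=
  Measurable.ite GLM.measurableSet_treated measurable_const measurable_id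

lemma measurable_controlData (n : ℕ) :
    Measurable (controlData : (Fin n → Obs p) → Fin n → Obs p) :=
  measurable_pi_lambda _ fun i => measurable_controlPart.comp (measurable_pi_apply i)

/-- The normalized score of the treatment group at `θ₀`. -/
def GLM.normScore (M : GLM) (θ₀ : Vec p) (n : ℕ) (d : Fin n → Obs p) : Vec p :=
  (Real.sqrt n)⁻¹ • ∑ i, M.treatedScore θ₀ (d i)

/-- The normalized estimation error of the active coordinates. -/
def normError (θ₀ : Vec p) (θhat : ∀ n : ℕ, (Fin n → Obs p) → Vec p) (n : ℕ)
    (d : Fin n → Obs p) : EuclideanSpace ℝ (Active θ₀) :=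
  WithLp.toLp 2 fun j : Active θ₀ => Real.sqrt n * (θhat n d j - θ₀ j)

namespace GLM

variable {M : GLM} (hM : M.IsRegular) {ρ : Measure (Vec p × Bool)} [IsProbabilityMeasure ρ]
  {θ₀ : Vec p} {ε : ℝ} {G : Obs p → ℝ} (hB : M.LocalBound ρ θ₀ ε G)
  {θhat : ∀ n : ℕ, (Fin n → Obs p) → Vec p} (hθhat : ∀ n, Measurable (θhat n))

include hM in
lemma IsRegular.measurable_normScore (n : ℕ) : Measurable (M.normScore θ₀ n) := by
  have := hM.measurable_treatedScore θ₀
  unfold normScore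
  fun_prop

include hθhat in
omit [IsProbabilityMeasure ρ] in
lemma measurable_normError (n : ℕ) : Measurable (normError θ₀ θhat n) := by
  have := hθhat n
  unfold normError
  fun_prop

include hM hB hθhat

open Classical in
/-- The score of the treatment group and the estimation error are jointly asymptotically normal
and asymptotically independent. -/
lemma IsRegular.weaklyTendsto_normScore_normError
    (hdet : IsUnit (M.infoBeta ρ θ₀ 0).det) {Sstar : Matrix (Active θ₀) (Active θ₀) ℝ}
    (hW : ConvergesInLaw (fun n => M.sampleLaw ρ θ₀ 0 n)
      (fun n d => normError θ₀ θhat n (controlData d)) (multivariateGaussian 0 Sstar)) :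
    WeaklyTendsto (fun n => M.sampleLaw ρ θ₀ 0 n)
      (fun n d => (M.normScore θ₀ n d, normError θ₀ θhat n (controlData d)))
      ((multivariateGaussian 0 (M.infoBeta ρ θ₀ 0)).prod (multivariateGaussian 0 Sstar)) := by
  have hP := hM.isProbabilityMeasure_obsLaw_zero hB
  have hPn : ∀ n, IsProbabilityMeasure (M.sampleLaw ρ θ₀ 0 n) := fun n => by
    unfold sampleLaw
    infer_instance
  have hU := fun n => hM.measurable_normScore (θ₀ := θ₀) n
  have hE := fun n => measurable_normError (θ₀ := θ₀) hθhat n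
  have hWm : ∀ n, Measurable fun d : Fin n → Obs p => normError θ₀ θhat n (controlData d) :=
    fun n => (hE n).comp (measurable_controlData n)
  refine weaklyTendsto_prod_of_tendsto_charFun hU hWm fun s t => ?_
  have hc := hM.integrable_curvature_mul_sq hB s
  -- The reduction `controlPart` is constant on treated observations and the score vanishes on
  -- controls, so any bounded function of the estimation error can serve as `F`.
  have hclt := conditional_clt (P := M.obsLaw ρ θ₀ 0) (T := {o : Obs p | o.1.2 = true})
    measurableSet_treated (hM.measure_treated_ne_zero hB hdet) (c := controlPart)
    measurable_controlPart (o₀ := ((0, true), 0)) (fun o ho => by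
      have : o.1.2 = true := ho
      simp [controlPart, this])
    (f := fun o => (inner ℝ s (M.treatedScore θ₀ o) : ℝ))
    (measurable_const.inner (hM.measurable_treatedScore θ₀))
    (fun o ho => by
      have : ¬ o.1.2 = true := ho
      simp [treatedScore, this])
    (hM.integral_inner_treatedScore hB.linPred_mem s hc)
    (hM.memLp_inner_treatedScore hB.linPred_mem s hc)
    (fun n d => Complex.exp ((inner ℝ (normError θ₀ θhat n d) t : ℝ) * Complex.I))
    (fun n => by
      have := hE n
      fun_prop)
    (fun n d => by rw [Complex.norm_exp_ofReal_mul_I])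
  have hchar := (hW.weaklyTendsto hWm).tendsto_charFun hWm t
  have h1 : charFun (multivariateGaussian 0 (M.infoBeta ρ θ₀ 0)) s =
      (Real.exp (-(∫ o, (inner ℝ s (M.treatedScore θ₀ o) : ℝ) ^ 2 ∂M.obsLaw ρ θ₀ 0) / 2) : ℂ) := by
    rw [charFun_multivariateGaussian (hM.posSemidef_infoBeta hB),
      ← hM.infoBeta_quadratic_eq_integral_sq hB s]
    simp [neg_div]
  rw [h1]
  -- The joint characteristic function is asymptotically a Gaussian constant times that of the
  -- error, whose limit is known from the oracle property.
  have h2 := hclt.add (hchar.const_mul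
    (Real.exp (-(∫ o, (inner ℝ s (M.treatedScore θ₀ o) : ℝ) ^ 2 ∂M.obsLaw ρ θ₀ 0) / 2) : ℂ))
  rw [zero_add] at h2
  refine h2.congr fun n => ?_
  refine (sub_add_cancel _ _).trans (integral_congr_ae (Eventually.of_forall fun d => ?_))
  have h3 : (inner ℝ (M.normScore θ₀ n d) s : ℝ) =
      (Real.sqrt n)⁻¹ * ∑ i, inner ℝ s (M.treatedScore θ₀ (d i)) := by
    rw [normScore, real_inner_smul_left, sum_inner]
    simp_rw [real_inner_comm s]
  simp only []
  rw [h3, mul_comm]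
  rfl

omit hθhat in
/-- The law of a sample under `β`, relative to `β = 0`. -/
lemma IsRegular.sampleLaw_eq_withDensity {β : Vec p} (hβ : β ∈ Metric.ball (0 : Vec p) ε) (n : ℕ) :
    M.sampleLaw ρ θ₀ β n = (M.sampleLaw ρ θ₀ 0 n).withDensity fun d => ∏ i, ENNReal.ofReal
      (Real.exp (M.logLik (linPred θ₀ β (d i).1.1 (d i).1.2) (d i).2 -
        M.logLik (linPred θ₀ 0 (d i).1.1 (d i).1.2) (d i).2)) := by
  have hP := hM.isProbabilityMeasure_obsLaw_zero hB
  have h1 : ∀ β : Vec p, Measurable fun o : Obs p => M.logLik (linPred θ₀ β o.1.1 o.1.2) o.2 :=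
    fun β => hM.measurable_logLik.comp
      (((measurable_linPred θ₀ β).comp measurable_fst).prodMk measurable_snd)
  have hQ : IsProbabilityMeasure (M.obsLaw ρ θ₀ β) := by
    refine hM.isProbabilityMeasure_obsLaw ?_
    filter_upwards [hB.range] with z hz
    exact hz θ₀ (Metric.mem_ball_self hB.pos) β hβ
  rw [hM.obsLaw_eq_withDensity] at hQ
  rw [sampleLaw, hM.obsLaw_eq_withDensity]
  exact pi_withDensity_eq (P := fun _ : Fin n => M.obsLaw ρ θ₀ 0) fun _ =>
    ((h1 β).sub (h1 0)).exp.ennreal_ofReal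

end GLM

end

/-! ### The limiting statistic and its law -/

section

variable {p : ℕ}

/-- The statistic as a function of the normalized score, the normalized estimation error, and of
quantities that converge in probability. -/
def limitStatistic (θ₀ : Vec p) (q : Vec p × EuclideanSpace ℝ (Active θ₀))
    (y : (Mat p × Mat p) × (Mat p × Vec p)) : ℝ :=
  let v : Vec p := WithLp.toLp 2 (padding θ₀ *ᵥ q.2.ofLp)
  let z : Vec p := q.1 - WithLp.toLp 2 (y.1.1 *ᵥ v.ofLp) + ‖v‖ • y.2.2
  z.ofLp ⬝ᵥ (sandwich y.1.2 y.2.1)⁻¹ *ᵥ z.ofLp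

/-- Inversion is continuous only at invertible matrices, so the claim is local in the second
argument, at values where the sandwich is positive definite. That suffices for Slutsky's lemma. -/
lemma continuousAt_limitStatistic {θ₀ : Vec p} {J S : Mat p} (hV : (sandwich J S).PosDef)
    (A : Mat p) (e : Vec p) (q : Vec p × EuclideanSpace ℝ (Active θ₀)) :
    ContinuousAt (Function.uncurry (limitStatistic θ₀)) (q, ((A, J), (S, e))) := by
  let X := (Vec p × EuclideanSpace ℝ (Active θ₀)) × ((Mat p × Mat p) × (Mat p × Vec p))
  have hv : Continuous fun x : X => (WithLp.toLp 2 (padding θ₀ *ᵥ x.1.2.ofLp) : Vec p) := by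
    fun_prop
  have hz : Continuous fun x : X => x.1.1 -
      WithLp.toLp 2 (x.2.1.1 *ᵥ (WithLp.toLp 2 (padding θ₀ *ᵥ x.1.2.ofLp) : Vec p).ofLp) +
      ‖(WithLp.toLp 2 (padding θ₀ *ᵥ x.1.2.ofLp) : Vec p)‖ • x.2.2.2 := by
    fun_prop
  have hs : Continuous fun x : X => sandwich x.2.1.2 x.2.2.1 :=
    continuous_sandwich.comp (by fun_prop : Continuous fun x : X => (x.2.1.2, x.2.2.1))
  have hinv : ContinuousAt (fun x : X => (sandwich x.2.1.2 x.2.2.1)⁻¹) (q, ((A, J), (S, e))) := by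
    refine ContinuousAt.comp (f := fun x : X => sandwich x.2.1.2 x.2.2.1) (g := Inv.inv)
      (continuousAt_matrix_inv _ ?_) hs.continuousAt
    rw [Ring.inverse_eq_inv']
    exact continuousAt_inv₀ hV.det_pos.ne'
  have h1 : Continuous fun y : Mat p × (Fin (p + 1) → ℝ) => y.2 ⬝ᵥ y.1 *ᵥ y.2 :=
    continuous_snd.dotProduct (continuous_fst.matrix_mulVec continuous_snd)
  have hz' : Continuous fun x : X => (x.1.1 -
      WithLp.toLp 2 (x.2.1.1 *ᵥ (WithLp.toLp 2 (padding θ₀ *ᵥ x.1.2.ofLp) : Vec p).ofLp) +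
      ‖(WithLp.toLp 2 (padding θ₀ *ᵥ x.1.2.ofLp) : Vec p)‖ • x.2.2.2).ofLp := by
    fun_prop
  exact ContinuousAt.comp (g := fun y : Mat p × (Fin (p + 1) → ℝ) => y.2 ⬝ᵥ y.1 *ᵥ y.2)
    h1.continuousAt (hinv.prodMk hz'.continuousAt)

/-- Exponential tilting of the first of two independent factors. -/
lemma multivariateGaussian_prod_tilt {F : Type*} [MeasurableSpace F] {J : Mat p}
    (hJ : J.PosSemidef) (δ : Vec p) (ν : Measure F) [SFinite ν] :
    ((multivariateGaussian 0 J).prod ν).withDensity (fun q => ENNReal.ofReal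
      (Real.exp (δ.ofLp ⬝ᵥ q.1.ofLp - δ.ofLp ⬝ᵥ J *ᵥ δ.ofLp / 2))) =
      (multivariateGaussian (WithLp.toLp 2 (J *ᵥ δ.ofLp)) J).prod ν := by
  have h1 : Measurable fun u : Vec p => ENNReal.ofReal
      (Real.exp (δ.ofLp ⬝ᵥ u.ofLp - δ.ofLp ⬝ᵥ J *ᵥ δ.ofLp / 2)) := by
    simp only [dotProduct]
    fun_prop
  rw [← multivariateGaussian_tilt hJ δ, prod_withDensity_left h1]

open Classical in
/-- The law of the limiting statistic under the limiting experiment. -/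
lemma map_limitStatistic {θ₀ : Vec p} {J : Mat p} (hJ : J.PosDef)
    {Sstar : Matrix (Active θ₀) (Active θ₀) ℝ} (hS : Sstar.PosSemidef) (δ : Vec p) :
    ((multivariateGaussian (WithLp.toLp 2 (J *ᵥ δ.ofLp)) J).prod
      (multivariateGaussian 0 Sstar)).map
        (fun q => limitStatistic θ₀ q ((J, J), (padMatrix θ₀ Sstar, 0))) =
      chiSquared (p + 1) (δ.ofLp ⬝ᵥ (J *ᵥ ((sandwich J (padMatrix θ₀ Sstar))⁻¹ *ᵥ
        (J *ᵥ δ.ofLp)))) := by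
  set V := sandwich J (padMatrix θ₀ Sstar) with hVdef
  have hJT : Jᵀ = J := by
    rw [← conjTranspose_eq_transpose_of_trivial]
    exact hJ.isHermitian
  have hV : V.PosDef := posDef_sandwich hJ (posSemidef_padMatrix hS)
  -- In the limit the score at the estimator is U − J·(padded W), so the linear map acting on W is
  -- −J times the padding; its sign disappears from the covariance.
  have hVeq : J + (-(J * padding θ₀)) * Sstar * (-(J * padding θ₀))ᵀ = V := by
    rw [hVdef, sandwich, padMatrix_eq, transpose_neg, transpose_mul, hJT]
    simp only [Matrix.neg_mul, Matrix.mul_neg, neg_neg, Matrix.mul_assoc]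
  have hmap := map_add_multivariateGaussian hJ.posSemidef hS (WithLp.toLp 2 (J *ᵥ δ.ofLp))
    (-(J * padding θ₀))
  rw [hVeq] at hmap
  have hfun : (fun q : Vec p × EuclideanSpace ℝ (Active θ₀) =>
      limitStatistic θ₀ q ((J, J), (padMatrix θ₀ Sstar, 0))) =
      (fun z : Vec p => z.ofLp ⬝ᵥ V⁻¹ *ᵥ z.ofLp) ∘
        fun q => q.1 + WithLp.toLp 2 (-(J * padding θ₀) *ᵥ q.2.ofLp) := by
    funext q
    simp only [limitStatistic, smul_zero, add_zero, Function.comp_apply, ← hVdef, neg_mulVec,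
      ← mulVec_mulVec, WithLp.toLp_neg, ← sub_eq_add_neg]
  rw [hfun, ← Measure.map_map (by simp only [dotProduct]; fun_prop) (by fun_prop), hmap,
    map_quadraticForm_multivariateGaussian _ hV]
  congr 1
  simp only []
  rw [dotProduct_mulVec δ.ofLp J, ← mulVec_transpose, hJT]

namespace GLM

variable {M : GLM} (hM : M.IsRegular) {ρ : Measure (Vec p × Bool)} [IsProbabilityMeasure ρ]
  {θ₀ : Vec p} {ε : ℝ} {G : Obs p → ℝ} (hB : M.LocalBound ρ θ₀ ε G)
  {θhat : ∀ n : ℕ, (Fin n → Obs p) → Vec p} (hθhat : ∀ n, Measurable (θhat n))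
  {Shat : ∀ n : ℕ, (Fin n → Obs p) → Vec p → Mat p}
  {Sstar : Matrix (Active θ₀) (Active θ₀) ℝ}

/-! ### Consequences of the oracle property -/

section Estimator

variable (horacle : OracleProperty (fun n => M.sampleLaw ρ θ₀ 0 n)
  (fun n d => θhat n (controlData d)) θ₀ Sstar)

include hM hB hθhat horacle

/-- With high probability, the estimation error vanishes off the active coordinates. -/
lemma IsRegular.eventually_error_eq : ∀ᶠ x : Σ n, Fin n → Obs p in
    whp fun n => M.sampleLaw ρ θ₀ 0 n,
      Real.sqrt x.1 • (θhat x.1 (controlData x.2) - θ₀) =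
        WithLp.toLp 2 (padding θ₀ *ᵥ (normError θ₀ θhat x.1 (controlData x.2)).ofLp) := by
  classical
  have hP := hM.isProbabilityMeasure_obsLaw_zero hB
  have hPn : ∀ n, IsProbabilityMeasure (M.sampleLaw ρ θ₀ 0 n) := fun n => by
    unfold sampleLaw
    infer_instance
  have hTm : ∀ n, Measurable fun d : Fin n → Obs p => θhat n (controlData d) := fun n =>
    (hθhat n).comp (measurable_controlData n)
  have hsel : ∀ᶠ x : Σ n, Fin n → Obs p in whp fun n => M.sampleLaw ρ θ₀ 0 n,
      ∀ j, θhat x.1 (controlData x.2) j ≠ 0 ↔ θ₀ j ≠ 0 := by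
    rw [eventually_whp]
    have h1 : ∀ n, MeasurableSet {d : Fin n → Obs p | ∀ j, θhat n (controlData d) j ≠ 0 ↔
        θ₀ j ≠ 0} := fun n => by
      have h2 : ∀ j, MeasurableSet {d : Fin n → Obs p | θhat n (controlData d) j ≠ 0} := fun j => by
        have h3 : Measurable fun d : Fin n → Obs p => θhat n (controlData d) j :=
          (show Measurable fun v : Vec p => v j by fun_prop).comp (hTm n)
        exact h3 (measurableSet_singleton (0 : ℝ)).compl
      rw [Set.ofPred_forall]
      exact MeasurableSet.iInter fun j => (h2 j).iff (MeasurableSet.const _)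
    have h2 := ENNReal.Tendsto.sub (tendsto_const_nhds (x := (1 : ENNReal))) horacle.selection
      (Or.inl ENNReal.one_ne_top)
    rw [tsub_self] at h2
    refine h2.congr fun n => ?_
    rw [← prob_compl_eq_one_sub (h1 n)]
    rfl
  filter_upwards [hsel] with x hx
  ext i
  change _ = (padding θ₀ *ᵥ (normError θ₀ θhat x.1 (controlData x.2)).ofLp) i
  rw [padding_mulVec]
  by_cases hi : θ₀ i ≠ 0
  · simp [hi, normError]
  · have h1 : θhat x.1 (controlData x.2) i = 0 := by
      by_contra h
      exact hi ((hx i).1 h)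
    simp only [ne_eq, not_not] at hi
    simp [hi, h1]

/-- After correct selection, the error is the padding of 1/√n times a weakly convergent, hence
bounded in probability, vector. -/
lemma IsRegular.tendsto_estimator : Tendsto (fun x : Σ n, Fin n → Obs p =>
    θhat x.1 (controlData x.2)) (whp fun n => M.sampleLaw ρ θ₀ 0 n) (𝓝 θ₀) := by
  classical
  have hP := hM.isProbabilityMeasure_obsLaw_zero hB
  have hPn : ∀ n, IsProbabilityMeasure (M.sampleLaw ρ θ₀ 0 n) := fun n => by
    unfold sampleLaw
    infer_instance
  have hWm : ∀ n, Measurable fun d : Fin n → Obs p => normError θ₀ θhat n (controlData d) :=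
    fun n => (measurable_normError hθhat n).comp (measurable_controlData n)
  have h1 := (horacle.normality.weaklyTendsto hWm).tendsto_smul_zero hWm
    (a := fun n : ℕ => (Real.sqrt n)⁻¹)
    (tendsto_inv_atTop_zero.comp (Real.tendsto_sqrt_atTop.comp tendsto_natCast_atTop_atTop))
  have h2 : Continuous fun w : EuclideanSpace ℝ (Active θ₀) =>
      θ₀ + WithLp.toLp 2 (padding θ₀ *ᵥ w.ofLp) := by fun_prop
  have h3 := (h2.tendsto 0).comp h1
  have h4 : θ₀ + WithLp.toLp 2 (padding θ₀ *ᵥ (0 : EuclideanSpace ℝ (Active θ₀)).ofLp) = θ₀ := by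
    simp
  rw [h4] at h3
  refine h3.congr' ?_
  filter_upwards [hM.eventually_error_eq hB hθhat horacle,
    (tendsto_fst_whp _).eventually (eventually_gt_atTop 0)] with x hx hn
  have hs : Real.sqrt x.1 ≠ 0 := by positivity
  have h5 : WithLp.toLp 2 (padding θ₀ *ᵥ ((Real.sqrt x.1)⁻¹ •
      normError θ₀ θhat x.1 (controlData x.2)).ofLp) =
      (Real.sqrt x.1)⁻¹ • WithLp.toLp 2 (padding θ₀ *ᵥ
        (normError θ₀ θhat x.1 (controlData x.2)).ofLp) := by
    rw [WithLp.ofLp_smul, mulVec_smul, WithLp.toLp_smul]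
  simp only [Function.comp_apply]
  rw [h5, ← hx, smul_smul, inv_mul_cancel₀ hs, one_smul]
  abel

/-- With high probability, the statistic is a function of the normalized score, the normalized
estimation error, and quantities that converge in probability. -/
lemma IsRegular.exists_llr_eq (hdet : IsUnit (M.infoBeta ρ θ₀ 0).det) (hSstar : Sstar.PosSemidef)
    (hconsistent : ∀ i j, ∀ ε > (0 : ℝ), Tendsto (fun n : ℕ => M.sampleLaw ρ θ₀ 0 n
      {d | ε ≤ |Shat n (controlData d) (θhat n (controlData d)) i j
        - padMatrix θ₀ Sstar i j|}) atTop (𝓝 0)) :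
    ∃ Y : (Σ n, Fin n → Obs p) → (Mat p × Mat p) × (Mat p × Vec p),
      Tendsto Y (whp fun n => M.sampleLaw ρ θ₀ 0 n)
        (𝓝 ((M.infoBeta ρ θ₀ 0, M.infoBeta ρ θ₀ 0), (padMatrix θ₀ Sstar, 0))) ∧
      ∀ᶠ x : Σ n, Fin n → Obs p in whp fun n => M.sampleLaw ρ θ₀ 0 n,
        M.llr 0 (θhat x.1 (controlData x.2)) (Shat x.1 (controlData x.2)) x.2 =
          limitStatistic θ₀ (M.normScore θ₀ x.1 x.2, normError θ₀ θhat x.1 (controlData x.2))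
            (Y x) := by
  set T : (Σ n, Fin n → Obs p) → Vec p := fun x => θhat x.1 (controlData x.2) with hTdef
  have hT : Tendsto T _ _ := hM.tendsto_estimator hB hθhat horacle
  obtain ⟨e, he, hexp⟩ := hM.exists_score_expansion hB hT
  have hS : Tendsto (fun x : Σ n, Fin n → Obs p => Shat x.1 (controlData x.2) (T x))
      (whp fun n => M.sampleLaw ρ θ₀ 0 n) (𝓝 (padMatrix θ₀ Sstar)) := by
    refine tendsto_pi_nhds.2 fun i => tendsto_pi_nhds.2 fun j => Metric.tendsto_nhds.2 fun κ hκ => ?_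
    rw [eventually_whp]
    refine (hconsistent i j κ hκ).congr fun n => ?_
    simp only [not_lt, Real.dist_eq]
    rfl
  have hA := hM.tendsto_sampleInfo hB hT
  have hA0 := hM.tendsto_sampleInfo hB (tendsto_const_nhds (x := θ₀))
  -- The information enters twice: at `θ₀` in the score expansion, and at the estimator in the
  -- sandwich.
  refine ⟨fun x => ((M.sampleInfo x.2 θ₀, M.sampleInfo x.2 (T x)),
    (Shat x.1 (controlData x.2) (T x), e x)), (hA0.prodMk_nhds hA).prodMk_nhds (hS.prodMk_nhds he),
    ?_⟩
  have hJ := hM.posDef_infoBeta hB hdet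
  have hV := posDef_sandwich hJ (posSemidef_padMatrix hSstar)
  filter_upwards [hM.eventually_error_eq hB hθhat horacle, hM.eventually_forall_mem_range hB,
    hT.eventually (Metric.ball_mem_nhds θ₀ hB.pos),
    (hA.prodMk_nhds hS).eventually (eventually_admissible hJ hV),
    (tendsto_fst_whp _).eventually (eventually_gt_atTop 0)] with x hx hr hTx hadm hn
  have hr' : ∀ k, (x.2 k).1.2 = true → inner ℝ (T x + 0) (x.2 k).1.1 ∈ M.predictorRange :=
    fun k _ => by
      rw [add_zero]
      exact hr k _ hTx
  have hβ := hM.infoBetaBar_eq hr'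
  have hθ := hM.infoThetaBar_eq hr'
  rw [add_zero] at hβ hθ
  rw [llr_eq hn hβ hθ hadm, hM.score_eq hr', add_zero, hexp x, hx]
  rfl

end Estimator

include hM hB hθhat in
/-- The limit law of the statistic under local alternatives. -/
theorem IsRegular.convergesInLaw_llr
    (horacle : OracleProperty (fun n => M.sampleLaw ρ θ₀ 0 n)
      (fun n d => θhat n (controlData d)) θ₀ Sstar)
    (hdet : IsUnit (M.infoBeta ρ θ₀ 0).det) (hSstar : Sstar.PosSemidef)
    (hconsistent : ∀ i j, ∀ ε > (0 : ℝ), Tendsto (fun n : ℕ => M.sampleLaw ρ θ₀ 0 n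
      {d | ε ≤ |Shat n (controlData d) (θhat n (controlData d)) i j
        - padMatrix θ₀ Sstar i j|}) atTop (𝓝 0)) (δ : Vec p) :
    ConvergesInLaw (fun n => M.sampleLaw ρ θ₀ ((Real.sqrt n)⁻¹ • δ) n)
      (fun n d => M.llr 0 (θhat n (controlData d)) (Shat n (controlData d)) d)
      (chiSquared (p + 1) (δ.ofLp ⬝ᵥ (M.infoBeta ρ θ₀ 0 *ᵥ
        ((sandwich (M.infoBeta ρ θ₀ 0) (padMatrix θ₀ Sstar))⁻¹ *ᵥ
          (M.infoBeta ρ θ₀ 0 *ᵥ δ.ofLp))))) := by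
  classical
  set J := M.infoBeta ρ θ₀ 0
  have hJ : J.PosDef := hM.posDef_infoBeta hB hdet
  have hV := posDef_sandwich hJ (posSemidef_padMatrix hSstar)
  -- For small `n` the alternative may leave the ball on which the model is known to give
  -- probability measures; replacing these finitely many terms does not affect the limit.
  let β : ℕ → Vec p := fun n =>
    if (Real.sqrt n)⁻¹ • δ ∈ Metric.ball (0 : Vec p) ε then (Real.sqrt n)⁻¹ • δ else 0
  have hβball : ∀ n, β n ∈ Metric.ball (0 : Vec p) ε := fun n => by
    by_cases h : (Real.sqrt n)⁻¹ • δ ∈ Metric.ball (0 : Vec p) ε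
    · simp only [β, h, if_true]
    · simpa only [β, h, if_false] using Metric.mem_ball_self hB.pos
  have hβ : ∀ᶠ n in atTop, β n = (Real.sqrt n)⁻¹ • δ := by
    have h3 : Tendsto (fun n : ℕ => (Real.sqrt n)⁻¹ • δ) atTop (𝓝 ((0 : ℝ) • δ)) :=
      (tendsto_inv_atTop_zero.comp (Real.tendsto_sqrt_atTop.comp
        tendsto_natCast_atTop_atTop)).smul_const δ
    rw [zero_smul] at h3
    filter_upwards [h3.eventually (Metric.ball_mem_nhds 0 hB.pos)] with n hn
    exact if_pos hn
  have hprob : ∀ b ∈ Metric.ball (0 : Vec p) ε, ∀ n,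
      IsProbabilityMeasure (M.sampleLaw ρ θ₀ b n) := fun b hb n => by
    have : IsProbabilityMeasure (M.obsLaw ρ θ₀ b) := by
      refine hM.isProbabilityMeasure_obsLaw ?_
      filter_upwards [hB.range] with z hz
      exact hz θ₀ (Metric.mem_ball_self hB.pos) b hb
    unfold sampleLaw
    infer_instance
  have hPn := hprob 0 (Metric.mem_ball_self hB.pos)
  have hQn : ∀ n, IsProbabilityMeasure (M.sampleLaw ρ θ₀ (β n) n) := fun n =>
    hprob _ (hβball n) n
  let ℓ : ∀ n, (Fin n → Obs p) → Fin n → ℝ := fun n d i =>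
    M.logLik (linPred θ₀ (β n) (d i).1.1 (d i).1.2) (d i).2 -
      M.logLik (linPred θ₀ 0 (d i).1.1 (d i).1.2) (d i).2
  let L : ∀ n, (Fin n → Obs p) → ENNReal := fun n d => ∏ i, ENNReal.ofReal (Real.exp (ℓ n d i))
  have hlog : ∀ b : Vec p, Measurable fun o : Obs p => M.logLik (linPred θ₀ b o.1.1 o.1.2) o.2 :=
    fun b => hM.measurable_logLik.comp
      (((measurable_linPred θ₀ b).comp measurable_fst).prodMk measurable_snd)
  have hL : ∀ n, Measurable (L n) := fun n => Finset.measurable_prod _ fun i _ =>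
    ((((hlog (β n)).sub (hlog 0)).comp (measurable_pi_apply i)).exp).ennreal_ofReal
  have hQ : ∀ n, M.sampleLaw ρ θ₀ (β n) n = (M.sampleLaw ρ θ₀ 0 n).withDensity (L n) :=
    fun n => hM.sampleLaw_eq_withDensity hB (hβball n) n
  let X : ∀ n, (Fin n → Obs p) → Vec p × EuclideanSpace ℝ (Active θ₀) := fun n d =>
    (M.normScore θ₀ n d, normError θ₀ θhat n (controlData d))
  have hX : ∀ n, Measurable (X n) := fun n => (hM.measurable_normScore n).prodMk
    ((measurable_normError hθhat n).comp (measurable_controlData n))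
  have hjoint : WeaklyTendsto (fun n => M.sampleLaw ρ θ₀ 0 n) X
      ((multivariateGaussian 0 J).prod (multivariateGaussian 0 Sstar)) :=
    hM.weaklyTendsto_normScore_normError hB hθhat hdet horacle.normality
  -- This is the likelihood ratio of the limiting Gaussian shift experiment. It involves only the
  -- score coordinate, so the law of the error is unchanged.
  let k : Vec p × EuclideanSpace ℝ (Active θ₀) → ℝ := fun q =>
    Real.exp (δ.ofLp ⬝ᵥ q.1.ofLp - δ.ofLp ⬝ᵥ J *ᵥ δ.ofLp / 2)
  have hk : Continuous k := by
    have : Continuous fun q : Vec p × EuclideanSpace ℝ (Active θ₀) => q.1.ofLp := by fun_prop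
    exact ((continuous_const.dotProduct this).sub continuous_const).rexp
  have hk0 : ∀ x, 0 ≤ k x := fun x => (Real.exp_pos _).le
  have hLk : ∀ η : ℝ, 0 ≤ η → η < 1 →
      ∀ᶠ x : Σ n, Fin n → Obs p in whp fun n => M.sampleLaw ρ θ₀ 0 n,
        ENNReal.ofReal (η * k (X x.1 x.2)) ≤ L x.1 x.2 := by
    intro η hη0 hη1
    have h1 := hM.tendsto_logLik_expansion hB δ hβ
    have h2 := (Real.continuous_exp.tendsto 0).comp h1
    rw [Real.exp_zero] at h2
    filter_upwards [h2.eventually (lt_mem_nhds hη1)] with x hx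
    simp only [Function.comp_apply] at hx
    simp only [L]
    rw [← ENNReal.ofReal_prod_of_nonneg fun i _ => (Real.exp_pos _).le, ← Real.exp_sum]
    refine ENNReal.ofReal_le_ofReal ?_
    have h3 := mul_le_mul_of_nonneg_right hx.le (hk0 (X x.1 x.2))
    refine h3.trans (le_of_eq ?_)
    simp only [k, X, normScore]
    rw [← Real.exp_add, inner_eq_dotProduct]
    congr 1
    simp only [ℓ, J]
    ring
  have htilt : ((multivariateGaussian 0 J).prod (multivariateGaussian 0 Sstar)).withDensity
      (fun q => ENNReal.ofReal (k q)) =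
      (multivariateGaussian (WithLp.toLp 2 (J *ᵥ δ.ofLp)) J).prod
        (multivariateGaussian 0 Sstar) :=
    multivariateGaussian_prod_tilt hJ.posSemidef δ _
  have hk1 : ∫⁻ q, ENNReal.ofReal (k q)
      ∂(multivariateGaussian 0 J).prod (multivariateGaussian 0 Sstar) = 1 := by
    have := congrArg (fun m => m Set.univ) htilt
    simpa using this
  -- By contiguity, the representation of the statistic and the convergence of `Y`, both proved
  -- under the null law, remain valid under the alternatives.
  have hcont : (whp fun n => M.sampleLaw ρ θ₀ (β n) n) ≤ whp fun n => M.sampleLaw ρ θ₀ 0 n :=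
    hjoint.contiguous hL hQ hX hk hk0 hLk hk1
  have hweak := hjoint.tilt hL hQ hX hk hk0 hLk
  rw [htilt] at hweak
  obtain ⟨Y, hY, hR⟩ := hM.exists_llr_eq hB hθhat horacle hdet hSstar hconsistent
  have hfc : FirstCountableTopology (Mat p) :=
    inferInstanceAs (FirstCountableTopology (Fin (p + 1) → Fin (p + 1) → ℝ))
  have hmain := hweak.convergesInLaw hX (hY.mono_left hcont) (H := limitStatistic θ₀)
    (R := fun n d => M.llr 0 (θhat n (controlData d)) (Shat n (controlData d)) d)
    (fun q => continuousAt_limitStatistic hV _ _ q) (hR.filter_mono hcont)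
  rw [map_limitStatistic hJ hSstar δ] at hmain
  intro B hBm hBf
  refine (hmain B hBm hBf).congr' ?_
  filter_upwards [hβ] with n hn
  rw [hn]

end GLM

end

end POST

end

theorem corollary1 {p : ℕ} (M : POST.GLM) (hM : M.IsRegular)
    (ρ : Measure (POST.Vec p × Bool)) [IsProbabilityMeasure ρ]
    (θ₀ β₀ : POST.Vec p) (hβ₀ : β₀ = 0)
    (hreg : M.RegularAt ρ θ₀ β₀)
    (hinfo : IsUnit (M.infoBeta ρ θ₀ β₀).det)
    -- the estimators are measurable functions of the control-group data
    (θhat : ∀ n : ℕ, (Fin n → POST.Obs p) → POST.Vec p)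
    (hθhat : ∀ n, Measurable (θhat n))
    (Shat : ∀ n : ℕ, (Fin n → POST.Obs p) → POST.Vec p → POST.Mat p)
    (hShat : ∀ n i j, Measurable fun d => Shat n d (θhat n d) i j)
    (Sstar : Matrix (POST.Active θ₀) (POST.Active θ₀) ℝ) (hSstar : Sstar.PosSemidef)
    (horacle : POST.OracleProperty (fun n => M.sampleLaw ρ θ₀ β₀ n)
      (fun n d => θhat n (POST.controlData d)) θ₀ Sstar)
    (hconsistent : ∀ i j, ∀ ε > (0 : ℝ), Tendsto (fun n : ℕ => M.sampleLaw ρ θ₀ β₀ n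
      {d | ε ≤ |Shat n (POST.controlData d) (θhat n (POST.controlData d)) i j
        - POST.padMatrix θ₀ Sstar i j|}) atTop (𝓝 0)) :
    -- under the null hypothesis
    POST.ConvergesInLaw (fun n => M.sampleLaw ρ θ₀ β₀ n)
      (fun n d => M.llr β₀ (θhat n (POST.controlData d)) (Shat n (POST.controlData d)) d)
      (POST.chiSquared (p + 1) 0) ∧
    -- under the local alternatives
    ∀ δ : POST.Vec p, δ ≠ 0 →
      POST.ConvergesInLaw
        (fun n => M.sampleLaw ρ θ₀ (β₀ + (Real.sqrt n)⁻¹ • δ) n)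
        (fun n d => M.llr β₀ (θhat n (POST.controlData d)) (Shat n (POST.controlData d)) d)
        (POST.chiSquared (p + 1)
          (δ.ofLp ⬝ᵥ (M.infoBeta ρ θ₀ β₀ *ᵥ
            ((POST.sandwich (M.infoTheta ρ θ₀ β₀) (POST.padMatrix θ₀ Sstar))⁻¹ *ᵥ
              (M.infoBeta ρ θ₀ β₀ *ᵥ δ.ofLp))))) := by
  subst hβ₀
  obtain ⟨ε, G, hB⟩ := hM.exists_localBound hreg
  have hmain := hM.convergesInLaw_llr hB hθhat horacle hinfo hSstar hconsistent
  rw [hM.infoTheta_eq hB]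
  refine ⟨?_, fun δ _ => ?_⟩
  -- The null hypothesis is the local alternative with `δ = 0`, where the noncentrality vanishes.
  · simpa using hmain 0
  · simpa using hmain δ
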